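/- **Setting.** Fix integers $K,R\ge 0$ and $\varepsilon>0$. Let $N=N_n\to\infty$, $T=T_n\to\infty$, and let $c=c_{N,T}>0$ satisfy $c_{N,T}\max\{N,T\}\to0$. For each $n$ let $\mathcal P=\mathcal P_n$ be a set of distributions $P$ of random $N\times T$ matrices $\Gamma,X,Z_1,\dots,Z_K,U$, and $\Theta=\Theta_n\subset\mathbb R^{1+K}$ a set of parameters $\theta=(\beta,\delta')'$. Observed are $W=(X,Z_1,\dots,Z_K)$ and $Y=X\beta+\sum_kZ_k\delta_k+\Gamma+U$. Write $\langle A,B\rangle_F=\sum_{i,t}A_{it}B_{it}$, $\|\cdot\|_F$ for the Frobenius norm, $s_r(\cdot)$ for the $r$-th largest singular value, $\operatorname{Lind}(A)=\max_{i,t}A_{it}^2/\sum_{i,t}A_{it}^2$, and $W\cdot\gamma=X\gamma_0+\sum_kZ_k\gamma_k$. **Uniform asymptotics.** $A_{n}=\mathcal O_{\Theta,\mathcal P}(r_n)$ means: for every $\epsilon'>0$ there is $C<\infty$ with $\limsup_n\sup_{P\in\mathcal P,\theta\in\Theta}\mathbb P_{P,\theta}(r_n^{-1}\|A_n\|\ge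 C)\le\epsilon'$. $A_n=o_{\Theta,\mathcal P}(r_n)$ means: $\sup_{P,\theta}\mathbb P_{P,\theta}(r_n^{-1}\|A_n\|\ge\epsilon')\to0$ for every $\epsilon'>0$. $A_n\asymp_{\Theta,\mathcal P}r_n$ means $A_n=\mathcal O_{\Theta,\mathcal P}(r_n)$ and $A_n^{-1}=\mathcal O_{\Theta,\mathcal P}(r_n^{-1})$ (with $0^{-1}=\infty$, and the norm of the inverse of a singular matrix is $\infty$). $A_n\to_d N(0,1)$ uniformly means $\sup_{P,\theta}|\mathbb P_{P,\theta}(A_n\le x)-\Phi(x)|\to0$ for every $x\in\mathbb R$. **Procedure.** Let $b=4R(\sqrt N+\sqrt T)$. Write $W_0=X$, $W_k=Z_k$. For $j=0,\dots,K$ let $A^{(j)}$ be a measurable function of $W$ that minimizes $\|A\|_F^2+b^2s_1(A)^2$ subject to $\operatorname{Lind}(A)\le c$, $\langle A,W_j\rangle_F=1$, $\langle A,W_k\rangle_F=0$ for $k\ne j$, whenever a minimizer exists. Let $(\hat\gamma_{LS},\hat\Gamma_{LS})$ be a measurable function of $(Y,W)$ that minimizes $\|Y-W\cdot\gamma-G\|_F^2$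 over $\gamma\in\mathbb R^{K+1}$ and $G$ with $\operatorname{rank}G\le R$, whenever a minimizer exists. Let $\hat\gamma_{pre,j}=\langle A^{(j)},Y-\hat\Gamma_{LS}\rangle_F$ for each $j$, let $\hat\Gamma_{pre}$ (measurable in $(Y,W)$) minimize $\|Y-W\cdot\hat\gamma_{pre}-G\|_F^2$ over $\operatorname{rank}G\le R$, and let $\hat U_{pre}=Y-W\cdot\hat\gamma_{pre}-\hat\Gamma_{pre}$, $\hat U=Y-W\cdot\hat\gamma_{LS}-\hat\Gamma_{LS}$. With $A=A^{(0)}$ set $$\hat\beta=\langle A,Y-\hat\Gamma_{pre}\rangle_F,\quad \hat C=4R\,s_1(\hat U_{pre})(1+\varepsilon),\quad \overline{\operatorname{bias}}_{\hat C}(\hat\beta)=\hat C\,s_1(A),\quad \widehat{\mathrm{se}}^2=\sum_{i,t}A_{it}^2\hat U_{it}^2 .$$ **Assumptions.** 1. *Factor model.* $\operatorname{rank}\Gamma\le R$ almost surely for every $P\in\mathcal P$, and: (i) for some constant $\underline s^2>0$, $\min_{\|\gamma\|=1}\frac1{NT}\sum_{r=2R+1}^{\min\{N,T\}}s_r^2(W\cdot\gamma)\ge\underline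 s^2$ with probability approaching one uniformly; (ii) $s_1(X),s_1(Z_k)=\mathcal O_{\Theta,\mathcal P}(\sqrt{NT})$ for all $k$, and $s_1(U)\asymp_{\Theta,\mathcal P}\max\{\sqrt N,\sqrt T\}$; (iii) $\frac1{\sqrt{NT}}\langle X,U\rangle_F$ and $\frac1{\sqrt{NT}}\langle Z_k,U\rangle_F$ are $\mathcal O_{\Theta,\mathcal P}(1)$ for all $k$; (iv) $(s_1(U)-s_r(U))/s_1(U)=o_{\Theta,\mathcal P}(1)$ for every fixed positive integer $r$. 2. *Regressors.* For each $j=0,\dots,K$ and each $P\in\mathcal P$ there are coefficients $\pi=\pi_P$ and random matrices $H,V$ with $W_j=\sum_{k\ne j}\pi_kW_k+H+V$ almost surely, such that $\|V\|_F\asymp_{\Theta,\mathcal P}\sqrt{NT}$; $s_1(V)=\mathcal O_{\Theta,\mathcal P}(\max\{\sqrt N,\sqrt T\})$; $\|H\|_F$ and $\langle H,V\rangle_F$ are $\mathcal O_{\Theta,\mathcal P}(\sqrt{NT})$; $\|W_k\|_F$ and $\langle W_k,V\rangle_F$ are $\mathcal O_{\Theta,\mathcal P}(\sqrt{NT})$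 for $k\ne j$; the inverse of the Gram matrix $(\langle W_k,W_l\rangle_F)_{k,l\ne j}$ is $\mathcal O_{\Theta,\mathcal P}(1/(NT))$; $\max_{i,t}V_{it}^2=o_{\Theta,\mathcal P}(NT\,c_{N,T})$; and $\max_{i,t}W_{k,it}^2=o_{\Theta,\mathcal P}((NT)^2c_{N,T})$ for $k\ne j$. 3. *Errors.* There are constants $\underline\sigma>0$, $\eta>0$ such that for all $n$ and $P\in\mathcal P_n$ the $U_{it}$ are independent over $i,t$ conditional on $(W,\Gamma)$ and, almost surely for all $i,t$, $\mathbb E_P[U_{it}\mid W,\Gamma]=0$, $\mathbb E_P[U_{it}^2\mid W,\Gamma]>\underline\sigma^2$, $\mathbb E_P[U_{it}^4\mid W,\Gamma]<1/\eta$. **Conclusion.** Under these assumptions: (a) the standard error is consistent: $\widehat{\mathrm{se}}\Big/\sqrt{\sum_{i,t}A_{it}^2\,\mathbb E_P[U_{it}^2\mid W,\Gamma]}-1=o_{\Theta,\mathcal P}(1)$; (b) $\langle A,U\rangle_F/\widehat{\mathrm{se}}\to_dN(0,1)$ uniformly over $\Theta,\mathcal P$; (c) $\hat\beta-\beta=\mathcal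 O_{\Theta,\mathcal P}(1/\min\{N,T\})$; (d) for every $\alpha\in(0,1)$, with $z_{1-\alpha/2}$ the standard normal quantile, $$\liminf_n\ \inf_{\theta\in\Theta,P\in\mathcal P}\mathbb P_{\theta,P}\Big(\beta\in\big\{\hat\beta\pm[\overline{\operatorname{bias}}_{\hat C}(\hat\beta)+z_{1-\alpha/2}\widehat{\mathrm{se}}]\big\}\Big)\ge1-\alpha .$$ -/

import Mathlib

open MeasureTheory ProbabilityTheory Filter Topology
open scoped ENNReal NNReal

noncomputable section

namespace PanelDebias

/-! ### Matrices -/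

/-- Real `N × T` matrices, with the product σ-algebra. -/
abbrev Panel (N T : ℕ) : Type := Fin N → Fin T → ℝ

/-- A list of `K + 1` regressor matrices: index `0` is `X`, index `k` (for `1 ≤ k ≤ K`) is `Z_k`. -/
abbrev Regressors (N T K : ℕ) : Type := Fin (K + 1) → Panel N T

/-- The coefficient vector `γ = (β, δ')'`: index `0` is `β`, index `k ≥ 1` is `δ_k`. -/
abbrev Coef (K : ℕ) : Type := Fin (K + 1) → ℝ

/-- The entrywise inner product `⟨A, B⟩_F`. -/
def ip {N T : ℕ} (A B : Panel N T) : ℝ := ∑ i, ∑ t, A i t * B i t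

/-- The Frobenius norm. -/
def frob {N T : ℕ} (A : Panel N T) : ℝ := Real.sqrt (∑ i, ∑ t, A i t ^ 2)

/-- The `r`-th largest singular value `s_r(A)`, for `r ≥ 1` (zero for `r > min N T`). Mathlib
numbers singular values from `0`. -/
def sv {N T : ℕ} (r : ℕ) (A : Panel N T) : ℝ :=
  (Matrix.toEuclideanLin (Matrix.of A)).singularValues (r - 1)

/-- The rank of a panel, as a matrix. -/
def rk {N T : ℕ} (A : Panel N T) : ℕ := (Matrix.of A).rank

/-- `max_{i,t} A_{it}^2`. -/
def maxSq {N T : ℕ} (A : Panel N T) : ℝ := ⨆ p : Fin N × Fin T, A p.1 p.2 ^ 2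

/-- The Lindeberg weight `Lind(A) = max_{i,t} A_{it}^2 / ∑_{i,t} A_{it}^2`. -/
def lind {N T : ℕ} (A : Panel N T) : ℝ := maxSq A / ∑ i, ∑ t, A i t ^ 2

/-- The linear combination `W · γ = X β + ∑_k Z_k δ_k`. -/
def comb {N T K : ℕ} (W : Regressors N T K) (γ : Coef K) : Panel N T :=
  fun i t => ∑ k, γ k * W k i t

/-- The Gram matrix of (the vectorizations of) all regressors except the `j`-th. For `j = 0` this is
`𝐙'𝐙` with `𝐙 = [vec Z_1, …, vec Z_K]`. -/
def gramExcept {N T K : ℕ} (W : Regressors N T K) (j : Fin (K + 1)) :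
    Matrix {k : Fin (K + 1) // k ≠ j} {k : Fin (K + 1) // k ≠ j} ℝ :=
  Matrix.of fun k l => ip (W k) (W l)

open Classical in
/-- The norm `‖G⁻¹‖ ∈ [0, ∞]` of the inverse of a square matrix (Frobenius norm), equal to `∞` when
`G` is singular. -/
def invNorm {ι : Type*} [Fintype ι] (G : Matrix ι ι ℝ) : ℝ≥0∞ :=
  if IsUnit G.det then ENNReal.ofReal (Real.sqrt (∑ k, ∑ l, G⁻¹ k l ^ 2)) else ⊤

/-! ### The data -/

/-- Random matrices `Γ`, `W = (X, Z_1, …, Z_K)` and `U` on a common measurable space. -/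
structure FactorPanel (Ω : Type*) [MeasurableSpace Ω] (N T K : ℕ) where
  /-- the individual effects -/
  Γ : Ω → Panel N T
  /-- the regressors -/
  W : Ω → Regressors N T K
  /-- the errors -/
  U : Ω → Panel N T
  measurable_Γ : Measurable Γ
  measurable_W : Measurable W
  measurable_U : Measurable U

namespace FactorPanel

variable {Ω : Type*} [mΩ : MeasurableSpace Ω] {N T K : ℕ}

/-- The observed outcome `Y = X β + Z · δ + Γ + U` under the parameter `θ = (β, δ')'`. -/
def Y (D : FactorPanel Ω N T K) (θ : Coef K) (ω : Ω) : Panel N T :=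
  comb (D.W ω) θ + D.Γ ω + D.U ω

/-- The σ-algebra generated by `(W, Γ)`. -/
abbrev info (D : FactorPanel Ω N T K) : MeasurableSpace Ω :=
  MeasurableSpace.comap (fun ω => (D.W ω, D.Γ ω)) inferInstance

theorem info_le (D : FactorPanel Ω N T K) : D.info ≤ mΩ :=
  (D.measurable_W.prodMk D.measurable_Γ).comap_le

/-- The conditional variance `σ_{it}^2 = 𝔼_P[U_{it}^2 | W, Γ]` (for conditionally centred errors). -/
def condVar (D : FactorPanel Ω N T K) (P : Measure Ω) (i : Fin N) (t : Fin T) : Ω → ℝ :=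
  P[fun ω => D.U ω i t ^ 2 | D.info]

end FactorPanel

/-! ### The estimator and the confidence interval -/

/-- The tuning parameter `b^* = 4 R (√N + √T)`. -/
def bStar (N T R : ℕ) : ℝ := 4 * R * (Real.sqrt N + Real.sqrt T)

/-- The constraints `Lind(A) ≤ c`, `⟨A, W_j⟩ = 1` and `⟨A, W_k⟩ = 0` for `k ≠ j`. -/
def IsFeasibleWeight {N T K : ℕ} (W : Regressors N T K) (j : Fin (K + 1)) (c : ℝ)
    (A : Panel N T) : Prop :=
  lind A ≤ c ∧ ip A (W j) = 1 ∧ ∀ k, k ≠ j → ip A (W k) = 0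

/-- `A` minimizes `‖A‖_F^2 + b^2 s_1(A)^2` subject to the constraints. For `j = 0` this is the
weight matrix `A^*_{b,c}` for the coefficient of `X`; for `j ≥ 1` the roles of `X` and `Z_j` are
interchanged. -/
def IsOptimalWeight {N T K : ℕ} (W : Regressors N T K) (j : Fin (K + 1)) (b c : ℝ)
    (A : Panel N T) : Prop :=
  IsFeasibleWeight W j c A ∧ ∀ B, IsFeasibleWeight W j c B →
    frob A ^ 2 + b ^ 2 * sv 1 A ^ 2 ≤ frob B ^ 2 + b ^ 2 * sv 1 B ^ 2

/-- `(γ, G)` minimizes the sum of squared residuals `‖Y - W · γ - G‖_F^2` over all coefficients and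
all matrices `G` of rank at most `R`. -/
def IsLeastSquares {N T K : ℕ} (R : ℕ) (Y : Panel N T) (W : Regressors N T K)
    (q : Coef K × Panel N T) : Prop :=
  rk q.2 ≤ R ∧ ∀ (γ : Coef K) (G : Panel N T), rk G ≤ R →
    frob (Y - comb W q.1 - q.2) ^ 2 ≤ frob (Y - comb W γ - G) ^ 2

/-- `G` is a best approximation of `E` in Frobenius norm among the matrices of rank at most `R`. -/
def IsBestLowRank {N T : ℕ} (R : ℕ) (E G : Panel N T) : Prop :=
  rk G ≤ R ∧ ∀ G' : Panel N T, rk G' ≤ R → frob (E - G) ^ 2 ≤ frob (E - G') ^ 2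

/-- The optimal weights and the least squares estimator, as measurable functions of the data. The
minimizers need not be unique, so these are arbitrary measurable selections from the sets of
minimizers; nothing is required at data for which there is no minimizer. -/
structure FirstStage (N T K R : ℕ) (c : ℝ) where
  /-- the weights for the coefficient of the `j`-th regressor, a function of the regressors -/
  weights : Fin (K + 1) → Regressors N T K → Panel N T
  measurable_weights : ∀ j, Measurable (weights j)
  weights_optimal : ∀ j W, (∃ A, IsOptimalWeight W j (bStar N T R) c A) →
    IsOptimalWeight W j (bStar N T R) c (weights j W)
  /-- the least squares estimator `(γ̂_LS, Γ̂_LS)`, a function of `(Y, W)` -/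
  ls : Panel N T × Regressors N T K → Coef K × Panel N T
  measurable_ls : Measurable ls
  ls_optimal : ∀ Y W, (∃ q, IsLeastSquares R Y W q) → IsLeastSquares R Y W (ls (Y, W))

/-- The preliminary estimate `γ̂_pre`, with `j`-th entry `⟨A^{(j)}, Y - Γ̂_LS⟩_F`. -/
def FirstStage.gammaPre {N T K R : ℕ} {c : ℝ} (F : FirstStage N T K R c)
    (d : Panel N T × Regressors N T K) : Coef K :=
  fun j => ip (F.weights j d.2) (d.1 - (F.ls d).2)

/-- The full procedure: in addition to the first stage, a measurable selection `Γ̂_pre` of the best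
rank-`R` approximation of `Y - W · γ̂_pre`. -/
structure Procedure (N T K R : ℕ) (c : ℝ) extends FirstStage N T K R c where
  /-- the estimate `Γ̂_pre`, a function of `(Y, W)` -/
  GammaPre : Panel N T × Regressors N T K → Panel N T
  measurable_GammaPre : Measurable GammaPre
  GammaPre_optimal : ∀ d, IsBestLowRank R (d.1 - comb d.2 (toFirstStage.gammaPre d)) (GammaPre d)

namespace Procedure

variable {N T K R : ℕ} {c : ℝ}

/-- The weight matrix `A = A^*_{b^*, c}` of the final estimator. -/
def A (F : Procedure N T K R c) (d : Panel N T × Regressors N T K) : Panel N T :=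
  F.weights 0 d.2

/-- The debiased estimator `β̂ = ⟨A, Y - Γ̂_pre⟩_F`. -/
def betaHat (F : Procedure N T K R c) (d : Panel N T × Regressors N T K) : ℝ :=
  ip (F.A d) (d.1 - F.GammaPre d)

/-- The residual `Û_pre = Y - W · γ̂_pre - Γ̂_pre`. -/
def UPre (F : Procedure N T K R c) (d : Panel N T × Regressors N T K) : Panel N T :=
  d.1 - comb d.2 (F.gammaPre d) - F.GammaPre d

/-- The residual `Û = Y - W · γ̂_LS - Γ̂_LS` of the least squares estimator. -/
def UHat (F : Procedure N T K R c) (d : Panel N T × Regressors N T K) : Panel N T :=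
  d.1 - comb d.2 (F.ls d).1 - (F.ls d).2

/-- The bound `Ĉ = 4 R s_1(Û_pre) (1 + ε)` on the nuclear norm of `Γ̂_pre - Γ`. -/
def CHat (F : Procedure N T K R c) (ε : ℝ) (d : Panel N T × Regressors N T K) : ℝ :=
  4 * R * sv 1 (F.UPre d) * (1 + ε)

/-- The worst-case bias `Ĉ s_1(A)`. -/
def biasBound (F : Procedure N T K R c) (ε : ℝ) (d : Panel N T × Regressors N T K) : ℝ :=
  F.CHat ε d * sv 1 (F.A d)

/-- The standard error `√(∑_{i,t} A_{it}^2 Û_{it}^2)`. -/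
def se (F : Procedure N T K R c) (d : Panel N T × Regressors N T K) : ℝ :=
  Real.sqrt (∑ i, ∑ t, F.A d i t ^ 2 * F.UHat d i t ^ 2)

end Procedure

/-- The `p`-quantile `z_p` of the standard normal distribution, for `0 < p < 1`. -/
def normalQuantile (p : ℝ) : ℝ := sInf {x : ℝ | p ≤ cdf (gaussianReal 0 1) x}

/-- The bias-aware confidence interval `{β̂ ± [Ĉ s_1(A) + z_{1-α/2} se]}`. -/
def Procedure.CI {N T K R : ℕ} {c : ℝ} (F : Procedure N T K R c) (ε α : ℝ)
    (d : Panel N T × Regressors N T K) : Set ℝ :=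
  Set.Icc (F.betaHat d - (F.biasBound ε d + normalQuantile (1 - α / 2) * F.se d))
    (F.betaHat d + (F.biasBound ε d + normalQuantile (1 - α / 2) * F.se d))

/-! ### Uniform stochastic order symbols -/

section Uniform

variable {Ω : ℕ → Type*} [∀ n, MeasurableSpace (Ω n)] {K : ℕ}

/-- `sup_{P ∈ Pr_n, θ ∈ Θ_n} ℙ_P(E_n(P, θ))`. -/
def supProb (Pr : ∀ n, Set (ProbabilityMeasure (Ω n))) (Θ : ℕ → Set (Coef K))
    (E : ∀ n, ProbabilityMeasure (Ω n) → Coef K → Set (Ω n)) (n : ℕ) : ℝ≥0∞ :=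
  ⨆ P ∈ Pr n, ⨆ θ ∈ Θ n, (P : Measure (Ω n)) (E n P θ)

/-- `a = 𝒪_{Θ,Pr}(r)`, for random quantities `a_n(P, θ)` with values in `[0, ∞]` (norms, or inverses
of norms with `0⁻¹ = ∞`) and rates `r_n`. -/
def UnifBigO (Pr : ∀ n, Set (ProbabilityMeasure (Ω n))) (Θ : ℕ → Set (Coef K))
    (a : ∀ n, ProbabilityMeasure (Ω n) → Coef K → Ω n → ℝ≥0∞) (r : ℕ → ℝ) : Prop :=
  ∀ ε : ℝ≥0, 0 < ε → ∃ C : ℝ≥0,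
    limsup (supProb Pr Θ fun n P θ => {ω | (C : ℝ≥0∞) ≤ a n P θ ω / ENNReal.ofReal (r n)}) atTop ≤ ε

/-- `a = o_{Θ,Pr}(r)`. -/
def UnifLittleO (Pr : ∀ n, Set (ProbabilityMeasure (Ω n))) (Θ : ℕ → Set (Coef K))
    (a : ∀ n, ProbabilityMeasure (Ω n) → Coef K → Ω n → ℝ≥0∞) (r : ℕ → ℝ) : Prop :=
  ∀ ε : ℝ≥0, 0 < ε →
    Tendsto (supProb Pr Θ fun n P θ => {ω | (ε : ℝ≥0∞) ≤ a n P θ ω / ENNReal.ofReal (r n)})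
      atTop (𝓝 0)

/-- `a ≍_{Θ,Pr} r`: both `a = 𝒪_{Θ,Pr}(r)` and `a⁻¹ = 𝒪_{Θ,Pr}(r⁻¹)`. -/
def UnifTheta (Pr : ∀ n, Set (ProbabilityMeasure (Ω n))) (Θ : ℕ → Set (Coef K))
    (a : ∀ n, ProbabilityMeasure (Ω n) → Coef K → Ω n → ℝ≥0∞) (r : ℕ → ℝ) : Prop :=
  UnifBigO Pr Θ a r ∧ UnifBigO Pr Θ (fun n P θ ω => (a n P θ ω)⁻¹) (fun n => (r n)⁻¹)

/-- Convergence in distribution of the real random variables `a_n(P, θ)` to `N(0, 1)`, uniformly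
over `Θ` and `Pr`: `sup_{P, θ} |ℙ_P(a_n(P, θ) ≤ x) - Φ(x)| → 0` for every `x`. -/
def UnifStdNormal (Pr : ∀ n, Set (ProbabilityMeasure (Ω n))) (Θ : ℕ → Set (Coef K))
    (a : ∀ n, ProbabilityMeasure (Ω n) → Coef K → Ω n → ℝ) : Prop :=
  ∀ x : ℝ, Tendsto (fun n => ⨆ P ∈ Pr n, ⨆ θ ∈ Θ n,
    ‖(P : Measure (Ω n)).real {ω | a n P θ ω ≤ x} - cdf (gaussianReal 0 1) x‖ₑ) atTop (𝓝 0)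

/-! ### Assumptions -/

variable {N T : ℕ → ℕ}

/-- `rank Γ ≤ R` with probability one, for all `P`. -/
def RankBound (Pr : ∀ n, Set (ProbabilityMeasure (Ω n)))
    (D : ∀ n, FactorPanel (Ω n) (N n) (T n) K) (R : ℕ) : Prop :=
  ∀ n, ∀ P ∈ Pr n, ∀ᵐ ω ∂(P : Measure (Ω n)), rk ((D n).Γ ω) ≤ R

/-- Generalized non-collinearity: for some constant `s² > 0`,
`min_{‖γ‖ = 1} (NT)⁻¹ ∑_{r = 2R+1}^{min(N,T)} s_r(W · γ)² ≥ s²` with probability approaching one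
uniformly. -/
def NonCollinear (Pr : ∀ n, Set (ProbabilityMeasure (Ω n))) (Θ : ℕ → Set (Coef K))
    (D : ∀ n, FactorPanel (Ω n) (N n) (T n) K) (R : ℕ) : Prop :=
  ∃ s2 : ℝ, 0 < s2 ∧ Tendsto (supProb Pr Θ fun n _ _ =>
    {ω | ∀ γ : Coef K, ∑ k, γ k ^ 2 = 1 →
      s2 ≤ 1 / ((N n : ℝ) * T n) *
        ∑ r ∈ Finset.Icc (2 * R + 1) (min (N n) (T n)), sv r (comb ((D n).W ω) γ) ^ 2}ᶜ)
    atTop (𝓝 0)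

/-- `s_1(X), s_1(Z_k) = 𝒪(√(NT))` and `s_1(U) ≍ max(√N, √T)`. -/
def SpectralNorms (Pr : ∀ n, Set (ProbabilityMeasure (Ω n))) (Θ : ℕ → Set (Coef K))
    (D : ∀ n, FactorPanel (Ω n) (N n) (T n) K) : Prop :=
  (∀ k, UnifBigO Pr Θ (fun n _ _ ω => ENNReal.ofReal (sv 1 ((D n).W ω k)))
    (fun n => Real.sqrt ((N n : ℝ) * T n))) ∧
  UnifTheta Pr Θ (fun n _ _ ω => ENNReal.ofReal (sv 1 ((D n).U ω)))
    (fun n => max (Real.sqrt (N n)) (Real.sqrt (T n)))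

/-- `(NT)^{-1/2} ⟨X, U⟩_F = 𝒪(1)` and `(NT)^{-1/2} ⟨Z_k, U⟩_F = 𝒪(1)`. -/
def Exogeneity (Pr : ∀ n, Set (ProbabilityMeasure (Ω n))) (Θ : ℕ → Set (Coef K))
    (D : ∀ n, FactorPanel (Ω n) (N n) (T n) K) : Prop :=
  ∀ k, UnifBigO Pr Θ
    (fun n _ _ ω => ‖1 / Real.sqrt ((N n : ℝ) * T n) * ip ((D n).W ω k) ((D n).U ω)‖ₑ) (fun _ => 1)

/-- `(s_1(U) - s_r(U)) / s_1(U) = o(1)` for every fixed positive integer `r`. -/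
def LeadingSingularValues (Pr : ∀ n, Set (ProbabilityMeasure (Ω n))) (Θ : ℕ → Set (Coef K))
    (D : ∀ n, FactorPanel (Ω n) (N n) (T n) K) : Prop :=
  ∀ r : ℕ, 1 ≤ r → UnifLittleO Pr Θ
    (fun n _ _ ω => ‖(sv 1 ((D n).U ω) - sv r ((D n).U ω)) / sv 1 ((D n).U ω)‖ₑ) (fun _ => 1)

/-- The decomposition `W_j = ∑_{k ≠ j} π_k W_k + H + V` of the `j`-th regressor, with its
conditions. For `j = 0` it decomposes `X = Z · π + H + V`; for `j ≥ 1` the roles of `X` and `Z_j` are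
interchanged. -/
def RegressorDecomposition (Pr : ∀ n, Set (ProbabilityMeasure (Ω n))) (Θ : ℕ → Set (Coef K))
    (D : ∀ n, FactorPanel (Ω n) (N n) (T n) K) (c : ℕ → ℝ) (j : Fin (K + 1)) : Prop :=
  ∃ (π : ∀ n, ProbabilityMeasure (Ω n) → Coef K)
    (H V : ∀ n, ProbabilityMeasure (Ω n) → Ω n → Panel (N n) (T n)),
    (∀ n, ∀ P ∈ Pr n, Measurable (H n P) ∧ Measurable (V n P) ∧
      ∀ᵐ ω ∂(P : Measure (Ω n)), (D n).W ω j =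
        ∑ k ∈ Finset.univ.erase j, π n P k • (D n).W ω k + H n P ω + V n P ω) ∧
    UnifTheta Pr Θ (fun n P _ ω => ENNReal.ofReal (frob (V n P ω)))
      (fun n => Real.sqrt ((N n : ℝ) * T n)) ∧
    UnifBigO Pr Θ (fun n P _ ω => ENNReal.ofReal (sv 1 (V n P ω)))
      (fun n => max (Real.sqrt (N n)) (Real.sqrt (T n))) ∧
    UnifBigO Pr Θ (fun n P _ ω => ENNReal.ofReal (frob (H n P ω)))
      (fun n => Real.sqrt ((N n : ℝ) * T n)) ∧
    UnifBigO Pr Θ (fun n P _ ω => ‖ip (H n P ω) (V n P ω)‖ₑ)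
      (fun n => Real.sqrt ((N n : ℝ) * T n)) ∧
    (∀ k, k ≠ j →
      UnifBigO Pr Θ (fun n _ _ ω => ENNReal.ofReal (frob ((D n).W ω k)))
        (fun n => Real.sqrt ((N n : ℝ) * T n)) ∧
      UnifBigO Pr Θ (fun n P _ ω => ‖ip ((D n).W ω k) (V n P ω)‖ₑ)
        (fun n => Real.sqrt ((N n : ℝ) * T n))) ∧
    UnifBigO Pr Θ (fun n _ _ ω => invNorm (gramExcept ((D n).W ω) j))
      (fun n => 1 / ((N n : ℝ) * T n)) ∧
    UnifLittleO Pr Θ (fun n P _ ω => ENNReal.ofReal (maxSq (V n P ω)))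
      (fun n => (N n : ℝ) * T n * c n) ∧
    (∀ k, k ≠ j →
      UnifLittleO Pr Θ (fun n _ _ ω => ENNReal.ofReal (maxSq ((D n).W ω k)))
        (fun n => ((N n : ℝ) * T n) ^ 2 * c n))

/-- There are constants `σ > 0` and `η > 0` such that, under every `P`, the `U_{it}` are independent
over `i, t` conditional on `(W, Γ)`, with `𝔼[U_{it} | W, Γ] = 0`, `𝔼[U_{it}² | W, Γ] > σ²` and
`𝔼[U_{it}⁴ | W, Γ] < 1/η`. -/
def CondIndepErrors [∀ n, StandardBorelSpace (Ω n)] (Pr : ∀ n, Set (ProbabilityMeasure (Ω n)))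
    (D : ∀ n, FactorPanel (Ω n) (N n) (T n) K) : Prop :=
  ∃ σ η : ℝ, 0 < σ ∧ 0 < η ∧ ∀ n, ∀ P ∈ Pr n,
    iCondIndepFun (D n).info (D n).info_le
      (fun (p : Fin (N n) × Fin (T n)) ω => (D n).U ω p.1 p.2) (P : Measure (Ω n)) ∧
    ∀ i t,
      Integrable (fun ω => (D n).U ω i t ^ 4) (P : Measure (Ω n)) ∧
      (P : Measure (Ω n))[fun ω => (D n).U ω i t | (D n).info] =ᵐ[(P : Measure (Ω n))] 0 ∧
      (∀ᵐ ω ∂(P : Measure (Ω n)), σ ^ 2 <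
        ((P : Measure (Ω n))[fun ω => (D n).U ω i t ^ 2 | (D n).info]) ω) ∧
      (∀ᵐ ω ∂(P : Measure (Ω n)),
        ((P : Measure (Ω n))[fun ω => (D n).U ω i t ^ 4 | (D n).info]) ω < 1 / η)

end Uniform

end PanelDebias

end

/-!
The argument separates a deterministic part, valid on every draw of the data on which the assumed
bounds hold with fixed constants (`RegularDraw`), from a probabilistic part, which concerns only the
independence of the errors conditional on `(W, Γ)`.

*Deterministic part.* Projecting the idiosyncratic component `V` of a regressor off the other
regressors and normalizing gives a feasible weight matrix of small Frobenius and spectral norm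
(`exists_isFeasibleWeight`), so the optimal weights are at least as small
(`isOptimalWeight_bounds`). Noncollinearity and the optimality of least squares, combined with the
bound `|⟨A, B⟩| ≤ rank B · s_1(A) s_1(B)`, show that the least squares fit has error of the order of
the spectral norm of the noise (`leastSquares_bounds`); the Eckart–Young bound turns noncollinearity
into a lower bound on the distance to matrices of low rank. Since feasible weights satisfy
`⟨A, Y - G⟩ = β + ⟨A, U⟩ + ⟨A, Γ - G⟩`, the preliminary coefficients converge fast enough for
`Û_pre` to equal `U` plus a matrix of rank at most `2R` plus a term that is negligible in spectral
norm. By Weyl's inequality `s_1(Û_pre)` is then at least nearly `s_{2R+1}(U)`, which is nearly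
`s_1(U)`, while `Γ - Γ̂_pre` has spectral norm at most nearly `s_1(U) + s_1(Û_pre)`. Hence
`|⟨A, Γ - Γ̂_pre⟩| ≤ 2R · 2 s_1(Û_pre) (1 + ε) · s_1(A)`, which is the bias bound
(`procedure_bounds`).

*Probabilistic part.* Under the regular conditional probability given `(W, Γ)`, the errors are
almost surely independent and the weights are constants. Chebyshev's inequality bounds the noise
terms `⟨A, U⟩` and gives a law of large numbers for `∑ A_{it}² U_{it}²` because no weight dominates;
a Taylor expansion bounds the distance between the characteristic function of
`⟨A, U⟩ / √(∑ A_{it}² σ_{it}²)` and that of the standard normal distribution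
(`norm_charFun_sub_le_of_ae_isNoise`). This bound is uniform in the distribution, so Lévy's
continuity theorem along sequences of distributions gives uniform convergence in distribution
(`eventually_abs_cdf_sub_le`).

The uniform stochastic orders are handled through `Likely`, which says that an event depending on a
large constant and a small tolerance has uniformly high probability; regular draws are likely in
this sense (`likely_regularDraw`), and so are draws on which the procedure behaves as intended
(`goodOutcomesLikely`). The consistency of the standard error, the rate of convergence, asymptotic
normality and coverage are read off from these good outcomes.
-/

noncomputable section

namespace PanelDebias

/-! ### Singular values -/

section SingularValues

variable {E F : Type*} [NormedAddCommGroup E] [InnerProductSpace ℝ E] [FiniteDimensional ℝ E]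
  [NormedAddCommGroup F] [InnerProductSpace ℝ F] [FiniteDimensional ℝ F]

/-- An orthonormal basis of right singular vectors of `f`. -/
def rightSingularBasis (f : E →ₗ[ℝ] F) : OrthonormalBasis (Fin (Module.finrank ℝ E)) ℝ E :=
  f.isSymmetric_adjoint_comp_self.eigenvectorBasis rfl

theorem inner_map_rightSingularBasis (f : E →ₗ[ℝ] F) (x : E) (i : Fin (Module.finrank ℝ E)) :
    inner ℝ (f x) (f (rightSingularBasis f i)) =
      f.singularValues i ^ 2 * inner ℝ x (rightSingularBasis f i) := by
  rw [LinearMap.sq_singularValues_fin f rfl, ← LinearMap.adjoint_inner_right]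
  have := f.isSymmetric_adjoint_comp_self.apply_eigenvectorBasis rfl i
  simp only [LinearMap.comp_apply] at this
  rw [rightSingularBasis, this, inner_smul_right]
  rfl

theorem norm_map_rightSingularBasis (f : E →ₗ[ℝ] F) (i : Fin (Module.finrank ℝ E)) :
    ‖f (rightSingularBasis f i)‖ = f.singularValues i := by
  have h := inner_map_rightSingularBasis f (rightSingularBasis f i) i
  rw [real_inner_self_eq_norm_sq, real_inner_self_eq_norm_sq,
    (rightSingularBasis f).norm_eq_one] at h
  have h2 : ‖f (rightSingularBasis f i)‖ ^ 2 = f.singularValues i ^ 2 := by linarith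
  exact (sq_eq_sq₀ (norm_nonneg _) (f.singularValues_nonneg i)).1 h2

theorem norm_map_sq_eq_sum_singularValues (f : E →ₗ[ℝ] F) (x : E) :
    ‖f x‖ ^ 2 = ∑ i : Fin (Module.finrank ℝ E),
      f.singularValues i ^ 2 * inner ℝ x (rightSingularBasis f i) ^ 2 := by
  conv_lhs => rw [← real_inner_self_eq_norm_sq]
  have : f x = ∑ i, inner ℝ x (rightSingularBasis f i) • f (rightSingularBasis f i) := by
    conv_lhs => rw [← (rightSingularBasis f).sum_repr' x]
    rw [map_sum]
    refine Finset.sum_congr rfl fun i _ => ?_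
    rw [map_smul, real_inner_comm]
  conv_lhs => rhs; rw [this]
  rw [inner_sum]
  refine Finset.sum_congr rfl fun i _ => ?_
  rw [inner_smul_right, inner_map_rightSingularBasis]
  ring

theorem sum_inner_rightSingularBasis_sq (f : E →ₗ[ℝ] F) (x : E) :
    ∑ i, inner ℝ x (rightSingularBasis f i) ^ 2 = ‖x‖ ^ 2 := by
  have := (rightSingularBasis f).sum_sq_norm_inner_right x
  rw [← this]
  refine Finset.sum_congr rfl fun i _ => ?_
  rw [Real.norm_eq_abs, sq_abs, real_inner_comm]

theorem norm_map_le_singularValues_zero (f : E →ₗ[ℝ] F) (x : E) :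
    ‖f x‖ ≤ f.singularValues 0 * ‖x‖ := by
  refine abs_le_of_sq_le_sq' ?_ (mul_nonneg (f.singularValues_nonneg 0) (norm_nonneg _)) |>.2
  rw [norm_map_sq_eq_sum_singularValues, mul_pow, ← sum_inner_rightSingularBasis_sq f,
    Finset.mul_sum]
  refine Finset.sum_le_sum fun i _ => ?_
  gcongr
  · exact f.singularValues_nonneg _
  · exact f.singularValues_antitone (Nat.zero_le _)

/-- Weyl's inequality for a perturbation of low rank: the `k`-th singular value (counted from `0`)
is at most the operator norm of the distance to any map of rank at most `k`. The kernel of such a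
map meets the span of the first `k + 1` right singular vectors. -/
theorem singularValues_le_of_finrank_range_le (f g : E →ₗ[ℝ] F) {k : ℕ}
    (hg : Module.finrank ℝ (LinearMap.range g) ≤ k) {c : ℝ} (hc : 0 ≤ c)
    (h : ∀ x, ‖f x - g x‖ ≤ c * ‖x‖) : f.singularValues k ≤ c := by
  by_cases hk : Module.finrank ℝ E ≤ k
  · rw [f.singularValues_of_finrank_le hk]; exact hc
  push Not at hk
  let e := rightSingularBasis f
  let v : Fin (k + 1) → E := fun i => e ⟨i, by omega⟩
  have hv : LinearIndependent ℝ v :=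
    e.orthonormal.linearIndependent.comp (fun i : Fin (k + 1) => (⟨i, by omega⟩ : Fin _))
      (fun a b hab => by simpa [Fin.ext_iff] using hab)
  let S : Submodule ℝ E := Submodule.span ℝ (Set.range v)
  have hS : Module.finrank ℝ S = k + 1 := by
    rw [finrank_span_eq_card hv, Fintype.card_fin]
  have hker := g.finrank_range_add_finrank_ker
  have hinf : S ⊓ LinearMap.ker g ≠ ⊥ := by
    intro hbot
    have := Submodule.finrank_sup_add_finrank_inf_eq S (LinearMap.ker g)
    rw [hbot, finrank_bot] at this
    have := Submodule.finrank_le (S ⊔ LinearMap.ker g)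
    omega
  obtain ⟨x, hx, hx0⟩ := Submodule.exists_mem_ne_zero_of_ne_bot hinf
  obtain ⟨hxS, hxg⟩ := Submodule.mem_inf.1 hx
  rw [LinearMap.mem_ker] at hxg
  have hzero : ∀ i : Fin (Module.finrank ℝ E), k < i → inner ℝ x (e i) = 0 := by
    intro i hi
    refine Submodule.span_induction (p := fun y _ => inner ℝ y (e i) = 0) ?_ ?_ ?_ ?_ hxS
    · rintro _ ⟨j, rfl⟩
      refine e.orthonormal.2 ?_
      intro hij
      have := congrArg Fin.val hij
      simp at this
      omega
    · exact inner_zero_left _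
    · intro a b _ _ ha hb
      rw [inner_add_left, ha, hb, add_zero]
    · intro a b _ hb
      rw [inner_smul_left, hb, mul_zero]
  have hlow : (f.singularValues k * ‖x‖) ^ 2 ≤ ‖f x‖ ^ 2 := by
    rw [norm_map_sq_eq_sum_singularValues, mul_pow, ← sum_inner_rightSingularBasis_sq f,
      Finset.mul_sum]
    refine Finset.sum_le_sum fun i _ => ?_
    by_cases hi : k < i
    · have := hzero i hi
      simp only [e] at this
      rw [this]; simp
    · gcongr
      · exact f.singularValues_nonneg _
      · exact f.singularValues_antitone (by omega)
  have hup := h x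
  rw [hxg, sub_zero] at hup
  have hxpos : 0 < ‖x‖ := norm_pos_iff.2 hx0
  have h1 : f.singularValues k * ‖x‖ ≤ ‖f x‖ := abs_le_of_sq_le_sq' hlow (norm_nonneg _) |>.2
  exact le_of_mul_le_mul_right (h1.trans hup) hxpos

theorem singularValues_zero_le (f : E →ₗ[ℝ] F) {c : ℝ} (hc : 0 ≤ c)
    (h : ∀ x, ‖f x‖ ≤ c * ‖x‖) : f.singularValues 0 ≤ c :=
  singularValues_le_of_finrank_range_le f 0 (by simp) hc (by simpa using h)

/-- The Hilbert–Schmidt inner product does not depend on the orthonormal basis. -/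
theorem sum_inner_map_eq {ι κ : Type*} [Fintype ι] [Fintype κ] [DecidableEq ι] [DecidableEq κ]
    (f g : E →ₗ[ℝ] F)
    (b : OrthonormalBasis ι ℝ E) (b' : OrthonormalBasis κ ℝ E) :
    ∑ i, inner ℝ (f (b i)) (g (b i)) = ∑ i, inner ℝ (f (b' i)) (g (b' i)) := by
  have h1 := LinearMap.trace_eq_sum_inner (LinearMap.adjoint f ∘ₗ g) b
  have h2 := LinearMap.trace_eq_sum_inner (LinearMap.adjoint f ∘ₗ g) b'
  simp only [LinearMap.comp_apply, LinearMap.adjoint_inner_right] at h1 h2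
  rw [← h1, ← h2]

/-- The Hilbert–Schmidt norm of the adjoint. -/
theorem sum_norm_adjoint_sq {ι κ : Type*} [Fintype ι] [Fintype κ]
    (f : E →ₗ[ℝ] F) (b : OrthonormalBasis ι ℝ E) (b' : OrthonormalBasis κ ℝ F) :
    ∑ i, ‖LinearMap.adjoint f (b' i)‖ ^ 2 = ∑ i, ‖f (b i)‖ ^ 2 := by
  have h1 : ∀ i, ‖LinearMap.adjoint f (b' i)‖ ^ 2 = ∑ j, inner ℝ (f (b j)) (b' i) ^ 2 := by
    intro i
    rw [← b.sum_sq_norm_inner_right]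
    refine Finset.sum_congr rfl fun j _ => ?_
    rw [LinearMap.adjoint_inner_right, Real.norm_eq_abs, sq_abs]
  have h2 : ∀ j, ‖f (b j)‖ ^ 2 = ∑ i, inner ℝ (f (b j)) (b' i) ^ 2 := by
    intro j
    rw [← b'.sum_sq_norm_inner_right]
    refine Finset.sum_congr rfl fun i _ => ?_
    rw [real_inner_comm, Real.norm_eq_abs, sq_abs]
  simp only [h1, h2]
  exact Finset.sum_comm

/-- Precomposing with an orthogonal projection does not increase the Hilbert–Schmidt norm. -/
theorem sum_norm_comp_starProjection_sq_le {ι κ : Type*} [Fintype ι] [Fintype κ]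
    [DecidableEq ι] [DecidableEq κ]
    (h : E →ₗ[ℝ] F) (S : Submodule ℝ E) (b : OrthonormalBasis ι ℝ E)
    (b' : OrthonormalBasis κ ℝ E) :
    ∑ i, ‖h (S.starProjection (b' i))‖ ^ 2 ≤ ∑ i, ‖h (b i)‖ ^ 2 := by
  have hP : LinearMap.adjoint (S.starProjection : E →ₗ[ℝ] E) = (S.starProjection : E →ₗ[ℝ] E) := by
    symm
    rw [LinearMap.eq_adjoint_iff]
    intro x y
    exact Submodule.inner_starProjection_left_eq_right S x y
  have e1 := sum_norm_adjoint_sq (h ∘ₗ (S.starProjection : E →ₗ[ℝ] E)) b'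
    (stdOrthonormalBasis ℝ F)
  have e2 := sum_norm_adjoint_sq h b (stdOrthonormalBasis ℝ F)
  rw [LinearMap.adjoint_comp, hP] at e1
  simp only [LinearMap.comp_apply, ContinuousLinearMap.coe_coe] at e1
  rw [← e1, ← e2]
  refine Finset.sum_le_sum fun i _ => ?_
  gcongr
  exact Submodule.norm_starProjection_apply_le S _

theorem sum_norm_starProjection_sq {ι : Type*} [Fintype ι] [DecidableEq ι] (S : Submodule ℝ E)
    (b : OrthonormalBasis ι ℝ E) :
    ∑ i, ‖S.starProjection (b i)‖ ^ 2 = Module.finrank ℝ S := by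
  have h1 := LinearMap.trace_eq_sum_inner (S.starProjection : E →ₗ[ℝ] E) b
  have hproj : LinearMap.IsProj S (S.starProjection : E →ₗ[ℝ] E) :=
    ⟨fun x => Submodule.starProjection_apply_mem S x,
      fun x hx => Submodule.starProjection_eq_self_iff.2 hx⟩
  rw [hproj.trace] at h1
  rw [h1]
  refine Finset.sum_congr rfl fun i _ => ?_
  rw [← real_inner_self_eq_norm_sq]
  simp only [ContinuousLinearMap.coe_coe]
  rw [Submodule.inner_starProjection_left_eq_right, Submodule.starProjection_eq_self_iff.2
    (Submodule.starProjection_apply_mem S _)]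

/-- A weighted sum of a decreasing sequence, with weights in `[0, 1]` of total mass at least
`d - k`, is at least the sum of its last `d - k` terms. -/
theorem sum_tail_le_of_weights {d k : ℕ} (l w : Fin d → ℝ) (hl : Antitone l)
    (hl0 : ∀ i, 0 ≤ l i) (hw0 : ∀ i, 0 ≤ w i) (hw1 : ∀ i, w i ≤ 1)
    (hsum : (d : ℝ) - k ≤ ∑ i, w i) :
    ∑ i : Fin d, (if k ≤ (i : ℕ) then l i else 0) ≤ ∑ i, l i * w i := by
  by_cases hk : d ≤ k
  · refine Finset.sum_le_sum fun i _ => ?_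
    rw [if_neg (by omega)]
    exact mul_nonneg (hl0 i) (hw0 i)
  push Not at hk
  set m := l ⟨k, hk⟩ with hm
  have hcard : ∑ i : Fin d, (if k ≤ (i : ℕ) then (1 : ℝ) else 0) = d - k := by
    rw [Fin.sum_univ_eq_sum_range (fun i => if k ≤ i then (1 : ℝ) else 0) d,
      ← Finset.sum_filter]
    have : (Finset.range d).filter (fun i => k ≤ i) = Finset.Ico k d := by
      ext i; simp; omega
    rw [this, Finset.sum_const, Nat.card_Ico, nsmul_eq_mul, mul_one, Nat.cast_sub hk.le]
  have key : ∀ i : Fin d, m * (w i - if k ≤ (i : ℕ) then 1 else 0) ≤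
      l i * w i - if k ≤ (i : ℕ) then l i else 0 := by
    intro i
    split_ifs with hi
    · have : l i ≤ m := hl (by simpa [Fin.le_def] using hi)
      nlinarith [hw1 i]
    · have : m ≤ l i := hl (by simp [Fin.le_def]; omega)
      nlinarith [hw0 i]
  have := Finset.sum_le_sum fun i (_ : i ∈ Finset.univ) => key i
  rw [← Finset.mul_sum, Finset.sum_sub_distrib, Finset.sum_sub_distrib, hcard] at this
  have hm0 : 0 ≤ m := hl0 _
  nlinarith [mul_nonneg hm0 (sub_nonneg.2 hsum)]

/-- The lower bound in the Eckart–Young theorem: the squared Hilbert–Schmidt distance of `f` to a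
map of rank at most `k` is at least the sum of the squares of the singular values of `f` beyond the
first `k`. -/
theorem sum_sq_singularValues_le {ι : Type*} [Fintype ι] [DecidableEq ι] (f g : E →ₗ[ℝ] F) {k : ℕ}
    (hg : Module.finrank ℝ (LinearMap.range g) ≤ k) (b : OrthonormalBasis ι ℝ E) :
    ∑ i : Fin (Module.finrank ℝ E), (if k ≤ (i : ℕ) then f.singularValues i ^ 2 else 0) ≤
      ∑ i, ‖f (b i) - g (b i)‖ ^ 2 := by
  let S := LinearMap.ker g
  let e := rightSingularBasis f
  have h1 := sum_norm_comp_starProjection_sq_le (f - g) S b e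
  simp only [LinearMap.sub_apply] at h1
  refine le_trans ?_ h1
  have h2 : ∀ i, g (S.starProjection (e i)) = 0 := fun i =>
    LinearMap.mem_ker.1 (Submodule.starProjection_apply_mem S (e i))
  simp only [h2, sub_zero, norm_map_sq_eq_sum_singularValues f]
  rw [Finset.sum_comm]
  have h3 : ∀ j : Fin (Module.finrank ℝ E), ∑ i, f.singularValues j ^ 2 *
      inner ℝ (S.starProjection (e i)) (rightSingularBasis f j) ^ 2 =
      f.singularValues j ^ 2 * ‖S.starProjection (e j)‖ ^ 2 := by
    intro j
    rw [← Finset.mul_sum, ← e.sum_sq_norm_inner_right (S.starProjection (e j))]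
    congr 1
    refine Finset.sum_congr rfl fun i _ => ?_
    rw [Real.norm_eq_abs, sq_abs, Submodule.inner_starProjection_left_eq_right]
  simp only [h3]
  refine sum_tail_le_of_weights (fun i => f.singularValues i ^ 2)
    (fun i => ‖S.starProjection (e i)‖ ^ 2) ?_ (fun i => sq_nonneg _) (fun i => sq_nonneg _) ?_ ?_
  · intro i j hij
    exact pow_le_pow_left₀ (f.singularValues_nonneg _) (f.singularValues_antitone hij) 2
  · intro i
    have := Submodule.norm_starProjection_apply_le S (e i)
    rw [e.norm_eq_one] at this
    exact pow_le_one₀ (norm_nonneg _) this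
  · rw [sum_norm_starProjection_sq]
    have := g.finrank_range_add_finrank_ker
    have h4 : Module.finrank ℝ E ≤ k + Module.finrank ℝ S := by
      simp only [S]; omega
    have : (Module.finrank ℝ E : ℝ) ≤ k + Module.finrank ℝ S := by exact_mod_cast h4
    linarith

/-- Duality of the operator and nuclear norms, with the nuclear norm of `g` bounded by its rank
times its operator norm. -/
theorem abs_sum_inner_map_le {ι : Type*} [Fintype ι] [DecidableEq ι] (f g : E →ₗ[ℝ] F)
    (b : OrthonormalBasis ι ℝ E) :
    |∑ i, inner ℝ (f (b i)) (g (b i))| ≤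
      Module.finrank ℝ (LinearMap.range g) * (f.singularValues 0 * g.singularValues 0) := by
  rw [sum_inner_map_eq f g b (rightSingularBasis g)]
  refine (Finset.abs_sum_le_sum_abs _ _).trans ?_
  have h : ∀ i : Fin (Module.finrank ℝ E), |inner ℝ (f (rightSingularBasis g i))
      (g (rightSingularBasis g i))| ≤ if (i : ℕ) ∈ g.singularValues.support then
        f.singularValues 0 * g.singularValues 0 else 0 := by
    intro i
    refine (abs_real_inner_le_norm _ _).trans ?_
    rw [norm_map_rightSingularBasis]
    split_ifs with hi
    · have := norm_map_le_singularValues_zero f (rightSingularBasis g i)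
      rw [(rightSingularBasis g).norm_eq_one, mul_one] at this
      gcongr
      · exact g.singularValues_nonneg _
      · exact f.singularValues_nonneg 0
      · exact g.singularValues_antitone (Nat.zero_le _)
    · rw [Finsupp.notMem_support_iff.1 hi, mul_zero]
  refine (Finset.sum_le_sum fun i _ => h i).trans ?_
  rw [Fin.sum_univ_eq_sum_range (fun i => if i ∈ g.singularValues.support then
        f.singularValues 0 * g.singularValues 0 else 0), ← Finset.sum_filter, Finset.sum_const,
        nsmul_eq_mul]
  refine mul_le_mul_of_nonneg_right ?_
    (mul_nonneg (f.singularValues_nonneg 0) (g.singularValues_nonneg 0))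
  rw [← g.card_support_singularValues]
  exact_mod_cast Finset.card_le_card fun i hi => (Finset.mem_filter.1 hi).2

end SingularValues

/-! ### Panels as matrices -/

section Panels

variable {N T K : ℕ}

/-- A panel as a linear map between Euclidean spaces. -/
def op : Panel N T →ₗ[ℝ] (EuclideanSpace ℝ (Fin T) →ₗ[ℝ] EuclideanSpace ℝ (Fin N)) where
  toFun A := Matrix.toEuclideanLin (Matrix.of A)
  map_add' A B := by rw [← Matrix.of_add_of, map_add]
  map_smul' c A := by rw [← Matrix.smul_of, map_smul]; rfl

theorem sv_eq (r : ℕ) (A : Panel N T) : sv r A = (op A).singularValues (r - 1) := rfl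

theorem rk_eq (A : Panel N T) : rk A = Module.finrank ℝ (LinearMap.range (op A)) :=
  Matrix.rank_eq_finrank_range_toLin (Matrix.of A) (PiLp.basisFun 2 ℝ (Fin N))
    (PiLp.basisFun 2 ℝ (Fin T))

theorem sv_nonneg (r : ℕ) (A : Panel N T) : 0 ≤ sv r A := LinearMap.singularValues_nonneg _ _

theorem op_apply_basis (A : Panel N T) (t : Fin T) (i : Fin N) :
    op A (EuclideanSpace.basisFun (Fin T) ℝ t) i = A i t := by
  simp [op, Matrix.toLpLin_apply]

theorem ip_eq_sum_inner (A B : Panel N T) :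
    ip A B = ∑ t, inner ℝ (op A (EuclideanSpace.basisFun (Fin T) ℝ t))
      (op B (EuclideanSpace.basisFun (Fin T) ℝ t)) := by
  rw [ip, Finset.sum_comm]
  refine Finset.sum_congr rfl fun t _ => ?_
  rw [PiLp.inner_apply]
  refine Finset.sum_congr rfl fun i _ => ?_
  simp only [op_apply_basis, RCLike.inner_apply, conj_trivial]
  ring

/-! #### The Frobenius inner product -/

theorem ip_comm (A B : Panel N T) : ip A B = ip B A := by simp only [ip, mul_comm]

theorem ip_add_right (A B C : Panel N T) : ip A (B + C) = ip A B + ip A C := by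
  simp only [ip, Pi.add_apply, mul_add, Finset.sum_add_distrib]

theorem ip_smul_right (c : ℝ) (A B : Panel N T) : ip A (c • B) = c * ip A B := by
  simp only [ip, Pi.smul_apply, smul_eq_mul, Finset.mul_sum]
  refine Finset.sum_congr rfl fun i _ => Finset.sum_congr rfl fun t _ => ?_
  ring

theorem ip_neg_right (A B : Panel N T) : ip A (-B) = -ip A B := by
  simp [ip]

theorem ip_sub_right (A B C : Panel N T) : ip A (B - C) = ip A B - ip A C := by
  rw [sub_eq_add_neg, ip_add_right, ip_neg_right, sub_eq_add_neg]

theorem ip_add_left (A B C : Panel N T) : ip (A + B) C = ip A C + ip B C := by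
  rw [ip_comm, ip_add_right, ip_comm C, ip_comm C]

theorem ip_sub_left (A B C : Panel N T) : ip (A - B) C = ip A C - ip B C := by
  rw [ip_comm, ip_sub_right, ip_comm C, ip_comm C]

theorem ip_smul_left (c : ℝ) (A B : Panel N T) : ip (c • A) B = c * ip A B := by
  rw [ip_comm, ip_smul_right, ip_comm]

theorem ip_sum_right {ι : Type*} (s : Finset ι) (A : Panel N T) (B : ι → Panel N T) :
    ip A (∑ k ∈ s, B k) = ∑ k ∈ s, ip A (B k) := by
  classical
  induction s using Finset.induction_on with
  | empty => simp [ip]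
  | insert a s ha ih => rw [Finset.sum_insert ha, Finset.sum_insert ha, ip_add_right, ih]

theorem comb_eq_sum (W : Regressors N T K) (γ : Coef K) : comb W γ = ∑ k, γ k • W k := by
  ext i t
  simp [comb, Finset.sum_apply]

theorem ip_comb_right (A : Panel N T) (W : Regressors N T K) (γ : Coef K) :
    ip A (comb W γ) = ∑ k, γ k * ip A (W k) := by
  rw [comb_eq_sum, ip_sum_right]
  simp only [ip_smul_right]

theorem comb_sub (W : Regressors N T K) (γ δ : Coef K) :
    comb W (γ - δ) = comb W γ - comb W δ := by
  ext i t
  simp [comb, sub_mul, Finset.sum_sub_distrib]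

theorem comb_smul (W : Regressors N T K) (a : ℝ) (γ : Coef K) :
    comb W (a • γ) = a • comb W γ := by
  ext i t
  simp [comb, Finset.mul_sum, mul_assoc]

/-- The vectorization of a panel. -/
def vec : Panel N T →ₗ[ℝ] EuclideanSpace ℝ (Fin N × Fin T) where
  toFun A := WithLp.toLp 2 fun p => A p.1 p.2
  map_add' _ _ := rfl
  map_smul' _ _ := rfl

theorem vec_apply (A : Panel N T) (i : Fin N) (t : Fin T) : vec A (i, t) = A i t := rfl

theorem frob_eq_norm_vec (A : Panel N T) : frob A = ‖vec A‖ := by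
  rw [EuclideanSpace.norm_eq, frob, Fintype.sum_prod_type]
  simp [vec_apply]

theorem frob_nonneg (A : Panel N T) : 0 ≤ frob A := Real.sqrt_nonneg _

theorem frob_sq (A : Panel N T) : frob A ^ 2 = ∑ i, ∑ t, A i t ^ 2 :=
  Real.sq_sqrt (Finset.sum_nonneg fun _ _ => Finset.sum_nonneg fun _ _ => sq_nonneg _)

theorem ip_self (A : Panel N T) : ip A A = frob A ^ 2 := by
  rw [frob_sq, ip]
  simp only [sq]

theorem frob_add_le (A B : Panel N T) : frob (A + B) ≤ frob A + frob B := by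
  simp only [frob_eq_norm_vec, map_add]
  exact norm_add_le _ _

theorem frob_sub_le (A B : Panel N T) : frob (A - B) ≤ frob A + frob B := by
  simp only [frob_eq_norm_vec, map_sub]
  exact norm_sub_le _ _

theorem frob_smul (c : ℝ) (A : Panel N T) : frob (c • A) = |c| * frob A := by
  simp only [frob_eq_norm_vec, map_smul, norm_smul, Real.norm_eq_abs]

theorem frob_sum_le {ι : Type*} (s : Finset ι) (B : ι → Panel N T) :
    frob (∑ k ∈ s, B k) ≤ ∑ k ∈ s, frob (B k) := by
  simp only [frob_eq_norm_vec, map_sum]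
  exact norm_sum_le _ _

theorem frob_eq_zero {A : Panel N T} : frob A = 0 ↔ A = 0 := by
  rw [frob_eq_norm_vec, norm_eq_zero]
  constructor
  · intro h
    ext i t
    exact congrArg (fun v : EuclideanSpace ℝ (Fin N × Fin T) => v (i, t)) h
  · rintro rfl; exact map_zero _

theorem abs_ip_le_frob (A B : Panel N T) : |ip A B| ≤ frob A * frob B := by
  have : ip A B = inner ℝ (vec A) (vec B) := by
    rw [PiLp.inner_apply, Fintype.sum_prod_type, ip]
    refine Finset.sum_congr rfl fun i _ => Finset.sum_congr rfl fun t _ => ?_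
    simp [vec_apply, mul_comm]
  rw [this, frob_eq_norm_vec, frob_eq_norm_vec]
  exact abs_real_inner_le_norm _ _

theorem continuous_frob : Continuous (frob : Panel N T → ℝ) := by
  unfold frob
  fun_prop

theorem abs_apply_le_frob (A : Panel N T) (i : Fin N) (t : Fin T) : |A i t| ≤ frob A := by
  rw [frob_eq_norm_vec]
  have := PiLp.norm_apply_le (vec A) (i, t)
  simpa [vec_apply] using this

theorem norm_le_frob (A : Panel N T) : ‖A‖ ≤ frob A :=
  (pi_norm_le_iff_of_nonneg (frob_nonneg A)).2 fun i =>
    (pi_norm_le_iff_of_nonneg (frob_nonneg A)).2 fun t => abs_apply_le_frob A i t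

theorem frob_sq_eq_sum_norm (A : Panel N T) :
    frob A ^ 2 = ∑ t, ‖op A (EuclideanSpace.basisFun (Fin T) ℝ t)‖ ^ 2 := by
  rw [← ip_self, ip_eq_sum_inner]
  simp only [real_inner_self_eq_norm_sq]

/-! #### The spectral norm -/

theorem norm_op_le (A : Panel N T) (x : EuclideanSpace ℝ (Fin T)) : ‖op A x‖ ≤ sv 1 A * ‖x‖ :=
  norm_map_le_singularValues_zero _ _

theorem sv_one_le {A : Panel N T} {c : ℝ} (hc : 0 ≤ c) (h : ∀ x, ‖op A x‖ ≤ c * ‖x‖) :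
    sv 1 A ≤ c :=
  singularValues_zero_le _ hc h

theorem sv_one_add_le (A B : Panel N T) : sv 1 (A + B) ≤ sv 1 A + sv 1 B := by
  refine sv_one_le (add_nonneg (sv_nonneg _ _) (sv_nonneg _ _)) fun x => ?_
  rw [map_add, LinearMap.add_apply, add_mul]
  exact (norm_add_le _ _).trans (add_le_add (norm_op_le A x) (norm_op_le B x))

theorem sv_one_smul_le (c : ℝ) (A : Panel N T) : sv 1 (c • A) ≤ |c| * sv 1 A := by
  refine sv_one_le (mul_nonneg (abs_nonneg _) (sv_nonneg _ _)) fun x => ?_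
  rw [map_smul, LinearMap.smul_apply, norm_smul, mul_assoc, Real.norm_eq_abs]
  gcongr
  exact norm_op_le A x

theorem sv_one_neg (A : Panel N T) : sv 1 (-A) = sv 1 A := by
  have h : ∀ B : Panel N T, sv 1 (-B) ≤ sv 1 B := fun B => by
    simpa using sv_one_smul_le (-1) B
  exact le_antisymm (h A) (by simpa using h (-A))

theorem sv_one_sub_le (A B : Panel N T) : sv 1 (A - B) ≤ sv 1 A + sv 1 B := by
  rw [sub_eq_add_neg, ← sv_one_neg B]
  exact sv_one_add_le _ _

theorem sv_one_zero : sv 1 (0 : Panel N T) = 0 :=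
  le_antisymm (sv_one_le le_rfl (by simp)) (sv_nonneg _ _)

theorem sv_one_sum_le {ι : Type*} (s : Finset ι) (B : ι → Panel N T) :
    sv 1 (∑ k ∈ s, B k) ≤ ∑ k ∈ s, sv 1 (B k) := by
  classical
  induction s using Finset.induction_on with
  | empty => simp [sv_one_zero]
  | insert a s ha ih =>
    rw [Finset.sum_insert ha, Finset.sum_insert ha]
    exact (sv_one_add_le _ _).trans (by gcongr)

theorem sv_one_comb_le (W : Regressors N T K) (γ : Coef K) :
    sv 1 (comb W γ) ≤ ∑ k, |γ k| * sv 1 (W k) := by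
  rw [comb_eq_sum]
  exact (sv_one_sum_le _ _).trans (Finset.sum_le_sum fun k _ => sv_one_smul_le _ _)

theorem sv_one_le_frob (A : Panel N T) : sv 1 A ≤ frob A := by
  rcases Nat.eq_zero_or_pos T with rfl | hT
  · refine sv_one_le (frob_nonneg A) fun x => ?_
    rw [Subsingleton.elim x 0, map_zero, norm_zero, norm_zero, mul_zero]
  -- the largest singular value is the norm of one column of `A` in an orthonormal basis
  have hpos : 0 < Module.finrank ℝ (EuclideanSpace ℝ (Fin T)) := by simpa using hT
  have h1 := norm_map_rightSingularBasis (op A) ⟨0, hpos⟩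
  have h2 := sum_inner_map_eq (op A) (op A) (EuclideanSpace.basisFun (Fin T) ℝ)
    (rightSingularBasis (op A))
  simp only [real_inner_self_eq_norm_sq] at h2
  refine (sq_le_sq₀ (sv_nonneg _ _) (frob_nonneg _)).1 ?_
  rw [frob_sq_eq_sum_norm, h2, sv_eq]
  have h3 := Finset.single_le_sum
    (f := fun i => ‖op A (rightSingularBasis (op A) i)‖ ^ 2)
    (fun i _ => sq_nonneg _) (Finset.mem_univ (⟨0, hpos⟩ : Fin _))
  simp only [h1] at h3
  exact h3

theorem continuous_sv_one : Continuous (sv 1 : Panel N T → ℝ) := by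
  refine continuous_iff_continuousAt.2 fun A => ?_
  rw [ContinuousAt, tendsto_iff_norm_sub_tendsto_zero]
  have h0 : Tendsto (fun B : Panel N T => frob (B - A)) (𝓝 A) (𝓝 0) := by
    have : Continuous fun B : Panel N T => frob (B - A) :=
      continuous_frob.comp (continuous_id.sub continuous_const)
    have h := this.tendsto A
    rwa [sub_self, frob_eq_zero.2 rfl] at h
  refine squeeze_zero (fun _ => norm_nonneg _) (fun B => ?_) h0
  refine le_trans ?_ (sv_one_le_frob _)
  rw [Real.norm_eq_abs, abs_sub_le_iff]
  constructor
  · have := sv_one_add_le (B - A) A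
    rw [sub_add_cancel] at this
    linarith
  · have := sv_one_sub_le B (B - A)
    rw [sub_sub_cancel] at this
    linarith

/-! #### Rank -/

theorem rk_neg (A : Panel N T) : rk (-A) = rk A := by
  rw [rk_eq, rk_eq, map_neg, LinearMap.range_neg]

theorem rk_add_le (A B : Panel N T) : rk (A + B) ≤ rk A + rk B := by
  have h : LinearMap.range (op A + op B) ≤ LinearMap.range (op A) ⊔ LinearMap.range (op B) := by
    rintro _ ⟨x, rfl⟩
    exact Submodule.add_mem_sup ⟨x, rfl⟩ ⟨x, rfl⟩
  rw [rk_eq, rk_eq, rk_eq, map_add]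
  exact (Submodule.finrank_mono h).trans (Submodule.finrank_add_le_finrank_add_finrank _ _)

theorem rk_sub_le (A B : Panel N T) : rk (A - B) ≤ rk A + rk B := by
  rw [sub_eq_add_neg, ← rk_neg B]
  exact rk_add_le _ _

theorem rk_smul_le (c : ℝ) (A : Panel N T) : rk (c • A) ≤ rk A := by
  rw [rk_eq, rk_eq, map_smul]
  refine Submodule.finrank_mono ?_
  rintro _ ⟨x, rfl⟩
  exact ⟨c • x, by simp⟩

theorem rk_zero : rk (0 : Panel N T) = 0 := by
  rw [rk_eq, map_zero, LinearMap.range_zero, finrank_bot]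

theorem isClosed_rk_le (R : ℕ) : IsClosed {G : Panel N T | rk G ≤ R} := by
  have hlin : Continuous fun G : Panel N T => LinearMap.toContinuousLinearMap (op G) :=
    ((LinearMap.toContinuousLinearMap (𝕜 := ℝ) (E := EuclideanSpace ℝ (Fin T))
      (F' := EuclideanSpace ℝ (Fin N))).toLinearMap ∘ₗ op).continuous_of_finiteDimensional
  have hopen := (isOpen_setOfPred_nat_le_rank (𝕜 := ℝ) (E := EuclideanSpace ℝ (Fin T))
    (F := EuclideanSpace ℝ (Fin N)) (R + 1)).preimage hlin
  have : {G : Panel N T | rk G ≤ R}ᶜ = (fun G : Panel N T =>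
      LinearMap.toContinuousLinearMap (op G)) ⁻¹' {f | ((R + 1 : ℕ) : Cardinal) ≤
        (f : EuclideanSpace ℝ (Fin T) →ₗ[ℝ] EuclideanSpace ℝ (Fin N)).rank} := by
    ext G
    have h : (op G).rank = (rk G : Cardinal) := by
      rw [rk_eq, Module.finrank_eq_rank]
    change ¬ rk G ≤ R ↔ ((R + 1 : ℕ) : Cardinal) ≤ (op G).rank
    rw [h, Nat.cast_le, not_le, Nat.succ_le_iff]
  rw [← isOpen_compl_iff, this]
  exact hopen

/-- Duality of the spectral and nuclear norms, with the nuclear norm of `B` bounded by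
`rank B · s_1(B)`. -/
theorem abs_ip_le_rk (A B : Panel N T) : |ip A B| ≤ rk B * (sv 1 A * sv 1 B) := by
  rw [ip_eq_sum_inner, rk_eq]
  exact abs_sum_inner_map_le (op A) (op B) _

theorem sv_le_of_rk_le (A G : Panel N T) {k : ℕ} (hG : rk G ≤ k) :
    sv (k + 1) A ≤ sv 1 (A - G) := by
  rw [rk_eq] at hG
  refine singularValues_le_of_finrank_range_le (op A) (op G) hG
    (sv_nonneg _ _) fun x => ?_
  have := norm_op_le (A - G) x
  rwa [map_sub] at this

theorem sum_sv_sq_le_frob_sub_sq (A G : Panel N T) {k : ℕ} (hG : rk G ≤ k) :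
    ∑ r ∈ Finset.Icc (k + 1) (min N T), sv r A ^ 2 ≤ frob (A - G) ^ 2 := by
  rw [rk_eq] at hG
  have h := sum_sq_singularValues_le (op A) (op G) hG
    (EuclideanSpace.basisFun (Fin T) ℝ)
  have h2 := frob_sq_eq_sum_norm (A - G)
  simp only [map_sub, LinearMap.sub_apply] at h2
  rw [h2]
  refine le_trans ?_ h
  rw [Fin.sum_univ_eq_sum_range (fun i => if k ≤ i then (op A).singularValues i ^ 2 else 0),
    ← Finset.sum_filter, finrank_euclideanSpace, Fintype.card_fin]
  have h3 : ∑ r ∈ Finset.Icc (k + 1) (min N T), sv r A ^ 2 =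
      ∑ r ∈ (Finset.Icc (k + 1) (min N T)).image (fun r => r - 1),
        (op A).singularValues r ^ 2 := by
    rw [Finset.sum_image]
    · rfl
    · intro a ha b hb hab
      simp only [Finset.coe_Icc, Set.mem_Icc] at ha hb
      simp only at hab
      omega
  rw [h3]
  refine Finset.sum_le_sum_of_subset_of_nonneg ?_ fun _ _ _ => sq_nonneg _
  intro r hr
  simp only [Finset.mem_image, Finset.mem_Icc] at hr
  obtain ⟨a, ha, rfl⟩ := hr
  simp only [Finset.mem_filter, Finset.mem_range]
  omega

end Panels

/-! ### Existence of the minimizers -/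

section Existence

variable {N T K : ℕ}

theorem sq_le_maxSq (A : Panel N T) (i : Fin N) (t : Fin T) : A i t ^ 2 ≤ maxSq A :=
  le_ciSup (f := fun p : Fin N × Fin T => A p.1 p.2 ^ 2) (Set.finite_range _).bddAbove (i, t)

theorem lind_le_iff {A : Panel N T} (hA : A ≠ 0) (c : ℝ) :
    lind A ≤ c ↔ ∀ i t, A i t ^ 2 ≤ c * frob A ^ 2 := by
  have hpos : 0 < frob A ^ 2 :=
    pow_pos (lt_of_le_of_ne (frob_nonneg A) fun h => hA (frob_eq_zero.1 h.symm)) 2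
  rw [lind, ← frob_sq, div_le_iff₀ hpos]
  constructor
  · exact fun h i t => (sq_le_maxSq A i t).trans h
  · intro h
    have : Nonempty (Fin N × Fin T) := by
      by_contra hne
      rw [not_nonempty_iff] at hne
      refine hA ?_
      ext i t
      exact hne.elim (i, t)
    exact ciSup_le fun p => h p.1 p.2

theorem ne_zero_of_isFeasibleWeight {W : Regressors N T K} {j : Fin (K + 1)} {c : ℝ}
    {A : Panel N T} (h : IsFeasibleWeight W j c A) : A ≠ 0 := by
  rintro rfl
  have := h.2.1
  simp [ip] at this

theorem IsFeasibleWeight.sq_le {W : Regressors N T K} {j : Fin (K + 1)} {c : ℝ}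
    {A : Panel N T} (h : IsFeasibleWeight W j c A) (i : Fin N) (t : Fin T) :
    A i t ^ 2 ≤ c * frob A ^ 2 :=
  (lind_le_iff (ne_zero_of_isFeasibleWeight h) c).1 h.1 i t

theorem continuous_ip_left (B : Panel N T) : Continuous fun A : Panel N T => ip A B := by
  unfold ip
  fun_prop

theorem isClosed_isFeasibleWeight (W : Regressors N T K) (j : Fin (K + 1)) (c : ℝ) :
    IsClosed {A | IsFeasibleWeight W j c A} := by
  have : {A | IsFeasibleWeight W j c A} = {A : Panel N T | ∀ i t, A i t ^ 2 ≤ c * frob A ^ 2} ∩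
      ({A | ip A (W j) = 1} ∩ ⋂ k, ⋂ (_ : k ≠ j), {A | ip A (W k) = 0}) := by
    ext A
    simp only [Set.mem_ofPred_eq, Set.mem_inter_iff, Set.mem_iInter]
    constructor
    · exact fun h => ⟨h.sq_le, h.2.1, h.2.2⟩
    · rintro ⟨h1, h2, h3⟩
      have hA : A ≠ 0 := by
        rintro rfl
        simp [ip] at h2
      exact ⟨(lind_le_iff hA c).2 h1, h2, h3⟩
  rw [this]
  refine IsClosed.inter ?_ (IsClosed.inter ?_ ?_)
  · simp only [Set.ofPred_forall]
    refine isClosed_iInter fun i => isClosed_iInter fun t => isClosed_le ?_ ?_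
    · fun_prop
    · exact continuous_const.mul (continuous_frob.pow 2)
  · exact isClosed_eq (continuous_ip_left _) continuous_const
  · exact isClosed_iInter fun k => isClosed_iInter fun _ =>
      isClosed_eq (continuous_ip_left _) continuous_const

theorem exists_forall_le_of_isBounded_sublevel {E : Type*} [PseudoMetricSpace E] [ProperSpace E]
    {S : Set E} (hS : IsClosed S) {f : E → ℝ} (hf : Continuous f) {x₀ : E} (hx₀ : x₀ ∈ S)
    (hb : Bornology.IsBounded {x | x ∈ S ∧ f x ≤ f x₀}) :
    ∃ x ∈ S, ∀ y ∈ S, f x ≤ f y := by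
  have hc : IsCompact {x | x ∈ S ∧ f x ≤ f x₀} :=
    Metric.isCompact_of_isClosed_isBounded (hS.inter (isClosed_le hf continuous_const)) hb
  obtain ⟨x, hx, hmin⟩ := hc.exists_isMinOn ⟨x₀, hx₀, le_rfl⟩ hf.continuousOn
  refine ⟨x, hx.1, fun y hy => ?_⟩
  rcases le_total (f y) (f x₀) with h | h
  · exact hmin ⟨hy, h⟩
  · exact hx.2.trans h

theorem exists_isOptimalWeight {W : Regressors N T K} {j : Fin (K + 1)} {c : ℝ} (b : ℝ)
    {B : Panel N T} (hB : IsFeasibleWeight W j c B) : ∃ A, IsOptimalWeight W j b c A := by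
  have hcont : Continuous fun A : Panel N T => frob A ^ 2 + b ^ 2 * sv 1 A ^ 2 :=
    (continuous_frob.pow 2).add (continuous_const.mul (continuous_sv_one.pow 2))
  obtain ⟨A, hA, hmin⟩ := exists_forall_le_of_isBounded_sublevel
    (isClosed_isFeasibleWeight W j c) hcont hB (by
      refine (Metric.isBounded_closedBall
        (x := (0 : Panel N T)) (r := √(frob B ^ 2 + b ^ 2 * sv 1 B ^ 2))).subset ?_
      rintro A ⟨-, hA⟩
      rw [mem_closedBall_zero_iff]
      refine (norm_le_frob A).trans (Real.le_sqrt_of_sq_le ?_)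
      nlinarith [mul_nonneg (sq_nonneg b) (sq_nonneg (sv 1 A))])
  exact ⟨A, hA, hmin⟩

/-- Noncollinearity makes the least squares criterion coercive in the coefficients, uniformly over
matrices of rank at most `k`. -/
theorem mul_sum_sq_le_frob_comb_sub_sq {W : Regressors N T K} {k : ℕ} {m : ℝ}
    (hW : ∀ γ : Coef K, ∑ k, γ k ^ 2 = 1 →
      m ≤ ∑ r ∈ Finset.Icc (k + 1) (min N T), sv r (comb W γ) ^ 2)
    (γ : Coef K) {G : Panel N T} (hG : rk G ≤ k) :
    m * ∑ k, γ k ^ 2 ≤ frob (comb W γ - G) ^ 2 := by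
  rcases (Finset.sum_nonneg fun k (_ : k ∈ Finset.univ) => sq_nonneg (γ k)).eq_or_lt with h | h
  · rw [← h, mul_zero]; exact sq_nonneg _
  set s := √(∑ k, γ k ^ 2) with hs
  have hspos : 0 < s := Real.sqrt_pos.2 h
  have hs2 : s ^ 2 = ∑ k, γ k ^ 2 := Real.sq_sqrt h.le
  have h1 : ∑ k, (s⁻¹ • γ) k ^ 2 = 1 := by
    simp only [Pi.smul_apply, smul_eq_mul, mul_pow, ← Finset.mul_sum, ← hs2]
    field_simp
  have h2 := (hW _ h1).trans
    (sum_sv_sq_le_frob_sub_sq (comb W (s⁻¹ • γ)) (s⁻¹ • G) ((rk_smul_le _ _).trans hG))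
  rw [comb_smul, ← smul_sub, frob_smul, mul_pow, sq_abs, inv_pow, hs2,
    inv_mul_eq_div, le_div_iff₀ h] at h2
  exact h2

theorem frob_comb_le (W : Regressors N T K) (γ : Coef K) :
    frob (comb W γ) ≤ ∑ k, |γ k| * frob (W k) := by
  rw [comb_eq_sum]
  refine (frob_sum_le _ _).trans (le_of_eq ?_)
  simp only [frob_smul]

theorem exists_isLeastSquares {W : Regressors N T K} {R : ℕ} {m : ℝ} (hm : 0 < m)
    (hW : ∀ γ : Coef K, ∑ k, γ k ^ 2 = 1 →
      m ≤ ∑ r ∈ Finset.Icc (2 * R + 1) (min N T), sv r (comb W γ) ^ 2)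
    (Y : Panel N T) : ∃ q, IsLeastSquares R Y W q := by
  have hS : IsClosed {q : Coef K × Panel N T | rk q.2 ≤ R} :=
    (isClosed_rk_le R).preimage continuous_snd
  have hcont : Continuous fun q : Coef K × Panel N T => frob (Y - comb W q.1 - q.2) ^ 2 := by
    refine (continuous_frob.comp ?_).pow 2
    refine (continuous_const.sub ?_).sub continuous_snd
    unfold comb
    fun_prop
  set g := √(4 * frob Y ^ 2 / m) with hg
  obtain ⟨q, hq, hmin⟩ := exists_forall_le_of_isBounded_sublevel (x₀ := (0, 0)) hS hcont
    (by simp [rk_zero]) (by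
      refine (Metric.isBounded_closedBall (x := (0 : Coef K × Panel N T))
        (r := max g (2 * frob Y + ∑ k, g * frob (W k)))).subset ?_
      rintro ⟨γ, G⟩ ⟨hr, hle⟩
      rw [mem_closedBall_zero_iff, Prod.norm_def]
      have h0 : comb W (0 : Coef K) = 0 := by ext i t; simp [comb]
      simp only [Set.mem_ofPred_eq] at hr
      simp only [h0, sub_zero] at hle
      have hle' : frob (Y - comb W γ - G) ≤ frob Y :=
        (sq_le_sq₀ (frob_nonneg _) (frob_nonneg _)).1 hle
      have hcG : frob (comb W γ - -G) ≤ 2 * frob Y := by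
        have := frob_sub_le Y (Y - comb W γ - G)
        have e : Y - (Y - comb W γ - G) = comb W γ - -G := by abel
        rw [e] at this
        linarith
      have hγ : ∑ k, γ k ^ 2 ≤ 4 * frob Y ^ 2 / m := by
        rw [le_div_iff₀ hm, mul_comm]
        refine (mul_sum_sq_le_frob_comb_sub_sq hW γ (G := -G)
          (by rw [rk_neg]; omega)).trans ?_
        calc frob (comb W γ - -G) ^ 2 ≤ (2 * frob Y) ^ 2 :=
              pow_le_pow_left₀ (frob_nonneg _) hcG 2
          _ = _ := by ring
      have hγk : ∀ k, |γ k| ≤ g := fun k => by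
        refine Real.le_sqrt_of_sq_le ?_
        rw [sq_abs]
        exact (Finset.single_le_sum (f := fun k => γ k ^ 2) (fun i _ => sq_nonneg _)
          (Finset.mem_univ k)).trans hγ
      refine max_le_max ((pi_norm_le_iff_of_nonneg (Real.sqrt_nonneg _)).2 hγk) ?_
      refine (norm_le_frob G).trans ?_
      have e : G = (comb W γ - -G) - comb W γ := by abel
      rw [e]
      refine (frob_sub_le _ _).trans (add_le_add hcG ((frob_comb_le W γ).trans ?_))
      exact Finset.sum_le_sum fun k _ => mul_le_mul_of_nonneg_right (hγk k) (frob_nonneg _))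
  exact ⟨q, hq, fun γ G hG => hmin (γ, G) hG⟩

end Existence

/-! ### The optimal weights -/

section Weights

variable {N T K : ℕ}

/-- `max(√N, √T)`, the order of the spectral norm of the noise. -/
def maxRoot (N T : ℕ) : ℝ := max (√N) (√T)

/-- `min(√N, √T)`. Its inverse square is the rate of convergence of the debiased estimator. -/
def minRoot (N T : ℕ) : ℝ := min (√N) (√T)

theorem maxRoot_mul_minRoot (N T : ℕ) : maxRoot N T * minRoot N T = √((N : ℝ) * T) := by
  rw [maxRoot, minRoot, max_mul_min, Real.sqrt_mul (Nat.cast_nonneg N)]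

theorem minRoot_le_maxRoot (N T : ℕ) : minRoot N T ≤ maxRoot N T := min_le_max

theorem minRoot_sq (N T : ℕ) : minRoot N T ^ 2 = min (N : ℝ) T := by
  rcases le_total (N : ℝ) T with h | h
  · rw [minRoot, min_eq_left (Real.sqrt_le_sqrt h), min_eq_left h, Real.sq_sqrt (by positivity)]
  · rw [minRoot, min_eq_right (Real.sqrt_le_sqrt h), min_eq_right h, Real.sq_sqrt (by positivity)]

theorem maxRoot_sq (N T : ℕ) : maxRoot N T ^ 2 = max (N : ℝ) T := by
  rcases le_total (N : ℝ) T with h | h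
  · rw [maxRoot, max_eq_right (Real.sqrt_le_sqrt h), max_eq_right h, Real.sq_sqrt (by positivity)]
  · rw [maxRoot, max_eq_left (Real.sqrt_le_sqrt h), max_eq_left h, Real.sq_sqrt (by positivity)]

/-- The bounds on the decomposition `W_j = ∑_{k ≠ j} π_k W_k + H + V` of the `j`-th regressor that
hold with high probability, with one constant `C` for the stochastic `𝒪` conditions and one
tolerance `τ` for the stochastic `o` conditions. -/
def HasDecomposition (W : Regressors N T K) (j : Fin (K + 1)) (c C τ : ℝ) : Prop :=
  ∃ (π : Coef K) (H V : Panel N T),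
    W j = ∑ k ∈ Finset.univ.erase j, π k • W k + H + V ∧
    frob V ≤ C * √((N : ℝ) * T) ∧ √((N : ℝ) * T) ≤ C * frob V ∧
    sv 1 V ≤ C * maxRoot N T ∧
    frob H ≤ C * √((N : ℝ) * T) ∧ |ip H V| ≤ C * √((N : ℝ) * T) ∧
    (∀ k, k ≠ j → frob (W k) ≤ C * √((N : ℝ) * T)) ∧
    (∀ k, k ≠ j → |ip (W k) V| ≤ C * √((N : ℝ) * T)) ∧
    IsUnit (gramExcept W j).det ∧
    √(∑ k, ∑ l, (gramExcept W j)⁻¹ k l ^ 2) ≤ C * (1 / ((N : ℝ) * T)) ∧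
    maxSq V ≤ τ * ((N : ℝ) * T * c) ∧
    (∀ k, k ≠ j → maxSq (W k) ≤ τ * (((N : ℝ) * T) ^ 2 * c))

/-- The coefficients of the projection of a panel `V` on the regressors other than the `j`-th. -/
theorem exists_projection_coefficients (W : Regressors N T K) (j : Fin (K + 1)) (V : Panel N T)
    {x y : ℝ} (hG : IsUnit (gramExcept W j).det)
    (hx : √(∑ k, ∑ l, (gramExcept W j)⁻¹ k l ^ 2) ≤ x)
    (hy : ∀ k, k ≠ j → |ip (W k) V| ≤ y) :
    ∃ a : {k // k ≠ j} → ℝ, (∀ k, |a k| ≤ K * (x * y)) ∧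
      ∀ l, l ≠ j → ip (V - ∑ k, a k • W k) (W l) = 0 := by
  set G := gramExcept W j with hGdef
  let g : {k // k ≠ j} → ℝ := fun k => ip (W k) V
  refine ⟨Matrix.vecMul g G⁻¹, fun k => ?_, fun l hl => ?_⟩
  · have hcard : Fintype.card {k // k ≠ j} = K := by simp [Fintype.card_subtype_compl]
    rw [Matrix.vecMul, dotProduct]
    refine (Finset.abs_sum_le_sum_abs _ _).trans ?_
    have : ∀ l ∈ (Finset.univ : Finset {k // k ≠ j}), |g l * G⁻¹ l k| ≤ x * y := by
      intro l _
      rw [abs_mul, mul_comm]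
      refine mul_le_mul (le_trans (Real.abs_le_sqrt ?_) hx) (hy l l.2) (abs_nonneg _)
        ((Real.sqrt_nonneg _).trans hx)
      exact (Finset.single_le_sum (f := fun k' => G⁻¹ l k' ^ 2) (fun _ _ => sq_nonneg _)
        (Finset.mem_univ k)).trans (Finset.single_le_sum (f := fun l' => ∑ k', G⁻¹ l' k' ^ 2)
        (fun _ _ => Finset.sum_nonneg fun _ _ => sq_nonneg _) (Finset.mem_univ l))
    refine (Finset.sum_le_card_nsmul _ _ _ this).trans (le_of_eq ?_)
    rw [Finset.card_univ, hcard, nsmul_eq_mul]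
  · have h1 : Matrix.vecMul (Matrix.vecMul g G⁻¹) G = g := by
      rw [Matrix.vecMul_vecMul, Matrix.nonsing_inv_mul _ hG, Matrix.vecMul_one]
    have h2 := congrFun h1 ⟨l, hl⟩
    rw [ip_sub_left, ip_comm (∑ k, _), ip_sum_right]
    simp only [ip_smul_right]
    have h3 : Matrix.vecMul (Matrix.vecMul g G⁻¹) G ⟨l, hl⟩ =
        ∑ k : {k // k ≠ j}, Matrix.vecMul g G⁻¹ k * ip (W l) (W k) := by
      rw [Matrix.vecMul, dotProduct]
      refine Finset.sum_congr rfl fun k _ => ?_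
      rw [hGdef, gramExcept, Matrix.of_apply, ip_comm]
    rw [← h3, h2, ip_comm, sub_self]

/-- When the regressors satisfy the bounds of `HasDecomposition`, the residual of the projection of
`V` on the other regressors, suitably normalized, is a feasible weight. It is as small as the true
`V` would suggest both in Frobenius and in spectral norm. -/
theorem exists_isFeasibleWeight (K : ℕ) {C : ℝ} (hC : 1 ≤ C) :
    ∃ C₁ S₀ τ₀ : ℝ, 0 < C₁ ∧ 0 < τ₀ ∧ ∀ {N T : ℕ} (W : Regressors N T K) (j : Fin (K + 1))
      {c τ : ℝ}, 0 < c → 0 ≤ τ → τ ≤ τ₀ → 1 ≤ minRoot N T → S₀ ≤ √((N : ℝ) * T) →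
      (∀ k, sv 1 (W k) ≤ C * √((N : ℝ) * T)) → HasDecomposition W j c C τ →
      ∃ B, IsFeasibleWeight W j c B ∧ frob B ≤ C₁ / √((N : ℝ) * T) ∧
        sv 1 B ≤ C₁ * maxRoot N T / ((N : ℝ) * T) := by
  have hC0 : 0 < C := by linarith
  obtain ⟨C1, hC1⟩ : ∃ x : ℝ, x = K * (C * C) := ⟨_, rfl⟩
  have hC1' : 0 ≤ C1 := by rw [hC1]; positivity
  obtain ⟨C2, hC2⟩ : ∃ x : ℝ, x = K * C1 * C + C + K * C1 * C ^ 2 := ⟨_, rfl⟩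
  obtain ⟨C3, hC3⟩ : ∃ x : ℝ, x = C + K * C1 * C := ⟨_, rfl⟩
  have hC3' : 0 < C3 := by rw [hC3]; positivity
  refine ⟨2 * C ^ 2 * C3, max (2 * C ^ 2 * C2) (2 * C * (K * C1 * C)),
    1 / (4 * C ^ 2 * (1 + K * C1) ^ 2), by positivity, by positivity, ?_⟩
  intro N T W j c τ hc hτ hττ hmin hS hsvW ⟨π, H, V, hW, hV, hV', hsV, hH, hHV, hWk, hWV, hdet,
    hinv, hmaxV, hmaxW⟩
  have hmax : 1 ≤ maxRoot N T := hmin.trans (minRoot_le_maxRoot N T)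
  set S := √((N : ℝ) * T) with hSdef
  have hNT : (N : ℝ) * T = S ^ 2 := (Real.sq_sqrt (by positivity)).symm
  rw [hNT] at hinv hmaxV hmaxW ⊢
  have hS1 : 1 ≤ S := by
    rw [hSdef, ← maxRoot_mul_minRoot]
    exact one_le_mul_of_one_le_of_one_le hmax hmin
  have hS0 : 0 < S := by linarith
  have hSa : 2 * C ^ 2 * C2 ≤ S := (le_max_left _ _).trans hS
  have hSb : 2 * C * (K * C1 * C) ≤ S := (le_max_right _ _).trans hS
  obtain ⟨a, ha, horth⟩ := exists_projection_coefficients W j V hdet hinv hWV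
  have ha' : ∀ k, |a k| ≤ C1 / S := fun k => (ha k).trans (le_of_eq (by
    rw [hC1]; field_simp))
  have hcard : Fintype.card {k // k ≠ j} = K := by simp [Fintype.card_subtype_compl]
  have hsum : ∀ (f : {k // k ≠ j} → ℝ) (z : ℝ), (∀ k, f k ≤ z) → ∑ k, f k ≤ K * z := by
    intro f z hf
    refine (Finset.sum_le_card_nsmul _ _ z fun k _ => hf k).trans (le_of_eq ?_)
    rw [Finset.card_univ, hcard, nsmul_eq_mul]
  set V' := V - ∑ k, a k • W k with hV'def
  -- the projection part is bounded in Frobenius norm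
  have hproj : frob (∑ k, a k • W (k : {k // k ≠ j})) ≤ K * C1 * C := by
    refine (frob_sum_le _ _).trans ((hsum _ (C1 / S * (C * S)) fun k => ?_).trans (le_of_eq ?_))
    · rw [frob_smul]
      exact mul_le_mul (ha' k) (hWk k k.2) (frob_nonneg _) (by positivity)
    · field_simp
  have hprojsv : sv 1 (∑ k, a k • W (k : {k // k ≠ j})) ≤ K * C1 * C :=
    (sv_one_le_frob _).trans hproj
  have hKC : 0 ≤ K * C1 * C := by positivity
  have hfV' : frob V' ≤ C3 * S := by
    refine (frob_sub_le _ _).trans ?_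
    have := mul_le_mul_of_nonneg_left hS1 hKC
    rw [hC3, add_mul]
    linarith
  have hsV' : sv 1 V' ≤ C3 * maxRoot N T := by
    refine (sv_one_sub_le _ _).trans ?_
    have := mul_le_mul_of_nonneg_left hmax hKC
    rw [hC3, add_mul]
    linarith
  have hfV'low : S / (2 * C) ≤ frob V' := by
    have h1 := frob_add_le V' (∑ k, a k • W (k : {k // k ≠ j}))
    rw [hV'def, sub_add_cancel, ← hV'def] at h1
    have h2 : S / C ≤ frob V := by rw [div_le_iff₀ hC0, mul_comm]; exact hV'
    have h3 : K * C1 * C ≤ S / (2 * C) := by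
      rw [le_div_iff₀ (by positivity)]; linarith
    have h4 : S / C = S / (2 * C) + S / (2 * C) := by field_simp; ring
    linarith
  -- the normalizing constant is of the order of the squared norm of `V`
  set q := ip V' (W j) with hq
  have hqlow : S ^ 2 / (2 * C ^ 2) ≤ q := by
    have h1 : q = ip V' H + ip V' V := by
      rw [hq, hW, ip_add_right, ip_add_right, ip_sum_right]
      rw [Finset.sum_eq_zero, zero_add]
      intro k hk
      rw [ip_smul_right, horth k (Finset.ne_of_mem_erase hk), mul_zero]
    have h2 : ip V' V = frob V ^ 2 - ∑ k, a k * ip (W (k : {k // k ≠ j})) V := by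
      rw [hV'def, ip_sub_left, ip_self, ip_comm (∑ k, _) V, ip_sum_right]
      simp only [ip_comm V, ip_smul_left]
    have h3 : ip V' H = ip H V - ∑ k, a k * ip (W (k : {k // k ≠ j})) H := by
      rw [hV'def, ip_sub_left, ip_comm V, ip_comm (∑ k, _) H, ip_sum_right]
      simp only [ip_comm H, ip_smul_left]
    have h4 : ∑ k, a k * ip (W (k : {k // k ≠ j})) V ≤ K * (C1 / S * (C * S)) :=
      hsum _ _ fun k => (le_abs_self _).trans (by
        rw [abs_mul]
        exact mul_le_mul (ha' k) (hWV k k.2) (abs_nonneg _) (by positivity))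
    have h5 : ∑ k, a k * ip (W (k : {k // k ≠ j})) H ≤ K * (C1 / S * (C * S * (C * S))) :=
      hsum _ _ fun k => (le_abs_self _).trans (by
        rw [abs_mul]
        refine mul_le_mul (ha' k) ((abs_ip_le_frob _ _).trans ?_) (abs_nonneg _) (by positivity)
        exact mul_le_mul (hWk k k.2) hH (frob_nonneg _) (by positivity))
    have h4' : K * (C1 / S * (C * S)) = K * C1 * C := by field_simp
    have h5' : K * (C1 / S * (C * S * (C * S))) = K * C1 * C ^ 2 * S := by field_simp
    have h6 : S ^ 2 / C ^ 2 ≤ frob V ^ 2 := by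
      rw [div_le_iff₀ (by positivity), ← mul_pow, mul_comm (frob V)]
      exact pow_le_pow_left₀ hS0.le hV' 2
    have h7 := (abs_le.1 hHV).1
    have h8 : C2 * S ≤ S ^ 2 / (2 * C ^ 2) := by
      rw [le_div_iff₀ (by positivity)]
      calc C2 * S * (2 * C ^ 2) = 2 * C ^ 2 * C2 * S := by ring
        _ ≤ S * S := mul_le_mul_of_nonneg_right hSa hS0.le
        _ = S ^ 2 := (sq S).symm
    have h9 : S ^ 2 / C ^ 2 = S ^ 2 / (2 * C ^ 2) + S ^ 2 / (2 * C ^ 2) := by field_simp; ring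
    have h10 : K * C1 * C + C * S + K * C1 * C ^ 2 * S ≤ C2 * S := by
      have := mul_le_mul_of_nonneg_left hS1 hKC
      rw [hC2, add_mul, add_mul]
      linarith
    rw [h1, h2, h3]
    linarith
  have hq0 : 0 < q := lt_of_lt_of_le (by positivity) hqlow
  have hqinv : |q⁻¹| ≤ 2 * C ^ 2 / S ^ 2 := by
    rw [abs_of_pos (inv_pos.2 hq0)]
    refine (inv_anti₀ (by positivity) hqlow).trans (le_of_eq ?_)
    rw [inv_div]
  refine ⟨q⁻¹ • V', ⟨?_, ?_, ?_⟩, ?_, ?_⟩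
  · have hV'0 : V' ≠ 0 := fun h => by
      rw [frob_eq_zero.2 h] at hfV'low
      have : 0 < S / (2 * C) := by positivity
      linarith
    refine (lind_le_iff (smul_ne_zero (inv_ne_zero hq0.ne') hV'0) c).2 fun i t => ?_
    rw [frob_smul, mul_pow, sq_abs, Pi.smul_apply, Pi.smul_apply, smul_eq_mul, mul_pow,
      mul_left_comm]
    refine mul_le_mul_of_nonneg_left ?_ (sq_nonneg _)
    set ρ := √(τ * c) with hρ
    have hρ2 : ρ ^ 2 = τ * c := Real.sq_sqrt (by positivity)
    have hρ0 : 0 ≤ ρ := Real.sqrt_nonneg _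
    have e1 : |V i t| ≤ ρ * S := by
      refine abs_le_of_sq_le_sq ?_ (by positivity)
      rw [mul_pow, hρ2]
      refine (sq_le_maxSq V i t).trans (hmaxV.trans (le_of_eq (by ring)))
    have e2 : ∀ k, k ≠ j → |W k i t| ≤ ρ * S ^ 2 := by
      intro k hk
      refine abs_le_of_sq_le_sq ?_ (by positivity)
      rw [mul_pow, hρ2]
      refine (sq_le_maxSq (W k) i t).trans ((hmaxW k hk).trans (le_of_eq (by ring)))
    have e3 : |V' i t| ≤ ρ * S * (1 + K * C1) := by
      have : V' i t = V i t - ∑ k, a k * W (k : {k // k ≠ j}) i t := by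
        simp [hV'def, Finset.sum_apply]
      rw [this]
      refine (abs_sub _ _).trans ?_
      have h1 : |∑ k, a k * W (k : {k // k ≠ j}) i t| ≤ K * (C1 / S * (ρ * S ^ 2)) := by
        refine (Finset.abs_sum_le_sum_abs _ _).trans (hsum _ _ fun k => ?_)
        rw [abs_mul]
        exact mul_le_mul (ha' k) (e2 k k.2) (abs_nonneg _) (by positivity)
      have h2 : K * (C1 / S * (ρ * S ^ 2)) = ρ * S * (K * C1) := by field_simp
      linarith
    have e4 : V' i t ^ 2 ≤ (ρ * S * (1 + K * C1)) ^ 2 := by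
      rw [← sq_abs]; exact pow_le_pow_left₀ (abs_nonneg _) e3 2
    refine e4.trans ?_
    have e5 : (S / (2 * C)) ^ 2 ≤ frob V' ^ 2 := pow_le_pow_left₀ (by positivity) hfV'low 2
    refine le_trans ?_ (mul_le_mul_of_nonneg_left e5 hc.le)
    rw [mul_pow, mul_pow, hρ2, div_pow]
    have e6 : τ * (4 * C ^ 2 * (1 + K * C1) ^ 2) ≤ 1 := by
      rwa [le_div_iff₀ (by positivity)] at hττ
    have e7 : c * (S ^ 2 / (2 * C) ^ 2) - τ * c * S ^ 2 * (1 + K * C1) ^ 2 =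
      c * S ^ 2 / (4 * C ^ 2) * (1 - τ * (4 * C ^ 2 * (1 + K * C1) ^ 2)) := by
      field_simp; ring
    have e8 : 0 ≤ c * S ^ 2 / (4 * C ^ 2) * (1 - τ * (4 * C ^ 2 * (1 + K * C1) ^ 2)) :=
      mul_nonneg (by positivity) (by linarith)
    linarith
  · rw [ip_smul_left, ← hq, inv_mul_cancel₀ hq0.ne']
  · intro k hk
    rw [ip_smul_left, horth k hk, mul_zero]
  · rw [frob_smul]
    refine (mul_le_mul hqinv hfV' (frob_nonneg _) (by positivity)).trans (le_of_eq ?_)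
    field_simp
  · refine (sv_one_smul_le _ _).trans ((mul_le_mul hqinv hsV' (sv_nonneg _ _)
      (by positivity)).trans (le_of_eq ?_))
    field_simp

/-- The optimal weights exist and are small: their Frobenius norm, and `max(√N, √T)` times their
spectral norm when there are factors, are of order `1 / min(N, T)`. -/
theorem isOptimalWeight_bounds (K R : ℕ) {C : ℝ} (hC : 1 ≤ C) :
    ∃ C₁ S₀ τ₀ : ℝ, 0 < C₁ ∧ 0 < τ₀ ∧ ∀ {N T : ℕ} (W : Regressors N T K) (j : Fin (K + 1))
      {c τ : ℝ}, 0 < c → 0 ≤ τ → τ ≤ τ₀ → 1 ≤ minRoot N T → S₀ ≤ √((N : ℝ) * T) →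
      (∀ k, sv 1 (W k) ≤ C * √((N : ℝ) * T)) → HasDecomposition W j c C τ →
      (∃ A, IsOptimalWeight W j (bStar N T R) c A) ∧
      ∀ A, IsOptimalWeight W j (bStar N T R) c A →
        frob A ≤ C₁ / minRoot N T ^ 2 ∧
        R * (maxRoot N T * sv 1 A) ≤ C₁ / minRoot N T ^ 2 := by
  obtain ⟨C1, S0, τ0, hC1, hτ0, h⟩ := exists_isFeasibleWeight K hC
  refine ⟨C1 * (1 + 8 * R), S0, τ0, by positivity, hτ0, ?_⟩
  intro N T W j c τ hc hτ hττ hmin hS hsvW hdec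
  obtain ⟨B, hB, hBf, hBs⟩ := h W j hc hτ hττ hmin hS hsvW hdec
  refine ⟨exists_isOptimalWeight _ hB, fun A hA => ?_⟩
  have hopt := hA.2 B hB
  set μ := maxRoot N T with hμ
  set ν := minRoot N T with hν
  have hνμ : ν ≤ μ := minRoot_le_maxRoot N T
  have hμ0 : 0 < μ := by linarith
  have hν0 : 0 < ν := by linarith
  have hSμν : √((N : ℝ) * T) = μ * ν := (maxRoot_mul_minRoot N T).symm
  have hNT : (N : ℝ) * T = (μ * ν) ^ 2 := by rw [← hSμν, Real.sq_sqrt (by positivity)]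
  rw [hSμν] at hBf
  rw [hNT] at hBs
  have hb1 : bStar N T R ≤ 8 * R * μ := by
    rw [bStar]
    have h1 : √(N : ℝ) ≤ μ := le_max_left _ _
    have h2 : √(T : ℝ) ≤ μ := le_max_right _ _
    have : (0 : ℝ) ≤ R := Nat.cast_nonneg R
    nlinarith
  have hb2 : 4 * R * μ ≤ bStar N T R := by
    rw [bStar]
    have h1 : μ ≤ √(N : ℝ) + √(T : ℝ) :=
      max_le (le_add_of_nonneg_right (Real.sqrt_nonneg _))
        (le_add_of_nonneg_left (Real.sqrt_nonneg _))
    gcongr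
  have hb0 : 0 ≤ bStar N T R := le_trans (by positivity) hb2
  have hBf2 : frob B ≤ C1 / ν ^ 2 := by
    refine hBf.trans ?_
    gcongr
    nlinarith
  have hBs2 : bStar N T R * sv 1 B ≤ 8 * R * (C1 / ν ^ 2) := by
    refine (mul_le_mul hb1 hBs (sv_nonneg _ _) (by positivity)).trans (le_of_eq ?_)
    field_simp
  have htot : frob A ^ 2 + bStar N T R ^ 2 * sv 1 A ^ 2 ≤ (C1 * (1 + 8 * R) / ν ^ 2) ^ 2 := by
    refine hopt.trans ?_
    have e1 := pow_le_pow_left₀ (frob_nonneg B) hBf2 2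
    have e2 := pow_le_pow_left₀ (mul_nonneg hb0 (sv_nonneg 1 B)) hBs2 2
    rw [mul_pow] at e2
    have e3 : C1 * (1 + 8 * R) / ν ^ 2 = C1 / ν ^ 2 + 8 * R * (C1 / ν ^ 2) := by ring
    rw [e3]
    have : 0 ≤ C1 / ν ^ 2 * (8 * R * (C1 / ν ^ 2)) := by positivity
    nlinarith
  have hpos : 0 ≤ C1 * (1 + 8 * R) / ν ^ 2 := by positivity
  constructor
  · refine (sq_le_sq₀ (frob_nonneg _) hpos).1 (le_trans ?_ htot)
    have := mul_nonneg (sq_nonneg (bStar N T R)) (sq_nonneg (sv 1 A))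
    linarith
  · have h1 : bStar N T R * sv 1 A ≤ C1 * (1 + 8 * R) / ν ^ 2 := by
      refine (sq_le_sq₀ (mul_nonneg hb0 (sv_nonneg _ _)) hpos).1 (le_trans ?_ htot)
      rw [mul_pow]
      have := sq_nonneg (frob A)
      linarith
    have h2 : 4 * R * μ * sv 1 A ≤ bStar N T R * sv 1 A :=
      mul_le_mul_of_nonneg_right hb2 (sv_nonneg _ _)
    have h3 : 0 ≤ R * (μ * sv 1 A) :=
      mul_nonneg (Nat.cast_nonneg R) (mul_nonneg hμ0.le (sv_nonneg _ _))
    nlinarith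

end Weights

/-! ### Estimation errors on a regular draw -/

section Estimation

variable {N T K : ℕ}

/-- The bounds on a draw of `(W, Γ, U)` that hold with high probability: `C` is a common constant
for the stochastic `𝒪` conditions, `τ` a common tolerance for the stochastic `o` conditions, and
`κ²` is the noncollinearity constant. -/
structure RegularDraw (R : ℕ) (W : Regressors N T K) (Γ U : Panel N T) (c κ C τ : ℝ) :
    Prop where
  rank_le : rk Γ ≤ R
  noncollinear : ∀ γ : Coef K, ∑ k, γ k ^ 2 = 1 →
    κ ^ 2 * ((N : ℝ) * T) ≤
      ∑ r ∈ Finset.Icc (2 * R + 1) (min N T), sv r (comb W γ) ^ 2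
  sv_regressor_le : ∀ k, sv 1 (W k) ≤ C * √((N : ℝ) * T)
  sv_error_le : sv 1 U ≤ C * maxRoot N T
  le_sv_error : maxRoot N T ≤ C * sv 1 U
  ip_regressor_error : ∀ k, |ip (W k) U| ≤ C * √((N : ℝ) * T)
  sv_gap : sv 1 U - sv (2 * R + 1) U ≤ τ * sv 1 U
  decomposition : ∀ j, HasDecomposition W j c C τ

theorem abs_le_of_mul_sum_sq_le {m x : ℝ} (hm : 0 < m) (hx : 0 ≤ x) {γ : Coef K}
    (h : m ^ 2 * ∑ k, γ k ^ 2 ≤ x ^ 2) (k : Fin (K + 1)) : |γ k| ≤ x / m := by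
  rw [le_div_iff₀ hm, mul_comm]
  refine (sq_le_sq₀ (by positivity) hx).1 (le_trans ?_ h)
  rw [mul_pow, sq_abs]
  exact mul_le_mul_of_nonneg_left (Finset.single_le_sum (f := fun k => γ k ^ 2)
    (fun _ _ => sq_nonneg _) (Finset.mem_univ k)) (sq_nonneg m)

theorem sv_comb_le {W : Regressors N T K} {γ : Coef K} {x y : ℝ} (hx : ∀ k, sv 1 (W k) ≤ x)
    (hy : ∀ k, |γ k| ≤ y) : sv 1 (comb W γ) ≤ (K + 1) * (y * x) := by
  refine (sv_one_comb_le W γ).trans ((Finset.sum_le_card_nsmul _ _ (y * x) fun k _ => ?_).trans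
    (le_of_eq ?_))
  · exact mul_le_mul (hy k) (hx k) (sv_nonneg _ _) ((abs_nonneg _).trans (hy k))
  · simp

theorem abs_ip_comb_le {W : Regressors N T K} {γ : Coef K} {B : Panel N T} {x y : ℝ}
    (hx : ∀ k, |ip (W k) B| ≤ x) (hy : ∀ k, |γ k| ≤ y) :
    |ip B (comb W γ)| ≤ (K + 1) * (y * x) := by
  rw [ip_comb_right]
  refine (Finset.abs_sum_le_sum_abs _ _).trans
    ((Finset.sum_le_card_nsmul _ _ (y * x) fun k _ => ?_).trans (le_of_eq ?_))
  · rw [abs_mul, ip_comm]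
    exact mul_le_mul (hy k) (hx k) (abs_nonneg _) ((abs_nonneg _).trans (hy k))
  · simp

/-- If adding `E` to `U` does not increase the Frobenius norm, then `E` is controlled by its inner
product with `U`. -/
theorem frob_sq_le_of_frob_add_sq_le {U E : Panel N T} (h : frob (U + E) ^ 2 ≤ frob U ^ 2) :
    frob E ^ 2 ≤ 2 * |ip U E| := by
  rw [← ip_self, ← ip_self, ip_add_left, ip_add_right, ip_add_right, ip_comm E U, ip_self E] at h
  have := neg_abs_le (ip U E)
  linarith

/-- The error of the least squares fit is of the order of the spectral norm of the noise. -/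
theorem leastSquares_bounds (K R : ℕ) {C κ : ℝ} (hC : 1 ≤ C) (hκ : 0 < κ) :
    ∃ C₁ : ℝ, 0 < C₁ ∧ ∀ {N T : ℕ} {W : Regressors N T K} {Γ U : Panel N T} {c τ : ℝ}
      (θ : Coef K) (q : Coef K × Panel N T), 1 ≤ minRoot N T → RegularDraw R W Γ U c κ C τ →
      IsLeastSquares R (comb W θ + Γ + U) W q →
      frob (comb W θ + Γ + U - comb W q.1 - q.2 - U) ≤ C₁ * maxRoot N T ∧
      sv 1 (Γ - q.2) ≤ C₁ * maxRoot N T := by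
  have hC0 : 0 < C := by linarith
  obtain ⟨a, ha⟩ : ∃ x : ℝ, x = (K + 1) * C / κ := ⟨_, rfl⟩
  have ha0 : 0 < a := by rw [ha]; positivity
  obtain ⟨C2, hC2⟩ : ∃ x : ℝ, x = 2 * (2 * R * C * (1 + a) + a) := ⟨_, rfl⟩
  have hC20 : 0 < C2 := by rw [hC2]; positivity
  refine ⟨(1 + a) * C2, by positivity, ?_⟩
  intro N T W Γ U c τ θ q hmin hD hq
  have hmax : 1 ≤ maxRoot N T := hmin.trans (minRoot_le_maxRoot N T)
  set S := √((N : ℝ) * T) with hSdef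
  have hNT : (N : ℝ) * T = S ^ 2 := (Real.sq_sqrt (by positivity)).symm
  have hS0 : 0 < S := by
    rw [hSdef, ← maxRoot_mul_minRoot]
    positivity
  set Δ := θ - q.1 with hΔ
  set G := Γ - q.2 with hG
  have hrk : rk G ≤ 2 * R := by
    have : rk G ≤ rk Γ + rk q.2 := rk_sub_le Γ q.2
    have := hD.rank_le
    have := hq.1
    omega
  have hE : comb W θ + Γ + U - comb W q.1 - q.2 - U = comb W Δ + G := by
    rw [hΔ, hG, comb_sub]; abel
  set E := comb W Δ + G with hEdef
  rw [hE]
  set x := frob E with hx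
  have hx0 : 0 ≤ x := frob_nonneg E
  have hmain : x ^ 2 ≤ 2 * |ip U E| := by
    refine frob_sq_le_of_frob_add_sq_le ?_
    have h1 := hq.2 θ Γ hD.rank_le
    have e1 : comb W θ + Γ + U - comb W q.1 - q.2 = U + E := by rw [← hE]; abel
    have e2 : comb W θ + Γ + U - comb W θ - Γ = U := by abel
    rwa [e1, e2] at h1
  have hΔk : ∀ k, |Δ k| ≤ x / (κ * S) := by
    refine abs_le_of_mul_sum_sq_le (by positivity) hx0 ?_
    have h1 := mul_sum_sq_le_frob_comb_sub_sq (k := 2 * R) hD.noncollinear Δ (G := -G)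
      (by rwa [rk_neg])
    rw [sub_neg_eq_add, hNT, ← mul_pow] at h1
    exact h1
  have hcs : ((K : ℝ) + 1) * (x / (κ * S) * (C * S)) = a * x := by rw [ha]; field_simp
  have hsvΔ : sv 1 (comb W Δ) ≤ a * x :=
    (sv_comb_le hD.sv_regressor_le hΔk).trans (le_of_eq hcs)
  have hipΔ : |ip U (comb W Δ)| ≤ a * x :=
    (abs_ip_comb_le hD.ip_regressor_error hΔk).trans (le_of_eq hcs)
  have hsvG : sv 1 G ≤ (1 + a) * x := by
    have e : G = E - comb W Δ := by rw [hEdef]; abel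
    rw [e]
    have := sv_one_sub_le E (comb W Δ)
    have := sv_one_le_frob E
    linarith
  have hipG : |ip U G| ≤ 2 * R * (C * maxRoot N T * ((1 + a) * x)) := by
    refine (abs_ip_le_rk U G).trans (mul_le_mul (by exact_mod_cast hrk) ?_
      (mul_nonneg (sv_nonneg _ _) (sv_nonneg _ _)) (by positivity))
    exact mul_le_mul hD.sv_error_le hsvG (sv_nonneg _ _) (by positivity)
  have hipE : 2 * |ip U E| ≤ C2 * maxRoot N T * x := by
    have h1 : |ip U E| ≤ |ip U (comb W Δ)| + |ip U G| := by
      rw [hEdef, ip_add_right]; exact abs_add_le _ _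
    have h2 : a * x * 1 ≤ a * x * maxRoot N T := by gcongr
    have h3 : C2 * maxRoot N T * x = 2 * (2 * R * (C * maxRoot N T * ((1 + a) * x)) +
        a * x * maxRoot N T) := by rw [hC2]; ring
    rw [h3]
    linarith
  have hxle : x ≤ C2 * maxRoot N T := by
    rcases hx0.eq_or_lt with h | h
    · rw [← h]; positivity
    · refine le_of_mul_le_mul_right ?_ h
      calc x * x = x ^ 2 := (sq x).symm
        _ ≤ _ := hmain.trans hipE
  constructor
  · refine hxle.trans ?_
    have : 0 ≤ a * (C2 * maxRoot N T) := by positivity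
    linarith
  · refine hsvG.trans ?_
    rw [mul_assoc]
    gcongr

/-- On a regular draw on which the weighted noise terms are bounded, the weights are feasible, the
residuals of the least squares fit are close to the errors, the debiased estimator has the rate
`1 / min(N, T)`, and its bias is at most the bias bound. The bias bound works because `Û_pre` differs
from `U` by a small matrix and a matrix of rank at most `2 R`, so that its spectral norm is at least
nearly `s_{2R+1}(U)`, hence nearly `s_1(U)`. -/
theorem procedure_bounds (K R : ℕ) {C κ ε : ℝ} (hC : 1 ≤ C) (hκ : 0 < κ) (hε : 0 < ε) :
    ∃ C₁ ν₀ τ₀ : ℝ, 0 < C₁ ∧ 0 < τ₀ ∧ ∀ {N T : ℕ} {c : ℝ} (F : Procedure N T K R c)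
      {W : Regressors N T K} {Γ U : Panel N T} {τ : ℝ} (θ : Coef K),
      0 < c → 0 ≤ τ → τ ≤ τ₀ → ν₀ ≤ minRoot N T → RegularDraw R W Γ U c κ C τ →
      (∀ j, |ip (F.weights j W) U| ≤ C * frob (F.weights j W)) →
      IsFeasibleWeight W 0 c (F.weights 0 W) ∧
      frob (F.UHat (comb W θ + Γ + U, W) - U) ≤ C₁ * maxRoot N T ∧
      |F.betaHat (comb W θ + Γ + U, W) - θ 0| ≤ C₁ / minRoot N T ^ 2 ∧
      |F.betaHat (comb W θ + Γ + U, W) - θ 0 - ip (F.weights 0 W) U| ≤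
        F.biasBound ε (comb W θ + Γ + U, W) := by
  have hC0 : 0 < C := by linarith
  obtain ⟨A1, S1, τ1, hA1, hτ1, hweights⟩ := isOptimalWeight_bounds K R hC
  obtain ⟨L1, hL1, hls⟩ := leastSquares_bounds K R hC hκ
  -- constants bounding the errors of the preliminary coefficients, of the spectral norm of the
  -- corresponding linear combination of regressors, and of the second-stage factor estimate
  obtain ⟨P1, hP1⟩ : ∃ x : ℝ, x = C * A1 + 2 * (A1 * L1) := ⟨_, rfl⟩
  have hP10 : 0 < P1 := by rw [hP1]; positivity
  obtain ⟨P2, hP2⟩ : ∃ x : ℝ, x = (K + 1) * (P1 * C) := ⟨_, rfl⟩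
  have hP20 : 0 < P2 := by rw [hP2]; positivity
  obtain ⟨P3, hP3⟩ : ∃ x : ℝ, x = 4 * R * (C + P2) := ⟨_, rfl⟩
  have hP30 : 0 ≤ P3 := by rw [hP3]; positivity
  -- `(1 + t) / (1 - 2 t) ≤ 1 + 2 ε` for the tolerance `t`
  obtain ⟨t, ht0, ht1, ht2⟩ : ∃ t : ℝ, 0 < t ∧ t ≤ 1 / 4 ∧ t * (3 + 4 * ε) ≤ 2 * ε := by
    refine ⟨min (1 / 4) (2 * ε / (3 + 4 * ε)), by positivity, min_le_left _ _, ?_⟩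
    rw [← le_div_iff₀ (by positivity)]
    exact min_le_right _ _
  refine ⟨L1 + (C * A1 + 2 * (A1 * P3)), max (max 1 S1) (P2 * C / t), min τ1 t, by positivity,
    by positivity, ?_⟩
  intro N T c F W Γ U τ θ hc hτ hττ hν hD hAU
  have hmin : 1 ≤ minRoot N T := ((le_max_left _ _).trans (le_max_left _ _)).trans hν
  have hmax : 1 ≤ maxRoot N T := hmin.trans (minRoot_le_maxRoot N T)
  have hS1 : S1 ≤ √((N : ℝ) * T) := by
    have h1 : S1 ≤ minRoot N T := ((le_max_right _ _).trans (le_max_left _ _)).trans hν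
    rw [← maxRoot_mul_minRoot]
    nlinarith
  have hνt : P2 * C / t ≤ minRoot N T := (le_max_right _ _).trans hν
  have hτ1' : τ ≤ τ1 := hττ.trans (min_le_left _ _)
  have hτt : τ ≤ t := hττ.trans (min_le_right _ _)
  set μ := maxRoot N T with hμ
  set ν := minRoot N T with hνdef
  have hμ0 : 0 < μ := by linarith
  have hν0 : 0 < ν := by linarith
  have hSμν : √((N : ℝ) * T) = μ * ν := (maxRoot_mul_minRoot N T).symm
  set Y := comb W θ + Γ + U with hY
  set A := fun j => F.weights j W with hA
  have hopt : ∀ j, IsOptimalWeight W j (bStar N T R) c (A j) := fun j =>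
    F.weights_optimal j W
      (hweights W j hc hτ hτ1' hmin hS1 hD.sv_regressor_le (hD.decomposition j)).1
  have hfA : ∀ j, frob (A j) ≤ A1 / ν ^ 2 := fun j =>
    ((hweights W j hc hτ hτ1' hmin hS1 hD.sv_regressor_le (hD.decomposition j)).2 _ (hopt j)).1
  have hsA : ∀ j, R * (μ * sv 1 (A j)) ≤ A1 / ν ^ 2 := fun j =>
    ((hweights W j hc hτ hτ1' hmin hS1 hD.sv_regressor_le (hD.decomposition j)).2 _ (hopt j)).2
  -- feasible weights recover the coefficients exactly
  have hexact : ∀ j (G : Panel N T), ip (A j) (Y - G) = θ j + ip (A j) U + ip (A j) (Γ - G) := by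
    intro j G
    have e : Y - G = comb W θ + U + (Γ - G) := by rw [hY]; abel
    rw [e, ip_add_right, ip_add_right, ip_comb_right, Finset.sum_eq_single j, (hopt j).1.2.1,
      mul_one]
    · intro k _ hk
      rw [(hopt j).1.2.2 k hk, mul_zero]
    · simp
  have hAip : ∀ j (G : Panel N T) (B : ℝ), rk G ≤ 2 * R → sv 1 G ≤ B * μ →
      |ip (A j) G| ≤ 2 * (A1 * B) / ν ^ 2 := by
    intro j G B hG hB
    have hB0 : 0 ≤ B := by
      have := (sv_nonneg 1 G).trans hB
      exact nonneg_of_mul_nonneg_left this hμ0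
    calc |ip (A j) G| ≤ rk G * (sv 1 (A j) * sv 1 G) := abs_ip_le_rk _ _
      _ ≤ 2 * R * (sv 1 (A j) * (B * μ)) := by
        refine mul_le_mul (by exact_mod_cast hG) ?_
          (mul_nonneg (sv_nonneg _ _) (sv_nonneg _ _)) (by positivity)
        exact mul_le_mul_of_nonneg_left hB (sv_nonneg _ _)
      _ = 2 * B * (R * (μ * sv 1 (A j))) := by ring
      _ ≤ 2 * B * (A1 / ν ^ 2) := mul_le_mul_of_nonneg_left (hsA j) (by positivity)
      _ = 2 * (A1 * B) / ν ^ 2 := by ring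
  have hAUb : ∀ j, |ip (A j) U| ≤ C * A1 / ν ^ 2 := fun j =>
    (hAU j).trans ((mul_le_mul_of_nonneg_left (hfA j) hC0.le).trans (le_of_eq (by ring)))
  -- noncollinearity guarantees a least squares minimizer, so the selection is one
  obtain ⟨q0, hq0⟩ := exists_isLeastSquares (m := κ ^ 2 * ((N : ℝ) * T))
    (by
      have : (N : ℝ) * T = (μ * ν) ^ 2 := by rw [← hSμν, Real.sq_sqrt (by positivity)]
      rw [this]; positivity) hD.noncollinear Y
  have hq := F.ls_optimal Y W ⟨q0, hq0⟩
  obtain ⟨hUhat, hGls⟩ := hls θ (F.ls (Y, W)) hmin hD hq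
  have hrkls : rk (Γ - (F.ls (Y, W)).2) ≤ 2 * R := by
    have := rk_sub_le Γ (F.ls (Y, W)).2
    have := hD.rank_le
    have := hq.1
    omega
  -- the preliminary coefficients err by the noise term and a weighted first-stage factor error
  set Δ : Coef K := θ - F.gammaPre (Y, W) with hΔ
  have hΔk : ∀ k, |Δ k| ≤ P1 / ν ^ 2 := by
    intro k
    have e : Δ k = -(ip (A k) U + ip (A k) (Γ - (F.ls (Y, W)).2)) := by
      have := hexact k (F.ls (Y, W)).2
      rw [hΔ, Pi.sub_apply, FirstStage.gammaPre]
      change θ k - ip (A k) (Y - (F.ls (Y, W)).2) = _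
      rw [this]; ring
    rw [e, abs_neg]
    refine (abs_add_le _ _).trans ((add_le_add (hAUb k) (hAip k _ L1 hrkls hGls)).trans
      (le_of_eq ?_))
    rw [hP1]; ring
  have hsvΔ : sv 1 (comb W Δ) ≤ P2 * (μ / ν) := by
    refine (sv_comb_le hD.sv_regressor_le hΔk).trans (le_of_eq ?_)
    rw [hSμν, hP2]; field_simp
  -- the second-stage factor estimate errs by the order of the spectral norm of the noise
  set G := Γ - F.GammaPre (Y, W) with hG
  have hbest := F.GammaPre_optimal (Y, W)
  have hrkG : rk G ≤ 2 * R := by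
    have : rk G ≤ rk Γ + rk (F.GammaPre (Y, W)) := rk_sub_le Γ _
    have := hD.rank_le
    have : rk (F.GammaPre (Y, W)) ≤ R := hbest.1
    omega
  have hUpre : F.UPre (Y, W) = U + comb W Δ + G := by
    change Y - comb W (F.gammaPre (Y, W)) - F.GammaPre (Y, W) = _
    rw [hΔ, hG, comb_sub]
    linear_combination hY
  have hfG : frob G ≤ P3 * μ := by
    have h1 := hbest.2 Γ hD.rank_le
    have e1 : Y - comb W (F.gammaPre (Y, W)) - F.GammaPre (Y, W) = U + comb W Δ + G := hUpre
    have e2 : Y - comb W (F.gammaPre (Y, W)) - Γ = U + comb W Δ := by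
      rw [hΔ, comb_sub]
      linear_combination hY
    simp only [e1, e2] at h1
    have h2 := frob_sq_le_of_frob_add_sq_le h1
    have hU' : sv 1 (U + comb W Δ) ≤ (C + P2) * μ := by
      have h3 : P2 * (μ / ν) ≤ P2 * μ := by
        gcongr
        exact div_le_self hμ0.le hmin
      have := sv_one_add_le U (comb W Δ)
      have := hD.sv_error_le
      rw [add_mul]
      linarith
    have h4 : |ip (U + comb W Δ) G| ≤ 2 * R * ((C + P2) * μ * frob G) := by
      refine (abs_ip_le_rk _ _).trans (mul_le_mul (by exact_mod_cast hrkG) ?_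
        (mul_nonneg (sv_nonneg _ _) (sv_nonneg _ _)) (by positivity))
      exact mul_le_mul hU' (sv_one_le_frob G) (sv_nonneg _ _) (by positivity)
    rcases (frob_nonneg G).eq_or_lt with h | h
    · rw [← h]; positivity
    · refine le_of_mul_le_mul_right ?_ h
      rw [hP3]
      linarith
  have hbeta : F.betaHat (Y, W) = θ 0 + ip (A 0) U + ip (A 0) G := hexact 0 _
  refine ⟨(hopt 0).1, ?_, ?_, ?_⟩
  · refine hUhat.trans (mul_le_mul_of_nonneg_right ?_ hμ0.le)
    have : 0 ≤ C * A1 + 2 * (A1 * P3) := by positivity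
    linarith
  · have e : F.betaHat (Y, W) - θ 0 = ip (A 0) U + ip (A 0) G := by rw [hbeta]; ring
    rw [e]
    refine (abs_add_le _ _).trans ((add_le_add (hAUb 0)
      (hAip 0 G P3 hrkG ((sv_one_le_frob G).trans hfG))).trans ?_)
    rw [← add_div]
    exact div_le_div_of_nonneg_right (le_add_of_nonneg_left hL1.le) (by positivity)
  · have e : F.betaHat (Y, W) - θ 0 - ip (A 0) U = ip (A 0) G := by rw [hbeta]; ring
    rw [e]
    set u := sv 1 U with hu
    set v := sv 1 (F.UPre (Y, W)) with hv
    have hu0 : 0 ≤ u := sv_nonneg _ _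
    have hv0 : 0 ≤ v := sv_nonneg _ _
    -- the perturbation from the preliminary coefficients is negligible relative to the noise
    have hsmall : sv 1 (comb W Δ) ≤ t * u := by
      refine hsvΔ.trans ?_
      have h1 : P2 * C ≤ ν * t := by rwa [div_le_iff₀ ht0] at hνt
      have h2 : μ ≤ C * u := hD.le_sv_error
      rw [← mul_div_assoc, div_le_iff₀ hν0]
      calc P2 * μ ≤ P2 * (C * u) := by gcongr
        _ = P2 * C * u := by ring
        _ ≤ ν * t * u := by gcongr
        _ = t * u * ν := by ring
    -- `U + G` and `Û_pre` differ by a small term, and `G` has rank at most `2 R`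
    have hlow : (1 - 2 * t) * u ≤ v := by
      have h1 : sv (2 * R + 1) U ≤ sv 1 (U - -G) := sv_le_of_rk_le U (-G) (by rwa [rk_neg])
      have h2 : U - -G = F.UPre (Y, W) - comb W Δ := by rw [hUpre]; abel
      rw [h2] at h1
      have h3 := sv_one_sub_le (F.UPre (Y, W)) (comb W Δ)
      have h4 := hD.sv_gap
      have h5 : τ * u ≤ t * u := by gcongr
      linarith
    have hsvG : sv 1 G ≤ 2 * (1 + ε) * v := by
      have h1 : G = F.UPre (Y, W) - (U + comb W Δ) := by rw [hUpre]; abel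
      have h2 := sv_one_sub_le (F.UPre (Y, W)) (U + comb W Δ)
      rw [← h1] at h2
      have h3 := sv_one_add_le U (comb W Δ)
      have h4 : (1 + t) * u ≤ (1 + 2 * ε) * ((1 - 2 * t) * u) := by
        have : 1 + t ≤ (1 + 2 * ε) * (1 - 2 * t) := by linarith
        calc (1 + t) * u ≤ (1 + 2 * ε) * (1 - 2 * t) * u := by gcongr
          _ = _ := by ring
      have h5 : (1 + 2 * ε) * ((1 - 2 * t) * u) ≤ (1 + 2 * ε) * v := by gcongr
      linarith
    rw [Procedure.biasBound, Procedure.CHat]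
    calc |ip (A 0) G| ≤ rk G * (sv 1 (A 0) * sv 1 G) := abs_ip_le_rk _ _
      _ ≤ 2 * R * (sv 1 (A 0) * (2 * (1 + ε) * v)) := by
        refine mul_le_mul (by exact_mod_cast hrkG) ?_
          (mul_nonneg (sv_nonneg _ _) (sv_nonneg _ _)) (by positivity)
        exact mul_le_mul_of_nonneg_left hsvG (sv_nonneg _ _)
      _ = 4 * R * v * (1 + ε) * sv 1 (A 0) := by ring
      _ = _ := rfl

/-- The standard error is close to `s` if the residuals are close to the errors and the weighted sum
of squared errors is close to `s²`. -/
theorem abs_se_div_sub_one_le {A U E : Panel N T} {c x s σ τ : ℝ} (hc : 0 ≤ c) (hx : 0 ≤ x)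
    (hσ : 0 < σ) (hs : 0 < s) (hτ : 0 ≤ τ) (hA : ∀ i t, A i t ^ 2 ≤ c * frob A ^ 2) (hE : frob E ≤ x)
    (hsA : σ ^ 2 * frob A ^ 2 ≤ s ^ 2)
    (hU : |∑ i, ∑ t, A i t ^ 2 * U i t ^ 2 - s ^ 2| ≤ τ * frob A ^ 2) :
    |√(∑ i, ∑ t, A i t ^ 2 * (U + E) i t ^ 2) / s - 1| ≤ τ / σ ^ 2 + √c * x / σ := by
  let AU : Panel N T := fun i t => A i t * U i t
  let AE : Panel N T := fun i t => A i t * E i t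
  have e1 : √(∑ i, ∑ t, A i t ^ 2 * (U + E) i t ^ 2) = frob (AU + AE) := by
    rw [frob]
    congr 1
    refine Finset.sum_congr rfl fun i _ => Finset.sum_congr rfl fun t _ => ?_
    simp only [AU, AE, Pi.add_apply]
    ring
  have e2 : ∑ i, ∑ t, A i t ^ 2 * U i t ^ 2 = frob AU ^ 2 := by
    rw [frob_sq]
    refine Finset.sum_congr rfl fun i _ => Finset.sum_congr rfl fun t _ => ?_
    simp only [AU]
    ring
  have hAE : frob AE ≤ √c * frob A * x := by
    refine (sq_le_sq₀ (frob_nonneg _)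
      (mul_nonneg (mul_nonneg (Real.sqrt_nonneg _) (frob_nonneg _)) hx)).1 ?_
    rw [mul_pow, mul_pow, Real.sq_sqrt hc, frob_sq]
    have hE2 : frob E ^ 2 ≤ x ^ 2 := pow_le_pow_left₀ (frob_nonneg _) hE 2
    refine le_trans ?_ (mul_le_mul_of_nonneg_left hE2 (mul_nonneg hc (sq_nonneg (frob A))))
    rw [frob_sq E, Finset.mul_sum]
    refine Finset.sum_le_sum fun i _ => ?_
    rw [Finset.mul_sum]
    refine Finset.sum_le_sum fun t _ => ?_
    simp only [AE, mul_pow]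
    exact mul_le_mul_of_nonneg_right (hA i t) (sq_nonneg _)
  have hAs : σ * frob A ≤ s := by
    refine (sq_le_sq₀ (mul_nonneg hσ.le (frob_nonneg _)) hs.le).1 ?_
    rwa [mul_pow]
  have h1 : |frob (AU + AE) - frob AU| ≤ frob AE := by
    rw [abs_sub_le_iff]
    have h2 := frob_add_le AU AE
    have h3 := frob_sub_le (AU + AE) AE
    rw [add_sub_cancel_right] at h3
    constructor <;> linarith
  -- `|a - s| ≤ |a² - s²| / s` for nonnegative `a`
  have h2 : |frob AU - s| ≤ τ * frob A ^ 2 / s := by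
    rw [le_div_iff₀ hs]
    rw [e2] at hU
    refine le_trans ?_ hU
    have : frob AU ^ 2 - s ^ 2 = (frob AU - s) * (frob AU + s) := by ring
    rw [this, abs_mul]
    refine mul_le_mul_of_nonneg_left ?_ (abs_nonneg _)
    exact (le_add_of_nonneg_left (frob_nonneg _)).trans (le_abs_self _)
  have h3 : |frob (AU + AE) - s| ≤ τ * frob A ^ 2 / s + √c * frob A * x := by
    have := abs_sub_le (frob (AU + AE)) (frob AU) s
    linarith
  rw [e1, div_sub_one hs.ne', abs_div, abs_of_pos hs, div_le_iff₀ hs]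
  refine h3.trans ?_
  rw [add_mul]
  refine add_le_add ?_ ?_
  · rw [div_le_iff₀ hs]
    calc τ * frob A ^ 2 = τ / σ ^ 2 * (σ ^ 2 * frob A ^ 2) := by field_simp
      _ ≤ τ / σ ^ 2 * s ^ 2 := by gcongr
      _ = τ / σ ^ 2 * s * s := by ring
  · calc √c * frob A * x = √c * x / σ * (σ * frob A) := by field_simp
      _ ≤ √c * x / σ * s := by
        refine mul_le_mul_of_nonneg_left hAs (by positivity)

end Estimation

/-! ### Conditioning on a σ-algebra -/

section Conditioning

variable {Ω : Type*} {m mΩ : MeasurableSpace Ω} [StandardBorelSpace Ω] {P : Measure Ω}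
  [IsProbabilityMeasure P]

/-- Conditionally independent real random variables are almost surely independent under the regular
conditional probability: independence only has to be checked on the countably many boxes with
rational vertices. -/
theorem ae_iIndepFun_condExpKernel {ι : Type*} [Fintype ι] (hm : m ≤ mΩ) {f : ι → Ω → ℝ}
    (hf : ∀ i, Measurable (f i)) (hind : iCondIndepFun m hm f P) :
    ∀ᵐ ω ∂P, iIndepFun f (condExpKernel P m ω) := by
  have hbox : ∀ a b : ι → ℚ, ∀ᵐ ω ∂P,
      condExpKernel P m ω (⋂ i, f i ⁻¹' Set.Ioo (a i : ℝ) (b i)) =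
        ∏ i, condExpKernel P m ω (f i ⁻¹' Set.Ioo (a i : ℝ) (b i)) := fun a b =>
    ae_of_ae_trim hm (Kernel.iIndepFun.meas_iInter hind fun i => ⟨_, measurableSet_Ioo, rfl⟩)
  have hall : ∀ᵐ ω ∂P, ∀ a b : ι → ℚ,
      condExpKernel P m ω (⋂ i, f i ⁻¹' Set.Ioo (a i : ℝ) (b i)) =
        ∏ i, condExpKernel P m ω (f i ⁻¹' Set.Ioo (a i : ℝ) (b i)) :=
    ae_all_iff.2 fun a => ae_all_iff.2 fun b => hbox a b
  filter_upwards [hall] with ω hω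
  rw [iIndepFun_iff_map_fun_eq_pi_map fun i => (hf i).aemeasurable]
  have hprob : ∀ i, IsProbabilityMeasure ((condExpKernel P m ω).map (f i)) := fun i =>
    Measure.isProbabilityMeasure_map (hf i).aemeasurable
  refine (Measure.pi_eq_generateFrom (fun _ => Real.borel_eq_generateFrom_Ioo_rat.symm)
    (fun _ => Real.isPiSystem_Ioo_rat) (fun _ => Real.finiteSpanningSetsInIooRat _) ?_).symm
  intro s hs
  simp only [Set.mem_iUnion, Set.mem_singleton_iff] at hs
  choose a b H using hs
  obtain rfl : s = fun i => Set.Ioo (a i : ℝ) (b i) := funext fun i => (H i).2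
  rw [Measure.map_apply (measurable_pi_lambda _ hf)
    (MeasurableSet.univ_pi fun i => measurableSet_Ioo)]
  have e : (fun ω i => f i ω) ⁻¹' Set.univ.pi (fun i => Set.Ioo (a i : ℝ) (b i)) =
      ⋂ i, f i ⁻¹' Set.Ioo (a i : ℝ) (b i) := by
    ext ω
    simp
  rw [e, hω a b]
  refine Finset.prod_congr rfl fun i _ => ?_
  rw [Measure.map_apply (hf i) measurableSet_Ioo]

/-- Disintegration: an event involving an `m`-measurable variable `X` and another variable `V` may
be computed by first drawing `V` from its conditional law with `X` held fixed. -/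
theorem measure_eq_lintegral_condExpKernel {β γ : Type*} [MeasurableSpace β] [MeasurableSpace γ]
    (hm : m ≤ mΩ) {X : Ω → β} (hX : Measurable[m] X) {V : Ω → γ} (hV : Measurable V)
    {s : Set (β × γ)} (hs : MeasurableSet s) :
    P {ω | (X ω, V ω) ∈ s} = ∫⁻ ω, condExpKernel P m ω {ω' | (X ω, V ω') ∈ s} ∂P := by
  have hXV : @Measurable (Ω × Ω) (β × γ) (m.prod mΩ) _ fun p => (X p.1, V p.2) :=
    (hX.comp (@measurable_fst _ _ m mΩ)).prodMk (hV.comp (@measurable_snd _ _ m mΩ))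
  have hS : @MeasurableSet (Ω × Ω) (m.prod mΩ) {p | (X p.1, V p.2) ∈ s} := hXV hs
  have hdiag : @Measurable Ω (Ω × Ω) mΩ (m.prod mΩ) Function.diag :=
    (measurable_id'' hm).prodMk measurable_id
  have h1 := congrArg (fun μ => μ {p : Ω × Ω | (X p.1, V p.2) ∈ s})
    (compProd_trim_condExpKernel (μ := P) hm)
  rw [@Measure.map_apply Ω (Ω × Ω) mΩ (m.prod mΩ) P _ hdiag _ hS,
    @Measure.compProd_apply Ω Ω m mΩ _ _ _ _ _ hS] at h1
  rw [lintegral_trim hm (Kernel.measurable_kernel_prodMk_left hS)] at h1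
  exact h1.symm

theorem integral_map_of_measurable {α E : Type*} {mα : MeasurableSpace α}
    {mE : MeasurableSpace E} {μ : Measure α} {g : α → E} (hg : Measurable g) {f : E → ℂ}
    (hf : Measurable f) : ∫ y, f y ∂(μ.map g) = ∫ x, f (g x) ∂μ :=
  integral_map hg.aemeasurable hf.aestronglyMeasurable

theorem integrable_of_measurable_of_bound {E : Type*} {mE : MeasurableSpace E} {μ : Measure E}
    [IsFiniteMeasure μ] {f : E → ℂ} (hf : Measurable f) {C : ℝ} (hC : ∀ x, ‖f x‖ ≤ C) :
    Integrable f μ :=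
  Integrable.of_bound hf.aestronglyMeasurable C (Eventually.of_forall hC)

theorem stronglyMeasurable_integral_condExpKernel {β γ : Type*} [MeasurableSpace β]
    [MeasurableSpace γ] {X : Ω → β} (hX : Measurable[m] X) {V : Ω → γ}
    (hV : Measurable V) {h : β × γ → ℂ} (hh : Measurable h) :
    StronglyMeasurable[m] fun ω => ∫ ω', h (X ω, V ω') ∂(condExpKernel P m ω) := by
  have hXV : @Measurable (Ω × Ω) (β × γ) (m.prod mΩ) _ fun p => (X p.1, V p.2) :=
    (hX.comp (@measurable_fst _ _ m mΩ)).prodMk (hV.comp (@measurable_snd _ _ m mΩ))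
  have hS : @Measurable (Ω × Ω) ℂ (m.prod mΩ) _ fun p => h (X p.1, V p.2) := hh.comp hXV
  exact StronglyMeasurable.integral_kernel_prod_right' (κ := condExpKernel P m)
    (Measurable.stronglyMeasurable hS)

/-- Disintegration for integrals of bounded functions. -/
theorem integral_eq_integral_condExpKernel {β γ : Type*} [MeasurableSpace β] [MeasurableSpace γ]
    (hm : m ≤ mΩ) {X : Ω → β} (hX : Measurable[m] X) {V : Ω → γ} (hV : Measurable V)
    {h : β × γ → ℂ} (hh : Measurable h) {C : ℝ} (hC : ∀ x, ‖h x‖ ≤ C) :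
    ∫ ω, h (X ω, V ω) ∂P = ∫ ω, ∫ ω', h (X ω, V ω') ∂(condExpKernel P m ω) ∂P := by
  have hXV : @Measurable (Ω × Ω) (β × γ) (m.prod mΩ) _ fun p => (X p.1, V p.2) :=
    (hX.comp (@measurable_fst _ _ m mΩ)).prodMk (hV.comp (@measurable_snd _ _ m mΩ))
  have hS : @Measurable (Ω × Ω) ℂ (m.prod mΩ) _ fun p => h (X p.1, V p.2) := hh.comp hXV
  have hdiag : @Measurable Ω (Ω × Ω) mΩ (m.prod mΩ) Function.diag :=
    (measurable_id'' hm).prodMk measurable_id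
  have h1 := congrArg (fun μ => ∫ p : Ω × Ω, h (X p.1, V p.2) ∂μ)
    (compProd_trim_condExpKernel (μ := P) hm)
  have hmap := integral_map_of_measurable (μ := P) hdiag hS
  have hint : Integrable (fun p : Ω × Ω => h (X p.1, V p.2))
      ((P.trim hm) ⊗ₘ condExpKernel P m) :=
    integrable_of_measurable_of_bound hS fun p => hC _
  have hmeas := stronglyMeasurable_integral_condExpKernel (P := P) hX hV hh
  rw [hmap, Measure.integral_compProd hint, ← integral_trim hm hmeas] at h1
  exact h1.symm

end Conditioning

/-! ### Weighted sums of independent errors -/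

section Noise

variable {Ω ι : Type*} [mΩ : MeasurableSpace Ω]

/-- Independent centred errors with variances `v` and fourth moments at most `M`. -/
structure IsNoise (ν : Measure Ω) (U : ι → Ω → ℝ) (v : ι → ℝ) (M : ℝ) : Prop where
  measurable : ∀ p, Measurable (U p)
  indep : iIndepFun U ν
  integrable : ∀ p, Integrable (fun ω => U p ω ^ 4) ν
  mean : ∀ p, ∫ ω, U p ω ∂ν = 0
  variance : ∀ p, ∫ ω, U p ω ^ 2 ∂ν = v p
  fourth : ∀ p, ∫ ω, U p ω ^ 4 ∂ν ≤ M

variable {ν : Measure Ω} {U : ι → Ω → ℝ} {v : ι → ℝ} {M : ℝ}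

theorem IsNoise.memLp_sq (h : IsNoise ν U v M) (p : ι) : MemLp (fun ω => U p ω ^ 2) 2 ν := by
  rw [memLp_two_iff_integrable_sq ((h.measurable p).pow_const 2).aestronglyMeasurable]
  refine (h.integrable p).congr (Eventually.of_forall fun ω => ?_)
  ring

theorem IsNoise.variance_nonneg (h : IsNoise ν U v M) (p : ι) : 0 ≤ v p := by
  rw [← h.variance]
  exact integral_nonneg fun ω => sq_nonneg _

variable [IsProbabilityMeasure ν]

theorem IsNoise.integrable_sq (h : IsNoise ν U v M) (p : ι) :
    Integrable (fun ω => U p ω ^ 2) ν := by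
  refine ((integrable_const (1 : ℝ)).add (h.integrable p)).mono'
    ((h.measurable p).pow_const 2).aestronglyMeasurable (Eventually.of_forall fun ω => ?_)
  rw [Real.norm_eq_abs, abs_of_nonneg (sq_nonneg _), Pi.add_apply]
  nlinarith [sq_nonneg (U p ω ^ 2 - 1)]

theorem IsNoise.memLp_two (h : IsNoise ν U v M) (p : ι) : MemLp (U p) 2 ν :=
  (memLp_two_iff_integrable_sq (h.measurable p).aestronglyMeasurable).2 (h.integrable_sq p)

theorem IsNoise.variance_sq_le (h : IsNoise ν U v M) (p : ι) : v p ^ 2 ≤ M := by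
  have h1 := ProbabilityTheory.variance_nonneg (fun ω => U p ω ^ 2) ν
  rw [variance_eq_sub (h.memLp_sq p)] at h1
  have h2 : ∫ ω, ((fun ω => U p ω ^ 2) ^ 2) ω ∂ν = ∫ ω, U p ω ^ 4 ∂ν := by
    congr 1
    ext ω
    simp only [Pi.pow_apply]
    ring
  rw [h2, h.variance] at h1
  have := h.fourth p
  linarith

theorem IsNoise.variance_le (h : IsNoise ν U v M) (p : ι) : v p ≤ 1 + M := by
  have := h.variance_sq_le p
  nlinarith [sq_nonneg (v p - 1)]

/-- Chebyshev's inequality for a sum of independent random variables, in a form that allows the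
bound to vanish. -/
theorem measure_lt_abs_sum_sub_le [Fintype ι] {X : ι → Ω → ℝ} (hX : ∀ p, MemLp (X p) 2 ν)
    (hind : iIndepFun X ν) {x V : ℝ} (hx : 0 ≤ x) {δ : ℝ}
    (hV : ∑ p, ∫ ω, X p ω ^ 2 ∂ν ≤ V) (hVx : V ≤ δ * x ^ 2) :
    ν {ω | x < |∑ p, (X p ω - ∫ ω', X p ω' ∂ν)|} ≤ ENNReal.ofReal δ := by
  have hsum : MemLp (∑ p, X p) 2 ν := memLp_finsetSum' _ fun p _ => hX p
  have hint : ∫ ω, (∑ p, X p) ω ∂ν = ∑ p, ∫ ω, X p ω ∂ν := by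
    simp only [Finset.sum_apply]
    exact integral_finsetSum _ fun p _ => (hX p).integrable (by norm_num)
  have hvar : Var[∑ p, X p; ν] ≤ V := by
    rw [IndepFun.variance_sum (fun p _ => hX p) fun i _ j _ hij => hind.indepFun hij]
    exact (Finset.sum_le_sum fun p _ => variance_le_expectation_sq (hX p).1).trans hV
  have heq : ∀ ω, ∑ p, (X p ω - ∫ ω', X p ω' ∂ν) =
      (∑ p, X p) ω - ∫ ω', (∑ p, X p) ω' ∂ν := by
    intro ω
    rw [hint, Finset.sum_apply, Finset.sum_sub_distrib]
  simp only [heq]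
  rcases hx.eq_or_lt with h | h
  · -- a vanishing bound on the variance makes the sum almost surely constant
    have hV0 : Var[∑ p, X p; ν] = 0 := by
      refine le_antisymm (hvar.trans (hVx.trans ?_)) (variance_nonneg _ _)
      rw [← h]; simp
    have hev : ∀ᵐ ω ∂ν, (∑ p, X p) ω = ∫ ω', (∑ p, X p) ω' ∂ν :=
      (evariance_eq_zero_iff hsum.1.aemeasurable).1
        (by rw [← hsum.ofReal_variance_eq, hV0, ENNReal.ofReal_zero])
    have : ν {ω | x < |(∑ p, X p) ω - ∫ ω', (∑ p, X p) ω' ∂ν|} = 0 := by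
      rw [← h]
      refine measure_mono_null (fun ω hω => ?_) hev
      intro hc
      simp only [Set.mem_ofPred_eq] at hω
      rw [hc, sub_self, abs_zero] at hω
      exact lt_irrefl _ hω
    rw [this]
    exact zero_le
  · refine (measure_mono fun ω hω => ?_).trans
      ((meas_ge_le_variance_div_sq hsum h).trans (ENNReal.ofReal_le_ofReal ?_))
    · simp only [Set.mem_ofPred_eq] at hω ⊢
      exact hω.le
    · rw [div_le_iff₀ (by positivity)]
      exact hvar.trans hVx

/-- A weighted sum of errors is of the order of the Euclidean norm of the weights. -/
theorem IsNoise.measure_abs_sum_le [Fintype ι] (h : IsNoise ν U v M) (a : ι → ℝ) {C : ℝ} (hC : 0 < C) :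
    ν {ω | C * √(∑ p, a p ^ 2) < |∑ p, a p * U p ω|} ≤ ENNReal.ofReal ((1 + M) / C ^ 2) := by
  rcases isEmpty_or_nonempty ι with hι | ⟨⟨p0⟩⟩
  · simp
  have hM : 0 ≤ 1 + M := (h.variance_nonneg p0).trans (h.variance_le p0)
  have hind : iIndepFun (fun p ω => a p * U p ω) ν :=
    h.indep.comp (fun p x => a p * x) fun p => measurable_const_mul _
  have h1 := measure_lt_abs_sum_sub_le (fun p => (h.memLp_two p).const_mul (a p)) hind
    (x := C * √(∑ p, a p ^ 2)) (V := (1 + M) * ∑ p, a p ^ 2) (δ := (1 + M) / C ^ 2)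
    (by positivity) ?_ ?_
  · simpa only [integral_const_mul, h.mean, mul_zero, sub_zero] using h1
  · rw [Finset.mul_sum]
    refine Finset.sum_le_sum fun p _ => ?_
    simp only [mul_pow, integral_const_mul, h.variance]
    rw [mul_comm]
    exact mul_le_mul_of_nonneg_right (h.variance_le p) (sq_nonneg _)
  · rw [mul_pow, Real.sq_sqrt (Finset.sum_nonneg fun _ _ => sq_nonneg _)]
    apply le_of_eq
    field_simp

/-- The law of large numbers for weighted squared errors: if no weight dominates, their weighted
sum is close to its mean. -/
theorem IsNoise.measure_abs_sum_sq_le [Fintype ι] (h : IsNoise ν U v M) {a : ι → ℝ} {c τ : ℝ} (hτ : 0 < τ)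
    (hM : 0 ≤ M) (ha : ∀ p, a p ^ 2 ≤ c * ∑ p, a p ^ 2) :
    ν {ω | τ * ∑ p, a p ^ 2 < |∑ p, a p ^ 2 * U p ω ^ 2 - ∑ p, a p ^ 2 * v p|} ≤
      ENNReal.ofReal (c * M / τ ^ 2) := by
  have hind : iIndepFun (fun p ω => a p ^ 2 * U p ω ^ 2) ν :=
    h.indep.comp (fun p x => a p ^ 2 * x ^ 2) fun p => by fun_prop
  have hs : 0 ≤ ∑ p, a p ^ 2 := Finset.sum_nonneg fun _ _ => sq_nonneg _
  have h1 := measure_lt_abs_sum_sub_le (fun p => (h.memLp_sq p).const_mul (a p ^ 2)) hind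
    (x := τ * ∑ p, a p ^ 2) (V := c * M * (∑ p, a p ^ 2) ^ 2) (δ := c * M / τ ^ 2)
    (by positivity) ?_ ?_
  · simpa only [integral_const_mul, h.variance, Finset.sum_sub_distrib] using h1
  · have h2 : ∀ p, ∫ ω, (a p ^ 2 * U p ω ^ 2) ^ 2 ∂ν ≤ c * M * (∑ p, a p ^ 2) * a p ^ 2 := by
      intro p
      have e : ∀ ω, (a p ^ 2 * U p ω ^ 2) ^ 2 = a p ^ 4 * U p ω ^ 4 := fun ω => by ring
      simp only [e, integral_const_mul]
      calc a p ^ 4 * ∫ ω, U p ω ^ 4 ∂ν ≤ a p ^ 4 * M :=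
            mul_le_mul_of_nonneg_left (h.fourth p) (by positivity)
        _ = M * (a p ^ 2 * a p ^ 2) := by ring
        _ ≤ M * (c * (∑ p, a p ^ 2) * a p ^ 2) := by gcongr; exact ha p
        _ = _ := by ring
    refine (Finset.sum_le_sum fun p _ => h2 p).trans (le_of_eq ?_)
    rw [← Finset.mul_sum]; ring
  · apply le_of_eq
    field_simp

/-! ### A central limit theorem with an explicit error for characteristic functions -/

theorem norm_prod_sub_prod_le {ι : Type*} (s : Finset ι) {z w : ι → ℂ} (hz : ∀ p, ‖z p‖ ≤ 1)
    (hw : ∀ p, ‖w p‖ ≤ 1) : ‖∏ p ∈ s, z p - ∏ p ∈ s, w p‖ ≤ ∑ p ∈ s, ‖z p - w p‖ := by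
  classical
  induction s using Finset.induction_on with
  | empty => simp
  | insert p s hp ih =>
    rw [Finset.prod_insert hp, Finset.prod_insert hp, Finset.sum_insert hp]
    have e : z p * ∏ q ∈ s, z q - w p * ∏ q ∈ s, w q =
        (z p - w p) * ∏ q ∈ s, z q + w p * (∏ q ∈ s, z q - ∏ q ∈ s, w q) := by ring
    rw [e]
    refine (norm_add_le _ _).trans (add_le_add ?_ ?_)
    · rw [norm_mul]
      refine mul_le_of_le_one_right (norm_nonneg _) ?_
      rw [norm_prod]
      exact Finset.prod_le_one (fun _ _ => norm_nonneg _) fun q _ => hz q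
    · rw [norm_mul]
      exact (mul_le_of_le_one_left (norm_nonneg _) (hw p)).trans ih

theorem norm_exp_I_mul_sub_taylor_le (x : ℝ) :
    ‖Complex.exp (x * Complex.I) - (1 + x * Complex.I - x ^ 2 / 2)‖ ≤ 4 * |x| ^ 3 := by
  have hnorm : ‖(x : ℂ) * Complex.I‖ = |x| := by simp
  rcases le_total |x| 1 with h | h
  · have h1 := Complex.exp_bound (x := x * Complex.I) (by rw [hnorm]; exact h) (n := 3)
      (by norm_num)
    have h2 : ∑ m ∈ Finset.range 3, ((x : ℂ) * Complex.I) ^ m / (m.factorial : ℂ) =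
        1 + x * Complex.I - x ^ 2 / 2 := by
      simp only [Finset.sum_range_succ, Finset.sum_range_zero, mul_pow, Complex.I_sq]
      norm_num [Nat.factorial]
      ring
    rw [h2, hnorm] at h1
    refine h1.trans ?_
    rw [mul_comm]
    refine mul_le_mul_of_nonneg_right ?_ (by positivity)
    norm_num [Nat.factorial]
  · have h1 : ‖Complex.exp (x * Complex.I)‖ = 1 := Complex.norm_exp_ofReal_mul_I x
    have h2 : ‖(1 : ℂ) + x * Complex.I - x ^ 2 / 2‖ ≤ 1 + |x| + |x| ^ 2 / 2 := by
      refine (norm_sub_le _ _).trans (add_le_add ((norm_add_le _ _).trans ?_) ?_)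
      · rw [hnorm, norm_one]
      · simp
    refine (norm_sub_le _ _).trans ?_
    rw [h1]
    have h3 : |x| ≤ |x| ^ 3 := le_self_pow₀ h (by norm_num)
    have h4 : |x| ^ 2 ≤ |x| ^ 3 := pow_le_pow_right₀ h (by norm_num)
    have h5 : 1 ≤ |x| ^ 3 := one_le_pow₀ h
    linarith

/-- The cubic remainder is split into a small multiple of the square, which the variances control,
and a multiple of the fourth power, which is negligible when no weight dominates. -/
theorem norm_exp_I_mul_sub_taylor_le' (x : ℝ) {k : ℝ} (hk : 0 < k) :
    ‖Complex.exp (x * Complex.I) - (1 + x * Complex.I - x ^ 2 / 2)‖ ≤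
      2 * k * x ^ 2 + 2 / k * x ^ 4 := by
  refine (norm_exp_I_mul_sub_taylor_le x).trans ?_
  have h1 : 2 * k * x ^ 2 + 2 / k * x ^ 4 - 4 * |x| ^ 3 = 2 / k * (k * |x| - |x| ^ 2) ^ 2 := by
    have e2 : x ^ 2 = |x| ^ 2 := (sq_abs x).symm
    have e4 : x ^ 4 = |x| ^ 4 := by
      rw [show x ^ 4 = (x ^ 2) ^ 2 by ring, e2]; ring
    rw [e2, e4]
    field_simp
    ring
  have h2 : 0 ≤ 2 / k * (k * |x| - |x| ^ 2) ^ 2 := by positivity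
  linarith

theorem abs_exp_neg_sub_le {s : ℝ} (hs : 0 ≤ s) : |Real.exp (-s) - (1 - s)| ≤ s ^ 2 := by
  have h1 := Real.one_sub_le_exp_neg s
  rw [abs_of_nonneg (by linarith)]
  have h2 := Real.quadratic_le_exp_of_nonneg hs
  have h3 : Real.exp (-s) * Real.exp s = 1 := by rw [← Real.exp_add]; simp
  have h4 : 0 < Real.exp (-s) := Real.exp_pos _
  have h5 : Real.exp (-s) * (1 + s + s ^ 2 / 2) ≤ 1 := by
    calc _ ≤ Real.exp (-s) * Real.exp s := by gcongr
      _ = 1 := h3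
  have h6 : 0 ≤ s ^ 4 := by positivity
  have h7 : 0 < 1 + s + s ^ 2 / 2 := by positivity
  by_contra hcon
  push Not at hcon
  have h8 : (1 - s + s ^ 2) * (1 + s + s ^ 2 / 2) < Real.exp (-s) * (1 + s + s ^ 2 / 2) := by
    gcongr
    linarith
  have h9 : 0 ≤ s ^ 3 := by positivity
  have h10 : 0 ≤ s ^ 2 := by positivity
  nlinarith

/-- The characteristic function of a single error is close to that of a normal distribution with the
same variance. -/
theorem IsNoise.norm_integral_exp_sub_le (h : IsNoise ν U v M) (p : ι) (y : ℝ) {k : ℝ}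
    (hk : 0 < k) :
    ‖∫ ω, Complex.exp ((y * U p ω : ℝ) * Complex.I) ∂ν - Real.exp (-(y ^ 2 * v p / 2))‖ ≤
      2 * k * (y ^ 2 * v p) + (2 / k + 1 / 4) * (y ^ 4 * M) := by
  have hU1 : Integrable (U p) ν := (h.memLp_two p).integrable (by norm_num)
  have hint1 : Integrable (fun ω => Complex.exp ((y * U p ω : ℝ) * Complex.I)) ν := by
    refine Integrable.of_bound ?_ 1 (Eventually.of_forall fun ω => ?_)
    · have := h.measurable p
      exact Measurable.aestronglyMeasurable (by fun_prop)
    · rw [Complex.norm_exp_ofReal_mul_I]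
  have i1 : Integrable (fun ω => ((y * U p ω : ℝ) : ℂ) * Complex.I) ν :=
    ((hU1.const_mul y).ofReal).mul_const _
  have i2 : Integrable (fun ω => ((y * U p ω : ℝ) : ℂ) ^ 2 / 2) ν := by
    have := (((h.integrable_sq p).const_mul (y ^ 2)).ofReal (𝕜 := ℂ)).div_const 2
    refine this.congr (Eventually.of_forall fun ω => ?_)
    simp [mul_pow]
  have i3 : Integrable (fun ω => (1 : ℂ) + ((y * U p ω : ℝ) : ℂ) * Complex.I) ν :=
    (integrable_const _).add i1
  have hintT' : Integrable
      (fun ω => (1 : ℂ) + (y * U p ω : ℝ) * Complex.I - (y * U p ω : ℝ) ^ 2 / 2) ν := i3.sub i2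
  have hintT : ∫ ω, ((1 : ℂ) + (y * U p ω : ℝ) * Complex.I - (y * U p ω : ℝ) ^ 2 / 2) ∂ν =
      ((1 - y ^ 2 * v p / 2 : ℝ) : ℂ) := by
    rw [integral_sub i3 i2, integral_add (integrable_const _) i1]
    have e1 : ∫ ω, ((y * U p ω : ℝ) : ℂ) * Complex.I ∂ν = 0 := by
      rw [integral_mul_const, integral_complex_ofReal, integral_const_mul, h.mean]
      simp
    have e2 : ∫ ω, ((y * U p ω : ℝ) : ℂ) ^ 2 / 2 ∂ν = ((y ^ 2 * v p / 2 : ℝ) : ℂ) := by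
      have : ∀ ω, ((y * U p ω : ℝ) : ℂ) ^ 2 / 2 = ((y ^ 2 * U p ω ^ 2 / 2 : ℝ) : ℂ) := by
        intro ω; push_cast; ring
      simp only [this]
      rw [integral_complex_ofReal, integral_div, integral_const_mul, h.variance]
    rw [e1, e2]
    simp
  have hv := h.variance_nonneg p
  have hM := h.variance_sq_le p
  have hfirst : ‖∫ ω, Complex.exp ((y * U p ω : ℝ) * Complex.I) ∂ν -
      ((1 - y ^ 2 * v p / 2 : ℝ) : ℂ)‖ ≤ 2 * k * (y ^ 2 * v p) + 2 / k * (y ^ 4 * M) := by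
    rw [← hintT, ← integral_sub hint1 hintT']
    refine (norm_integral_le_integral_norm _).trans ?_
    have hbound : Integrable
        (fun ω => 2 * k * y ^ 2 * U p ω ^ 2 + 2 / k * y ^ 4 * U p ω ^ 4) ν :=
      ((h.integrable_sq p).const_mul _).add ((h.integrable p).const_mul _)
    refine (integral_mono (hint1.sub hintT').norm hbound fun ω => ?_).trans ?_
    · refine (norm_exp_I_mul_sub_taylor_le' (y * U p ω) hk).trans (le_of_eq ?_)
      ring
    · rw [integral_add ((h.integrable_sq p).const_mul _) ((h.integrable p).const_mul _),
        integral_const_mul, integral_const_mul, h.variance]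
      have h1 : 2 / k * y ^ 4 * ∫ ω, U p ω ^ 4 ∂ν ≤ 2 / k * y ^ 4 * M :=
        mul_le_mul_of_nonneg_left (h.fourth p) (by positivity)
      linarith
  have hsecond : ‖((1 - y ^ 2 * v p / 2 : ℝ) : ℂ) - Real.exp (-(y ^ 2 * v p / 2))‖ ≤
      1 / 4 * (y ^ 4 * M) := by
    rw [← Complex.ofReal_sub, Complex.norm_real, Real.norm_eq_abs, abs_sub_comm]
    refine (abs_exp_neg_sub_le (by positivity)).trans ?_
    have : (y ^ 2 * v p / 2) ^ 2 = 1 / 4 * (y ^ 4 * v p ^ 2) := by ring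
    rw [this]
    gcongr
  refine (norm_sub_le_norm_sub_add_norm_sub _ ((1 - y ^ 2 * v p / 2 : ℝ) : ℂ) _).trans ?_
  linarith

/-- The characteristic function of a normalized weighted sum of independent errors is close to that
of the standard normal distribution if the Lyapunov ratio `δ` is small. -/
theorem IsNoise.norm_charFun_sub_le [Fintype ι] (h : IsNoise ν U v M) {a : ι → ℝ} {δ : ℝ}
    (ha : ∑ p, a p ^ 2 * v p = 1) (hδ : ∑ p, a p ^ 4 * M ≤ δ) (t : ℝ) {k : ℝ} (hk : 0 < k) :
    ‖∫ ω, Complex.exp ((t * ∑ p, a p * U p ω : ℝ) * Complex.I) ∂ν - Real.exp (-(t ^ 2 / 2))‖ ≤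
      2 * k * t ^ 2 + (2 / k + 1 / 4) * (t ^ 4 * δ) := by
  have hprod : ∫ ω, Complex.exp ((t * ∑ p, a p * U p ω : ℝ) * Complex.I) ∂ν =
      ∏ p, ∫ ω, Complex.exp (((t * a p) * U p ω : ℝ) * Complex.I) ∂ν := by
    have hind : iIndepFun (fun p ω => Complex.exp (((t * a p) * U p ω : ℝ) * Complex.I)) ν :=
      h.indep.comp (fun p x => Complex.exp (((t * a p) * x : ℝ) * Complex.I)) fun p => by fun_prop
    rw [← hind.integral_fun_prod_eq_prod_integral]
    · congr 1
      ext ω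
      rw [← Complex.exp_sum, ← Finset.sum_mul, ← Complex.ofReal_sum]
      congr 3
      rw [Finset.mul_sum]
      exact Finset.sum_congr rfl fun p _ => by ring
    · intro p
      have := h.measurable p
      exact Measurable.aestronglyMeasurable (by fun_prop)
  have hexp : ((Real.exp (-(t ^ 2 / 2)) : ℝ) : ℂ) =
      ∏ p, ((Real.exp (-((t * a p) ^ 2 * v p / 2)) : ℝ) : ℂ) := by
    rw [← Complex.ofReal_prod, ← Real.exp_sum]
    congr 2
    rw [Finset.sum_neg_distrib, ← Finset.sum_div]
    congr 2
    calc t ^ 2 = t ^ 2 * ∑ p, a p ^ 2 * v p := by rw [ha, mul_one]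
      _ = _ := by
        rw [Finset.mul_sum]
        exact Finset.sum_congr rfl fun p _ => by ring
  rw [hprod, hexp]
  refine (norm_prod_sub_prod_le _ (fun p => ?_) (fun p => ?_)).trans ?_
  · refine (norm_integral_le_integral_norm _).trans (le_of_eq ?_)
    simp only [Complex.norm_exp_ofReal_mul_I]
    simp
  · rw [Complex.norm_real, Real.norm_eq_abs, abs_of_pos (Real.exp_pos _)]
    refine Real.exp_le_one_iff.2 ?_
    have := h.variance_nonneg p
    have : 0 ≤ (t * a p) ^ 2 * v p / 2 := by positivity
    linarith
  · refine (Finset.sum_le_sum fun p _ => h.norm_integral_exp_sub_le p (t * a p) hk).trans ?_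
    rw [Finset.sum_add_distrib, ← Finset.mul_sum, ← Finset.mul_sum]
    have e1 : ∑ p, (t * a p) ^ 2 * v p = t ^ 2 := by
      calc _ = t ^ 2 * ∑ p, a p ^ 2 * v p := by
            rw [Finset.mul_sum]
            exact Finset.sum_congr rfl fun p _ => by ring
        _ = t ^ 2 := by rw [ha, mul_one]
    have e2 : ∑ p, (t * a p) ^ 4 * M = t ^ 4 * ∑ p, a p ^ 4 * M := by
      rw [Finset.mul_sum]
      exact Finset.sum_congr rfl fun p _ => by ring
    rw [e1, e2]
    gcongr

end Noise

/-! ### Conditionally independent errors -/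

section ConditionalNoise

variable {Ω ι : Type*} {m mΩ : MeasurableSpace Ω}
  {P : Measure Ω} [IsProbabilityMeasure P] {U : ι → Ω → ℝ} {M : ℝ}

theorem lintegral_le_of_ae_le_const {f : Ω → ℝ≥0∞} {b : ℝ≥0∞} (h : ∀ᵐ ω ∂P, f ω ≤ b) :
    ∫⁻ ω, f ω ∂P ≤ b :=
  (lintegral_mono_ae h).trans (by simp)

variable [StandardBorelSpace Ω] [Fintype ι]

/-- Conditionally independent centred errors with bounded conditional fourth moments are almost
surely independent centred errors under the regular conditional probability. -/
theorem ae_isNoise (hm : m ≤ mΩ) (hU : ∀ p, Measurable (U p)) (hind : iCondIndepFun m hm U P)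
    (hint : ∀ p, Integrable (fun ω => U p ω ^ 4) P) (hmean : ∀ p, P[U p | m] =ᵐ[P] 0)
    (hfourth : ∀ p, ∀ᵐ ω ∂P, (P[fun ω => U p ω ^ 4 | m]) ω ≤ M) :
    ∀ᵐ ω ∂P, IsNoise (condExpKernel P m ω) U (fun p => (P[fun ω => U p ω ^ 2 | m]) ω) M := by
  have hint2 : ∀ p, Integrable (fun ω => U p ω ^ 2) P := by
    intro p
    refine ((integrable_const (1 : ℝ)).add (hint p)).mono'
      ((hU p).pow_const 2).aestronglyMeasurable (Eventually.of_forall fun ω => ?_)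
    rw [Real.norm_eq_abs, abs_of_nonneg (sq_nonneg _), Pi.add_apply]
    nlinarith [sq_nonneg (U p ω ^ 2 - 1)]
  have hint1 : ∀ p, Integrable (U p) P := fun p =>
    ((memLp_two_iff_integrable_sq (hU p).aestronglyMeasurable).2 (hint2 p)).integrable
      (by norm_num)
  have h1 : ∀ᵐ ω ∂P, ∀ p, (P[U p | m]) ω = ∫ y, U p y ∂condExpKernel P m ω :=
    ae_all_iff.2 fun p => condExp_ae_eq_integral_condExpKernel hm (hint1 p)
  have h2 : ∀ᵐ ω ∂P, ∀ p, (P[fun ω => U p ω ^ 2 | m]) ω =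
      ∫ y, U p y ^ 2 ∂condExpKernel P m ω :=
    ae_all_iff.2 fun p => condExp_ae_eq_integral_condExpKernel hm (hint2 p)
  have h4 : ∀ᵐ ω ∂P, ∀ p, (P[fun ω => U p ω ^ 4 | m]) ω =
      ∫ y, U p y ^ 4 ∂condExpKernel P m ω :=
    ae_all_iff.2 fun p => condExp_ae_eq_integral_condExpKernel hm (hint p)
  have h5 : ∀ᵐ ω ∂P, ∀ p, Integrable (fun y => U p y ^ 4) (condExpKernel P m ω) :=
    ae_all_iff.2 fun p => (hint p).condExpKernel_ae
  filter_upwards [ae_iIndepFun_condExpKernel hm hU hind, h1, h2, h4, h5, ae_all_iff.2 hmean,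
    ae_all_iff.2 hfourth] with ω g0 g1 g2 g4 g5 gm gf
  refine ⟨hU, g0, g5, fun p => ?_, fun p => ?_, fun p => ?_⟩
  · rw [← g1 p, gm p]; rfl
  · rw [← g2 p]
  · rw [← g4 p]; exact gf p

variable {v : Ω → ι → ℝ} {A : Ω → ι → ℝ}

/-- Noise terms with weights that are known conditionally are of the order of the Euclidean norm of
the weights. -/
theorem measure_abs_sum_le_of_ae_isNoise (hm : m ≤ mΩ) (hU : ∀ p, Measurable (U p))
    (h : ∀ᵐ ω ∂P, IsNoise (condExpKernel P m ω) U (v ω) M) (hA : Measurable[m] A)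
    {C : ℝ} (hC : 0 < C) :
    P {ω | C * √(∑ p, A ω p ^ 2) < |∑ p, A ω p * U p ω|} ≤ ENNReal.ofReal ((1 + M) / C ^ 2) := by
  have hs : MeasurableSet {x : (ι → ℝ) × (ι → ℝ) |
      C * √(∑ p, x.1 p ^ 2) < |∑ p, x.1 p * x.2 p|} :=
    measurableSet_lt (by fun_prop) (by fun_prop)
  have hV : Measurable fun ω p => U p ω := measurable_pi_lambda _ hU
  have h1 := measure_eq_lintegral_condExpKernel (P := P) hm hA hV hs
  simp only [Set.mem_ofPred_eq] at h1
  rw [h1]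
  refine lintegral_le_of_ae_le_const ?_
  filter_upwards [h] with ω hω
  exact hω.measure_abs_sum_le (A ω) hC

theorem measure_abs_sum_sq_le_of_ae_isNoise (hm : m ≤ mΩ) (hU : ∀ p, Measurable (U p))
    (h : ∀ᵐ ω ∂P, IsNoise (condExpKernel P m ω) U (v ω) M) (hv : Measurable[m] v)
    (hA : Measurable[m] A) {c τ : ℝ} (hτ : 0 < τ) (hM : 0 ≤ M) :
    P {ω | (∀ p, A ω p ^ 2 ≤ c * ∑ p, A ω p ^ 2) ∧ τ * ∑ p, A ω p ^ 2 <
        |∑ p, A ω p ^ 2 * U p ω ^ 2 - ∑ p, A ω p ^ 2 * v ω p|} ≤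
      ENNReal.ofReal (c * M / τ ^ 2) := by
  have hs : MeasurableSet {x : ((ι → ℝ) × (ι → ℝ)) × (ι → ℝ) |
      (∀ p, x.1.1 p ^ 2 ≤ c * ∑ p, x.1.1 p ^ 2) ∧ τ * ∑ p, x.1.1 p ^ 2 <
        |∑ p, x.1.1 p ^ 2 * x.2 p ^ 2 - ∑ p, x.1.1 p ^ 2 * x.1.2 p|} := by
    have h2 : MeasurableSet {x : ((ι → ℝ) × (ι → ℝ)) × (ι → ℝ) | τ * ∑ p, x.1.1 p ^ 2 <
        |∑ p, x.1.1 p ^ 2 * x.2 p ^ 2 - ∑ p, x.1.1 p ^ 2 * x.1.2 p|} :=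
      measurableSet_lt (by fun_prop) (by fun_prop)
    refine MeasurableSet.inter ?_ h2
    have : ∀ p, MeasurableSet {x : ((ι → ℝ) × (ι → ℝ)) × (ι → ℝ) |
        x.1.1 p ^ 2 ≤ c * ∑ p, x.1.1 p ^ 2} := fun p =>
      measurableSet_le (by fun_prop) (by fun_prop)
    have h3 := MeasurableSet.iInter this
    rw [← Set.ofPred_forall] at h3
    exact h3
  have hV : Measurable fun ω p => U p ω := measurable_pi_lambda _ hU
  have h1 := measure_eq_lintegral_condExpKernel (P := P) hm (hA.prodMk hv) hV hs
  simp only [Set.mem_ofPred_eq] at h1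
  rw [h1]
  refine lintegral_le_of_ae_le_const ?_
  filter_upwards [h] with ω hω
  by_cases hL : ∀ p, A ω p ^ 2 ≤ c * ∑ p, A ω p ^ 2
  · exact (measure_mono fun _ hx => hx.2).trans (hω.measure_abs_sum_sq_le hτ hM hL)
  · refine (measure_mono_null (fun _ hx => hL hx.1) (measure_empty)).trans_le zero_le

/-- The characteristic function of a conditionally normalized noise term is close to that of the
standard normal distribution if with high probability no weight dominates. -/
theorem norm_charFun_sub_le_of_ae_isNoise (hm : m ≤ mΩ) (hU : ∀ p, Measurable (U p))
    (h : ∀ᵐ ω ∂P, IsNoise (condExpKernel P m ω) U (v ω) M) (hv : Measurable[m] v)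
    (hA : Measurable[m] A) {c σ : ℝ} (hc : 0 ≤ c) (hM : 0 ≤ M) (hσ : 0 < σ)
    (hvσ : ∀ᵐ ω ∂P, ∀ p, σ ^ 2 ≤ v ω p) (t : ℝ) {k : ℝ} (hk : 0 < k) :
    ‖charFun (P.map fun ω => (∑ p, A ω p * U p ω) / √(∑ p, A ω p ^ 2 * v ω p)) t -
        Real.exp (-(t ^ 2 / 2))‖ ≤
      2 * k * t ^ 2 + (2 / k + 1 / 4) * (t ^ 4 * (c * M / σ ^ 4)) +
        2 * P.real {ω | (∀ p, A ω p ^ 2 ≤ c * ∑ p, A ω p ^ 2) ∧ 0 < ∑ p, A ω p ^ 2}ᶜ := by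
  have hA' : Measurable A := hA.mono hm le_rfl
  have hv' : Measurable v := hv.mono hm le_rfl
  have hV : Measurable fun ω p => U p ω := measurable_pi_lambda _ hU
  have hX : Measurable fun ω => (∑ p, A ω p * U p ω) / √(∑ p, A ω p ^ 2 * v ω p) := by
    fun_prop
  set G := {ω | (∀ p, A ω p ^ 2 ≤ c * ∑ p, A ω p ^ 2) ∧ 0 < ∑ p, A ω p ^ 2} with hG
  have hGm : MeasurableSet G := by
    have h2 : MeasurableSet {ω | 0 < ∑ p, A ω p ^ 2} :=
      measurableSet_lt (by fun_prop) (by fun_prop)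
    refine MeasurableSet.inter ?_ h2
    have : ∀ p, MeasurableSet {ω | A ω p ^ 2 ≤ c * ∑ p, A ω p ^ 2} := fun p =>
      measurableSet_le (by fun_prop) (by fun_prop)
    have h3 := MeasurableSet.iInter this
    rw [← Set.ofPred_forall] at h3
    exact h3
  let f : ((ι → ℝ) × (ι → ℝ)) × (ι → ℝ) → ℂ := fun x =>
    Complex.exp ((t * ((∑ p, x.1.1 p * x.2 p) / √(∑ p, x.1.1 p ^ 2 * x.1.2 p)) : ℝ) * Complex.I)
  have hf : Measurable f := by fun_prop
  have hf1 : ∀ x, ‖f x‖ ≤ 1 := fun x => (Complex.norm_exp_ofReal_mul_I _).le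
  have h1 : charFun (P.map fun ω => (∑ p, A ω p * U p ω) / √(∑ p, A ω p ^ 2 * v ω p)) t =
      ∫ ω, f ((A ω, v ω), fun p => U p ω) ∂P := by
    rw [charFun_apply_real, integral_map hX.aemeasurable
      (Measurable.aestronglyMeasurable (by fun_prop))]
    simp [f]
  rw [h1, integral_eq_integral_condExpKernel (P := P) hm (hA.prodMk hv) hV hf hf1]
  set g : Ω → ℂ := fun ω => ∫ ω', f ((A ω, v ω), fun p => U p ω') ∂condExpKernel P m ω with hg
  set e : ℂ := ((Real.exp (-(t ^ 2 / 2)) : ℝ) : ℂ) with he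
  have he1 : ‖e‖ ≤ 1 := by
    rw [he, Complex.norm_real, Real.norm_eq_abs, abs_of_pos (Real.exp_pos _)]
    refine Real.exp_le_one_iff.2 ?_
    have : 0 ≤ t ^ 2 / 2 := by positivity
    linarith
  have hg1 : ∀ ω, ‖g ω‖ ≤ 1 := by
    intro ω
    refine (norm_integral_le_of_norm_le_const (Eventually.of_forall fun ω' => hf1 _)).trans ?_
    simp
  set B := 2 * k * t ^ 2 + (2 / k + 1 / 4) * (t ^ 4 * (c * M / σ ^ 4)) with hB
  have hB0 : 0 ≤ B := by positivity
  have hgB : ∀ᵐ ω ∂P, ω ∈ G → ‖g ω - e‖ ≤ B := by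
    filter_upwards [h, hvσ] with ω hω hωσ hωG
    set S := ∑ p, A ω p ^ 2 with hS
    have hS0 : 0 < S := hωG.2
    set s := √(∑ p, A ω p ^ 2 * v ω p) with hs
    have hSs : σ ^ 2 * S ≤ ∑ p, A ω p ^ 2 * v ω p := by
      rw [hS, Finset.mul_sum]
      refine Finset.sum_le_sum fun p _ => ?_
      rw [mul_comm]
      exact mul_le_mul_of_nonneg_left (hωσ p) (sq_nonneg _)
    have hs0 : 0 < ∑ p, A ω p ^ 2 * v ω p := lt_of_lt_of_le (by positivity) hSs
    have hspos : 0 < s := Real.sqrt_pos.2 hs0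
    have hs2 : s ^ 2 = ∑ p, A ω p ^ 2 * v ω p := Real.sq_sqrt hs0.le
    have key := hω.norm_charFun_sub_le (a := fun p => A ω p / s) (δ := c * M / σ ^ 4) ?_ ?_ t hk
    · convert key using 3
      rw [hg]
      simp only [f]
      congr 1
      ext ω'
      congr 3
      rw [Finset.sum_div]
      congr 1
      exact Finset.sum_congr rfl fun p _ => by ring
    · simp only [div_pow, hs2]
      rw [← div_self hs0.ne', Finset.sum_div]
      exact Finset.sum_congr rfl fun p _ => by ring
    · have e1 : ∀ p, (A ω p / s) ^ 4 * M ≤ c * S * M / s ^ 4 * A ω p ^ 2 := by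
        intro p
        have : A ω p ^ 2 * A ω p ^ 2 * M ≤ c * S * A ω p ^ 2 * M := by
          gcongr
          exact hωG.1 p
        rw [div_pow, div_mul_eq_mul_div, div_mul_eq_mul_div]
        refine div_le_div_of_nonneg_right ?_ (by positivity)
        calc A ω p ^ 4 * M = A ω p ^ 2 * A ω p ^ 2 * M := by ring
          _ ≤ c * S * A ω p ^ 2 * M := this
          _ = c * S * M * A ω p ^ 2 := by ring
      refine (Finset.sum_le_sum fun p _ => e1 p).trans ?_
      rw [← Finset.mul_sum, ← hS, div_mul_eq_mul_div, div_le_div_iff₀ (by positivity)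
        (by positivity)]
      have e2 : (σ ^ 2 * S) ^ 2 ≤ (s ^ 2) ^ 2 := by
        rw [hs2]
        gcongr
      calc c * S * M * S * σ ^ 4 = c * M * (σ ^ 2 * S) ^ 2 := by ring
        _ ≤ c * M * (s ^ 2) ^ 2 := by gcongr
        _ = c * M * s ^ 4 := by ring
  have hle : ∀ᵐ ω ∂P, ‖g ω - e‖ ≤ B + Gᶜ.indicator (fun _ => 2) ω := by
    filter_upwards [hgB] with ω hω
    by_cases hωG : ω ∈ G
    · rw [Set.indicator_of_notMem (by simpa using hωG), add_zero]
      exact hω hωG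
    · rw [Set.indicator_of_mem hωG]
      have := norm_sub_le (g ω) e
      have := hg1 ω
      linarith
  have hgmeas : AEStronglyMeasurable g P :=
    (stronglyMeasurable_integral_condExpKernel (hA.prodMk hv) hV hf).mono hm
      |>.aestronglyMeasurable
  have hgint : Integrable g P := Integrable.of_bound hgmeas 1 (Eventually.of_forall hg1)
  have heq : ∫ ω, g ω ∂P - e = ∫ ω, (g ω - e) ∂P := by
    rw [integral_sub hgint (integrable_const _)]
    simp
  rw [heq]
  have hbint : Integrable (fun ω => B + Gᶜ.indicator (fun _ => (2 : ℝ)) ω) P :=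
    (integrable_const _).add ((integrable_const _).indicator hGm.compl)
  refine (norm_integral_le_of_norm_le hbint hle).trans (le_of_eq ?_)
  rw [integral_add (integrable_const _) ((integrable_const _).indicator hGm.compl),
    integral_indicator hGm.compl]
  simp [mul_comm]

end ConditionalNoise

/-! ### Uniform convergence in distribution -/

section UniformLevy

theorem continuous_cdf_gaussianReal : Continuous (cdf (gaussianReal 0 1)) := by
  rw [continuous_iff_continuousAt]
  intro x
  have hmono := (cdf (gaussianReal 0 1)).mono
  have h1 : (cdf (gaussianReal 0 1)).measure {x} = 0 := by
    rw [measure_cdf]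
    have := nullSingletonClass_gaussianReal (μ := 0) one_ne_zero
    exact measure_singleton x
  rw [StieltjesFunction.measure_singleton, ENNReal.ofReal_eq_zero, sub_nonpos] at h1
  rw [hmono.continuousAt_iff_leftLim_eq_rightLim, StieltjesFunction.rightLim_eq]
  exact le_antisymm (hmono.leftLim_le le_rfl) h1

/-- Lévy's continuity theorem, uniformly over families of probability measures: if the conclusion
failed, it would fail along a sequence of measures to which the classical theorem applies. -/
theorem eventually_abs_cdf_sub_le {ι : ℕ → Type*} (S : ∀ n, Set (ι n))
    (μ : ∀ n, ι n → ProbabilityMeasure ℝ)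
    (h : ∀ t : ℝ, ∀ δ : ℝ, 0 < δ → ∀ᶠ n in atTop, ∀ i ∈ S n,
      ‖charFun (μ n i : Measure ℝ) t - Real.exp (-(t ^ 2 / 2))‖ ≤ δ)
    (x : ℝ) {δ : ℝ} (hδ : 0 < δ) :
    ∀ᶠ n in atTop, ∀ i ∈ S n,
      |(μ n i : Measure ℝ).real (Set.Iic x) - cdf (gaussianReal 0 1) x| ≤ δ := by
  by_contra hcon
  rw [not_eventually] at hcon
  obtain ⟨φ, hφ, hφ'⟩ := extraction_of_frequently_atTop hcon
  push Not at hφ'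
  choose i hi hgt using hφ'
  let γ : ProbabilityMeasure ℝ := ⟨gaussianReal 0 1, inferInstance⟩
  have hlim : Tendsto (fun k => μ (φ k) (i k)) atTop (𝓝 γ) := by
    refine ProbabilityMeasure.tendsto_iff_tendsto_charFun.2 fun t => ?_
    have hγ : charFun (γ : Measure ℝ) t = Real.exp (-(t ^ 2 / 2)) := by
      change charFun (gaussianReal 0 1) t = _
      rw [charFun_gaussianReal]
      push_cast
      congr 1
      simp
    rw [hγ, tendsto_iff_norm_sub_tendsto_zero]
    rw [Metric.tendsto_atTop]
    intro ε hε
    obtain ⟨n0, hn0⟩ := eventually_atTop.1 (h t (ε / 2) (by positivity))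
    refine ⟨n0, fun k hk => ?_⟩
    have := hn0 (φ k) (hk.trans (hφ.id_le k)) (i k) (hi k)
    rw [Real.dist_eq, sub_zero, abs_of_nonneg (norm_nonneg _)]
    linarith
  have hfr : (γ : Measure ℝ) (frontier (Set.Iic x)) = 0 := by
    rw [frontier_Iic]
    change gaussianReal 0 1 {x} = 0
    have := nullSingletonClass_gaussianReal (μ := 0) one_ne_zero
    exact measure_singleton x
  have h2 := ProbabilityMeasure.tendsto_measure_of_null_frontier_of_tendsto' hlim hfr
  have h3 := (ENNReal.tendsto_toReal (measure_ne_top _ _)).comp h2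
  have h4 : Tendsto (fun k => |(μ (φ k) (i k) : Measure ℝ).real (Set.Iic x) -
      cdf (gaussianReal 0 1) x|) atTop (𝓝 0) := by
    have h5 : Tendsto (fun k => (μ (φ k) (i k) : Measure ℝ).real (Set.Iic x)) atTop
        (𝓝 (cdf (gaussianReal 0 1) x)) := by
      rw [cdf_eq_real]
      exact h3
    have := (h5.sub_const (cdf (gaussianReal 0 1) x)).abs
    simpa using this
  obtain ⟨k, hk⟩ := (h4.eventually (gt_mem_nhds hδ)).exists
  exact absurd hk (not_lt.2 (hgt k).le)

end UniformLevy

/-! ### Uniformly likely events -/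

section Likely

variable {Ω : ℕ → Type*} [∀ n, MeasurableSpace (Ω n)] {K : ℕ}

/-- The events `E C τ n P θ` hold with a probability that is uniformly close to one for large `n`,
provided that the constant `C` is large enough: `C` bounds the quantities that are uniformly
stochastically bounded, and `τ > 0` is an arbitrary tolerance for those that are uniformly
negligible. -/
def Likely (Pr : ∀ n, Set (ProbabilityMeasure (Ω n))) (Θ : ℕ → Set (Coef K))
    (E : ℝ → ℝ → ∀ n, ProbabilityMeasure (Ω n) → Coef K → Ω n → Prop) : Prop :=
  ∀ δ : ℝ≥0∞, 0 < δ → ∃ C₀ : ℝ, ∀ C, C₀ ≤ C → ∀ τ : ℝ, 0 < τ → ∀ᶠ n in atTop,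
    ∀ P ∈ Pr n, ∀ θ ∈ Θ n, (P : Measure (Ω n)) {ω | ¬ E C τ n P θ ω} ≤ δ

variable {Pr : ∀ n, Set (ProbabilityMeasure (Ω n))} {Θ : ℕ → Set (Coef K)}
  {E E' : ℝ → ℝ → ∀ n, ProbabilityMeasure (Ω n) → Coef K → Ω n → Prop}

theorem Likely.mono (h : Likely Pr Θ E)
    (hE : ∀ C τ : ℝ, 1 ≤ C → 0 < τ → ∀ᶠ n in atTop, ∀ P ∈ Pr n, ∀ θ ∈ Θ n,
      ∀ᵐ ω ∂(P : Measure (Ω n)), E C τ n P θ ω → E' C τ n P θ ω) : Likely Pr Θ E' := by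
  intro δ hδ
  obtain ⟨C₀, hC₀⟩ := h δ hδ
  refine ⟨max C₀ 1, fun C hC τ hτ => ?_⟩
  filter_upwards [hC₀ C ((le_max_left _ _).trans hC) τ hτ,
    hE C τ ((le_max_right _ _).trans hC) hτ] with n h1 h2 P hP θ hθ
  refine (measure_mono_ae ?_).trans (h1 P hP θ hθ)
  filter_upwards [h2 P hP θ hθ] with ω hω hn
  exact fun hc => hn (hω hc)

theorem Likely.forall {ι : Type*} [Finite ι]
    {E : ι → ℝ → ℝ → ∀ n, ProbabilityMeasure (Ω n) → Coef K → Ω n → Prop}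
    (h : ∀ i, Likely Pr Θ (E i)) : Likely Pr Θ fun C τ n P θ ω => ∀ i, E i C τ n P θ ω := by
  have := Fintype.ofFinite ι
  intro δ hδ
  have hδ' : 0 < δ / Fintype.card ι := ENNReal.div_pos hδ.ne' (ENNReal.natCast_ne_top _)
  choose C₀ hC₀ using fun i => h i _ hδ'
  obtain ⟨B, hB⟩ := (Set.finite_range C₀).bddAbove
  refine ⟨B, fun C hC τ hτ => ?_⟩
  have := eventually_all.2 fun i => hC₀ i C ((hB ⟨i, rfl⟩).trans hC) τ hτ
  filter_upwards [this] with n hn P hP θ hθ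
  have e : {ω | ¬ ∀ i, E i C τ n P θ ω} = ⋃ i, {ω | ¬ E i C τ n P θ ω} := by
    ext ω
    simp
  rw [e]
  refine (measure_iUnion_fintype_le _ _).trans
    ((Finset.sum_le_sum fun i _ => hn i P hP θ hθ).trans ?_)
  rw [Finset.sum_const, Finset.card_univ, nsmul_eq_mul]
  exact ENNReal.mul_div_le

theorem Likely.and (h : Likely Pr Θ E) (h' : Likely Pr Θ E') :
    Likely Pr Θ fun C τ n P θ ω => E C τ n P θ ω ∧ E' C τ n P θ ω := by
  refine (Likely.forall (ι := Bool) (E := fun b => bif b then E else E') ?_).mono ?_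
  · rintro (_ | _)
    · exact h'
    · exact h
  · intro C τ _ _
    refine Eventually.of_forall fun n P _ θ _ => Eventually.of_forall fun ω hω => ?_
    exact ⟨hω true, hω false⟩

theorem likely_of_tendsto_supProb {B : ∀ n, ProbabilityMeasure (Ω n) → Coef K → Set (Ω n)}
    (h : Tendsto (supProb Pr Θ B) atTop (𝓝 0)) :
    Likely Pr Θ fun _ _ n P θ ω => ω ∉ B n P θ := by
  intro δ hδ
  refine ⟨0, fun C _ τ _ => ?_⟩
  filter_upwards [h.eventually (gt_mem_nhds hδ)] with n hn P hP θ hθ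
  simp only [not_not]
  refine le_trans ?_ hn.le
  exact (le_iSup₂_of_le θ hθ le_rfl).trans
    (le_iSup₂ (f := fun P (_ : P ∈ Pr n) => ⨆ θ ∈ Θ n, (P : Measure (Ω n)) (B n P θ)) P hP)

theorem likely_of_unifBigO {a : ∀ n, ProbabilityMeasure (Ω n) → Coef K → Ω n → ℝ≥0∞}
    {r : ℕ → ℝ} (h : UnifBigO Pr Θ a r) :
    Likely Pr Θ fun C _ n P θ ω => a n P θ ω ≤ ENNReal.ofReal (C * r n) := by
  intro δ hδ
  obtain ⟨ε, hε, hεδ⟩ := ENNReal.lt_iff_exists_nnreal_btwn.1 hδ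
  obtain ⟨C₀, hC₀⟩ := h ε (by exact_mod_cast hε)
  refine ⟨C₀, fun C hC τ _ => ?_⟩
  filter_upwards [eventually_lt_of_limsup_lt (hC₀.trans_lt hεδ)] with n hn P hP θ hθ
  refine le_trans (measure_mono ?_) (((le_iSup₂_of_le θ hθ le_rfl).trans
    (le_iSup₂ (f := fun P (_ : P ∈ Pr n) => ⨆ θ ∈ Θ n, (P : Measure (Ω n))
      {ω | (C₀ : ℝ≥0∞) ≤ a n P θ ω / ENNReal.ofReal (r n)}) P hP)).trans hn.le)
  intro ω hω
  simp only [Set.mem_ofPred_eq, not_le] at hω ⊢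
  rw [ENNReal.le_div_iff_mul_le (Or.inr (bot_le.trans_lt hω).ne') (Or.inl ENNReal.ofReal_ne_top)]
  refine le_trans ?_ hω.le
  rw [ENNReal.ofReal_mul (C₀.2.trans hC)]
  gcongr
  rw [← ENNReal.ofReal_coe_nnreal]
  exact ENNReal.ofReal_le_ofReal hC

theorem likely_of_unifLittleO {a : ∀ n, ProbabilityMeasure (Ω n) → Coef K → Ω n → ℝ≥0∞}
    {r : ℕ → ℝ} (h : UnifLittleO Pr Θ a r) :
    Likely Pr Θ fun _ τ n P θ ω => a n P θ ω ≤ ENNReal.ofReal (τ * r n) := by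
  intro δ hδ
  refine ⟨0, fun C _ τ hτ => ?_⟩
  have h1 := likely_of_tendsto_supProb (h τ.toNNReal (Real.toNNReal_pos.2 hτ)) δ hδ
  obtain ⟨C₀, hC₀⟩ := h1
  filter_upwards [hC₀ C₀ le_rfl τ hτ] with n hn P hP θ hθ
  refine le_trans (measure_mono ?_) (hn P hP θ hθ)
  intro ω hω
  simp only [Set.mem_ofPred_eq, not_le] at hω ⊢
  rw [not_lt, ENNReal.le_div_iff_mul_le (Or.inr (bot_le.trans_lt hω).ne') (Or.inl ENNReal.ofReal_ne_top)]
  refine le_trans (le_of_eq ?_) hω.le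
  rw [ENNReal.ofReal_mul hτ.le]
  rfl

theorem unifBigO_of_forall_exists {a : ∀ n, ProbabilityMeasure (Ω n) → Coef K → Ω n → ℝ≥0∞}
    {r : ℕ → ℝ} (hr : ∀ᶠ n in atTop, 0 < r n)
    (h : ∀ δ : ℝ≥0∞, 0 < δ → ∃ C : ℝ, ∀ᶠ n in atTop, ∀ P ∈ Pr n, ∀ θ ∈ Θ n,
      (P : Measure (Ω n)) {ω | ¬ a n P θ ω ≤ ENNReal.ofReal (C * r n)} ≤ δ) :
    UnifBigO Pr Θ a r := by
  intro ε hε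
  obtain ⟨C, hC⟩ := h ε (by exact_mod_cast hε)
  refine ⟨(|C| + 1).toNNReal, limsup_le_of_le (by isBoundedDefault) ?_⟩
  filter_upwards [hC, hr] with n hn hrn
  refine iSup₂_le fun P hP => iSup₂_le fun θ hθ => ?_
  refine le_trans (measure_mono ?_) (hn P hP θ hθ)
  intro ω hω hle
  simp only [Set.mem_ofPred_eq] at hω
  rw [ENNReal.le_div_iff_mul_le (Or.inl (ENNReal.ofReal_pos.2 hrn).ne')
    (Or.inl ENNReal.ofReal_ne_top)] at hω
  have h1 : ENNReal.ofReal ((|C| + 1) * r n) ≤ ENNReal.ofReal (|C| * r n) := by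
    rw [ENNReal.ofReal_mul (by positivity)]
    exact (hω.trans hle).trans (ENNReal.ofReal_le_ofReal (by gcongr; exact le_abs_self C))
  rw [ENNReal.ofReal_le_ofReal_iff (by positivity)] at h1
  nlinarith

theorem unifLittleO_one_of_forall {a : ∀ n, ProbabilityMeasure (Ω n) → Coef K → Ω n → ℝ}
    (h : ∀ δ : ℝ≥0∞, 0 < δ → ∀ τ : ℝ, 0 < τ → ∀ᶠ n in atTop, ∀ P ∈ Pr n, ∀ θ ∈ Θ n,
      (P : Measure (Ω n)) {ω | ¬ |a n P θ ω| ≤ τ} ≤ δ) :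
    UnifLittleO Pr Θ (fun n P θ ω => ‖a n P θ ω‖ₑ) fun _ => 1 := by
  intro ε hε
  rw [ENNReal.tendsto_nhds_zero]
  intro δ hδ
  have hε' : (0 : ℝ) < ε := hε
  filter_upwards [h δ hδ (ε / 2) (by positivity)] with n hn
  refine iSup₂_le fun P hP => iSup₂_le fun θ hθ => ?_
  refine le_trans (measure_mono ?_) (hn P hP θ hθ)
  intro ω hω hle
  simp only [Set.mem_ofPred_eq, ENNReal.ofReal_one, div_one] at hω
  rw [Real.enorm_eq_ofReal_abs, ← ENNReal.ofReal_coe_nnreal,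
    ENNReal.ofReal_le_ofReal_iff (abs_nonneg _)] at hω
  linarith

theorem unifStdNormal_of_eventually {a : ∀ n, ProbabilityMeasure (Ω n) → Coef K → Ω n → ℝ}
    (h : ∀ x δ : ℝ, 0 < δ → ∀ᶠ n in atTop, ∀ P ∈ Pr n, ∀ θ ∈ Θ n,
      |(P : Measure (Ω n)).real {ω | a n P θ ω ≤ x} - cdf (gaussianReal 0 1) x| ≤ δ) :
    UnifStdNormal Pr Θ a := by
  intro x
  rw [ENNReal.tendsto_nhds_zero]
  intro δ hδ
  obtain ⟨δ', hδ', hlt⟩ := ENNReal.lt_iff_exists_nnreal_btwn.1 hδ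
  filter_upwards [h x δ' (by exact_mod_cast hδ')] with n hn
  refine iSup₂_le fun P hP => iSup₂_le fun θ hθ => le_trans ?_ hlt.le
  rw [Real.enorm_eq_ofReal_abs, ← ENNReal.ofReal_coe_nnreal]
  exact ENNReal.ofReal_le_ofReal (hn P hP θ hθ)

theorem le_of_ofReal_le_ofReal {x y : ℝ} (hy : 0 ≤ y) (h : ENNReal.ofReal x ≤ ENNReal.ofReal y) :
    x ≤ y :=
  (ENNReal.ofReal_le_ofReal_iff hy).1 h

theorem abs_le_of_enorm_le_ofReal {x y : ℝ} (hy : 0 ≤ y) (h : ‖x‖ₑ ≤ ENNReal.ofReal y) :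
    |x| ≤ y := by
  rw [Real.enorm_eq_ofReal_abs] at h
  exact le_of_ofReal_le_ofReal hy h

theorem le_mul_of_inv_ofReal_le {x y C : ℝ} (hC : 0 ≤ C) (hx : 0 ≤ x) (hy : 0 ≤ y)
    (h : (ENNReal.ofReal x)⁻¹ ≤ ENNReal.ofReal (C * y⁻¹)) : y ≤ C * x := by
  rcases hy.eq_or_lt with h0 | hy
  · rw [← h0]; positivity
  rcases hx.eq_or_lt with h0 | hx
  · rw [← h0, ENNReal.ofReal_zero, ENNReal.inv_zero, top_le_iff] at h
    exact absurd h ENNReal.ofReal_ne_top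
  rw [← ENNReal.ofReal_inv_of_pos hx] at h
  have h1 := le_of_ofReal_le_ofReal (by positivity) h
  rw [← div_eq_mul_inv, inv_eq_one_div, div_le_div_iff₀ hx hy] at h1
  linarith

end Likely

/-! ### Regular draws are likely -/

section LikelyDraw

variable {Ω : ℕ → Type*} [∀ n, MeasurableSpace (Ω n)] {K R : ℕ} {N T : ℕ → ℕ}
  {D : ∀ n, FactorPanel (Ω n) (N n) (T n) K} {Pr : ∀ n, Set (ProbabilityMeasure (Ω n))}
  {Θ : ℕ → Set (Coef K)} {c : ℕ → ℝ}

theorem isUnit_and_sqrt_le_of_invNorm_le {ι : Type*} [Fintype ι] [DecidableEq ι]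
    {G : Matrix ι ι ℝ} {x : ℝ} (hx : 0 ≤ x) (h : invNorm G ≤ ENNReal.ofReal x) :
    IsUnit G.det ∧ √(∑ k, ∑ l, G⁻¹ k l ^ 2) ≤ x := by
  classical
  unfold invNorm at h
  split_ifs at h with hu
  · refine ⟨by convert hu, ?_⟩
    convert le_of_ofReal_le_ofReal hx h
  · exact absurd (top_le_iff.1 h) ENNReal.ofReal_ne_top

theorem maxRoot_nonneg (N T : ℕ) : 0 ≤ maxRoot N T := le_max_of_le_left (Real.sqrt_nonneg _)

theorem likely_hasDecomposition (hc : ∀ n, 0 < c n) {j : Fin (K + 1)}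
    (h : RegressorDecomposition Pr Θ D c j) :
    Likely Pr Θ fun C τ n _ _ ω => HasDecomposition ((D n).W ω) j (c n) C τ := by
  obtain ⟨π, H, V, heq, hV, hsV, hH, hHV, hW, hG, hmV, hmW⟩ := h
  have hW1 := Likely.forall fun k : {k // k ≠ j} => likely_of_unifBigO (hW k k.2).1
  have hW2 := Likely.forall fun k : {k // k ≠ j} => likely_of_unifBigO (hW k k.2).2
  have hmW' := Likely.forall fun k : {k // k ≠ j} => likely_of_unifLittleO (hmW k k.2)
  refine ((likely_of_unifBigO hV.1).and <| (likely_of_unifBigO hV.2).and <|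
    (likely_of_unifBigO hsV).and <| (likely_of_unifBigO hH).and <| (likely_of_unifBigO hHV).and <|
    hW1.and <| hW2.and <| (likely_of_unifBigO hG).and <| (likely_of_unifLittleO hmV).and
    hmW').mono ?_
  intro C τ hC hτ
  have hC0 : 0 ≤ C := by linarith
  refine Eventually.of_forall fun n P hP θ _ => ?_
  have hcn := hc n
  filter_upwards [(heq n P hP).2.2] with ω hω ⟨h1, h2, h3, h4, h5, h6, h7, h8, h9, h10⟩
  have hmax := maxRoot_nonneg (N n) (T n)
  obtain ⟨hu, hinv⟩ := isUnit_and_sqrt_le_of_invNorm_le (by positivity) h8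
  exact ⟨π n P, H n P ω, V n P ω, hω, le_of_ofReal_le_ofReal (by positivity) h1,
    le_mul_of_inv_ofReal_le hC0 (frob_nonneg _) (Real.sqrt_nonneg _) h2,
    le_of_ofReal_le_ofReal (mul_nonneg hC0 hmax) h3, le_of_ofReal_le_ofReal (by positivity) h4,
    abs_le_of_enorm_le_ofReal (by positivity) h5,
    fun k hk => le_of_ofReal_le_ofReal (by positivity) (h6 ⟨k, hk⟩),
    fun k hk => abs_le_of_enorm_le_ofReal (by positivity) (h7 ⟨k, hk⟩), hu, hinv,
    le_of_ofReal_le_ofReal (by positivity) h9,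
    fun k hk => le_of_ofReal_le_ofReal (by positivity) (h10 ⟨k, hk⟩)⟩

/-- The assumptions on the factor model and the regressors make a draw regular with high
probability. -/
theorem likely_regularDraw (hN : Tendsto N atTop atTop) (hT : Tendsto T atTop atTop)
    (hc : ∀ n, 0 < c n) (hrank : RankBound Pr D R) (hNC : NonCollinear Pr Θ D R)
    (hSN : SpectralNorms Pr Θ D) (hEX : Exogeneity Pr Θ D) (hLSV : LeadingSingularValues Pr Θ D)
    (hdec : ∀ j, RegressorDecomposition Pr Θ D c j) :
    ∃ κ : ℝ, 0 < κ ∧ Likely Pr Θ fun C τ n _ _ ω =>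
      RegularDraw R ((D n).W ω) ((D n).Γ ω) ((D n).U ω) (c n) κ C τ := by
  obtain ⟨s2, hs2, hs⟩ := hNC
  refine ⟨√s2, Real.sqrt_pos.2 hs2, ?_⟩
  have h1 := likely_of_tendsto_supProb hs
  have h2 := Likely.forall fun k => likely_of_unifBigO (hSN.1 k)
  have h3 := likely_of_unifBigO hSN.2.1
  have h4 := likely_of_unifBigO hSN.2.2
  have h5 := Likely.forall fun k => likely_of_unifBigO (hEX k)
  have h6 := likely_of_unifLittleO (hLSV (2 * R + 1) (by omega))
  have h7 := Likely.forall fun j => likely_hasDecomposition hc (hdec j)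
  refine (h1.and <| h2.and <| h3.and <| h4.and <| h5.and <| h6.and h7).mono ?_
  intro C τ hC hτ
  have hC0 : 0 ≤ C := by linarith
  filter_upwards [hN.eventually_ge_atTop 1, hT.eventually_ge_atTop 1] with n hn1 hn2 P hP θ _
  have hNT : 0 < (N n : ℝ) * T n := by
    have : 0 < (N n : ℝ) := by exact_mod_cast hn1
    have : 0 < (T n : ℝ) := by exact_mod_cast hn2
    positivity
  have hS : 0 < √((N n : ℝ) * T n) := Real.sqrt_pos.2 hNT
  have hmax := maxRoot_nonneg (N n) (T n)
  filter_upwards [hrank n P hP] with ω hω ⟨g1, g2, g3, g4, g5, g6, g7⟩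
  refine ⟨hω, fun γ hγ => ?_, fun k => le_of_ofReal_le_ofReal (by positivity) (g2 k),
    le_of_ofReal_le_ofReal (mul_nonneg hC0 hmax) g3,
    le_mul_of_inv_ofReal_le hC0 (sv_nonneg _ _) hmax g4, fun k => ?_, ?_, g7⟩
  · simp only [Set.mem_compl_iff, not_not, Set.mem_ofPred_eq] at g1
    have := g1 γ hγ
    rw [Real.sq_sqrt hs2.le]
    rw [one_div, ← div_eq_inv_mul, le_div_iff₀ hNT] at this
    exact this
  · have := abs_le_of_enorm_le_ofReal (by positivity) (g5 k)
    rw [mul_one, abs_mul, abs_of_pos (by positivity), one_div, ← div_eq_inv_mul,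
      div_le_iff₀ hS] at this
    exact this
  · have := (le_abs_self _).trans (abs_le_of_enorm_le_ofReal (by positivity) g6)
    rw [mul_one] at this
    rcases (sv_nonneg 1 ((D n).U ω)).eq_or_lt with h0 | h0
    · rw [← h0]
      have := sv_nonneg (2 * R + 1) ((D n).U ω)
      linarith
    · exact (div_le_iff₀ h0).1 this

/-! ### Noise terms -/

variable {M σ : ℝ} [∀ n, StandardBorelSpace (Ω n)]

/-- The errors, listed by their index pairs. -/
def FactorPanel.errors {Ω : Type*} [MeasurableSpace Ω] {N T K : ℕ}
    (D : FactorPanel Ω N T K) (p : Fin N × Fin T) (ω : Ω) : ℝ := D.U ω p.1 p.2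

/-- The conditional variances, listed by their index pairs. -/
def FactorPanel.variances {Ω : Type*} [MeasurableSpace Ω] {N T K : ℕ}
    (D : FactorPanel Ω N T K) (P : Measure Ω) (ω : Ω) (p : Fin N × Fin T) : ℝ :=
  D.condVar P p.1 p.2 ω

/-- Under the regular conditional probability given `(W, Γ)`, the errors are almost surely
independent noise with fourth moments at most `M`, and their variances are at least `σ²`. -/
def NoisyErrors (Pr : ∀ n, Set (ProbabilityMeasure (Ω n)))
    (D : ∀ n, FactorPanel (Ω n) (N n) (T n) K) (σ M : ℝ) : Prop :=
  ∀ n, ∀ P ∈ Pr n, ∀ᵐ ω ∂(P : Measure (Ω n)),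
    IsNoise (condExpKernel (P : Measure (Ω n)) (D n).info ω) (D n).errors
      ((D n).variances (P : Measure (Ω n)) ω) M ∧
    ∀ p, σ ^ 2 ≤ (D n).variances (P : Measure (Ω n)) ω p

theorem measurable_errors {Ω : Type*} [MeasurableSpace Ω] {N T K : ℕ} (D : FactorPanel Ω N T K)
    (p : Fin N × Fin T) : Measurable (D.errors p) :=
  (measurable_pi_apply p.2).comp ((measurable_pi_apply p.1).comp D.measurable_U)

theorem measurable_variances {Ω : Type*} [MeasurableSpace Ω] {N T K : ℕ}
    (D : FactorPanel Ω N T K) (P : Measure Ω) : Measurable[D.info] (D.variances P) :=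
  @measurable_pi_lambda _ _ _ D.info _ _ fun _ => stronglyMeasurable_condExp.measurable

theorem exists_noisyErrors (hU : CondIndepErrors Pr D) :
    ∃ σ M : ℝ, 0 < σ ∧ 0 < M ∧ NoisyErrors Pr D σ M := by
  obtain ⟨σ, η, hσ, hη, h⟩ := hU
  refine ⟨σ, 1 / η, hσ, by positivity, fun n P hP => ?_⟩
  obtain ⟨hind, hUn⟩ := h n P hP
  have h1 := ae_isNoise (M := 1 / η) (D n).info_le (measurable_errors (D n)) hind
    (fun p => (hUn p.1 p.2).1) (fun p => (hUn p.1 p.2).2.1)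
    fun p => (hUn p.1 p.2).2.2.2.mono fun _ hω => hω.le
  have h2 : ∀ᵐ ω ∂(P : Measure (Ω n)), ∀ p, σ ^ 2 ≤ (D n).variances (P : Measure (Ω n)) ω p :=
    ae_all_iff.2 fun p => (hUn p.1 p.2).2.2.1.mono fun _ hω => hω.le
  exact h1.and h2

/-- The weights for the `j`-th regressor, listed by their index pairs. -/
def FactorPanel.weights {Ω : Type*} [MeasurableSpace Ω] {N T K : ℕ} {c : ℝ}
    (D : FactorPanel Ω N T K) (F : Procedure N T K R c) (j : Fin (K + 1)) (ω : Ω)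
    (p : Fin N × Fin T) : ℝ := F.weights j (D.W ω) p.1 p.2

theorem measurable_weights {Ω : Type*} [MeasurableSpace Ω] {N T K : ℕ} {c : ℝ}
    (D : FactorPanel Ω N T K) (F : Procedure N T K R c) (j : Fin (K + 1)) :
    Measurable[D.info] (D.weights F j) := by
  have h1 : Measurable[D.info] fun ω => (D.W ω, D.Γ ω) := comap_measurable _
  have h2 : Measurable fun (x : Regressors N T K × Panel N T) (p : Fin N × Fin T) =>
      F.weights j x.1 p.1 p.2 :=
    measurable_pi_lambda _ fun p => (measurable_pi_apply p.2).comp ((measurable_pi_apply p.1).comp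
      ((F.measurable_weights j).comp measurable_fst))
  exact h2.comp h1

variable {F : ∀ n, Procedure (N n) (T n) K R (c n)}

theorem likely_abs_ip_weights_le (hU : NoisyErrors Pr D σ M) (j : Fin (K + 1)) :
    Likely Pr Θ fun C _ n _ _ ω =>
      |ip ((F n).weights j ((D n).W ω)) ((D n).U ω)| ≤ C * frob ((F n).weights j ((D n).W ω)) := by
  intro δ hδ
  have hlim : Tendsto (fun C : ℝ => ENNReal.ofReal ((1 + M) / C ^ 2)) atTop (𝓝 0) := by
    rw [← ENNReal.ofReal_zero]
    exact ENNReal.tendsto_ofReal (tendsto_const_nhds.div_atTop (tendsto_pow_atTop two_ne_zero))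
  obtain ⟨C₀, hC₀⟩ := eventually_atTop.1 (hlim.eventually (gt_mem_nhds hδ))
  refine ⟨max C₀ 1, fun C hC τ _ => Eventually.of_forall fun n P hP θ _ => ?_⟩
  have hC0 : 0 < C := by linarith [(le_max_right C₀ 1).trans hC]
  have h1 := measure_abs_sum_le_of_ae_isNoise (D n).info_le (measurable_errors (D n))
    ((hU n P hP).mono fun _ hω => hω.1) (measurable_weights (D n) (F n) j) hC0
  refine le_trans (le_of_eq ?_) (h1.trans (hC₀ C ((le_max_left _ _).trans hC)).le)
  simp only [not_le, Fintype.sum_prod_type, FactorPanel.weights, FactorPanel.errors]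
  rfl

theorem likely_abs_sum_sq_weights_sub_le (hU : NoisyErrors Pr D σ M) (hM : 0 < M)
    (hc : Tendsto c atTop (𝓝 0)) :
    Likely Pr Θ fun _ τ n P _ ω =>
      IsFeasibleWeight ((D n).W ω) 0 (c n) ((F n).weights 0 ((D n).W ω)) →
      |∑ i, ∑ t, (F n).weights 0 ((D n).W ω) i t ^ 2 * (D n).U ω i t ^ 2 -
        ∑ i, ∑ t, (F n).weights 0 ((D n).W ω) i t ^ 2 *
          (D n).condVar (P : Measure (Ω n)) i t ω| ≤
        τ * frob ((F n).weights 0 ((D n).W ω)) ^ 2 := by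
  intro δ hδ
  refine ⟨0, fun C _ τ hτ => ?_⟩
  have hlim : Tendsto (fun n => ENNReal.ofReal (c n * M / τ ^ 2)) atTop (𝓝 0) := by
    rw [← ENNReal.ofReal_zero]
    refine ENNReal.tendsto_ofReal ?_
    simpa using (hc.mul_const M).div_const (τ ^ 2)
  filter_upwards [hlim.eventually (gt_mem_nhds hδ)] with n hn P hP θ _
  have h1 := measure_abs_sum_sq_le_of_ae_isNoise (D n).info_le (measurable_errors (D n))
    ((hU n P hP).mono fun _ hω => hω.1) (measurable_variances (D n) (P : Measure (Ω n)))
    (measurable_weights (D n) (F n) 0) (c := c n) hτ hM.le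
  refine le_trans (measure_mono fun ω hω => ?_) (h1.trans hn.le)
  simp only [Set.mem_ofPred_eq, Classical.not_imp, not_le] at hω
  simp only [Fintype.sum_prod_type, FactorPanel.weights, FactorPanel.errors,
    FactorPanel.variances, Set.mem_ofPred_eq]
  have h2 := hω.2
  rw [frob_sq] at h2
  refine ⟨fun p => ?_, h2⟩
  rw [← frob_sq]
  exact hω.1.sq_le p.1 p.2

end LikelyDraw

/-! ### Consistency of the standard error and the rate of convergence -/

section Outcome

variable {Ω : Type*} [MeasurableSpace Ω] {K R N T : ℕ} {c : ℝ}

/-- The conditional standard deviation `√(∑_{i,t} A_{it}^2 σ_{it}^2)` of the noise term `⟨A, U⟩`. -/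
def FactorPanel.sd (D : FactorPanel Ω N T K) (F : Procedure N T K R c) (P : Measure Ω) (ω : Ω) :
    ℝ :=
  √(∑ i, ∑ t, F.weights 0 (D.W ω) i t ^ 2 * D.condVar P i t ω)

/-- A draw on which the procedure behaves as intended: the weights are feasible, the least squares
residuals and the debiased estimator are accurate up to the constant `C`, the bias bound is valid,
and the weighted sum of squared errors is within the tolerance `τ` of its conditional mean. -/
structure GoodOutcome (D : FactorPanel Ω N T K) (F : Procedure N T K R c) (P : Measure Ω)
    (θ : Coef K) (ε σ C τ : ℝ) (ω : Ω) : Prop where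
  feasible : IsFeasibleWeight (D.W ω) 0 c (F.weights 0 (D.W ω))
  residual : frob (F.UHat (D.Y θ ω, D.W ω) - D.U ω) ≤ C * maxRoot N T
  rate : |F.betaHat (D.Y θ ω, D.W ω) - θ 0| ≤ C / minRoot N T ^ 2
  bias : |F.betaHat (D.Y θ ω, D.W ω) - θ 0 - ip (F.weights 0 (D.W ω)) (D.U ω)| ≤
    F.biasBound ε (D.Y θ ω, D.W ω)
  variance : |∑ i, ∑ t, F.weights 0 (D.W ω) i t ^ 2 * D.U ω i t ^ 2 -
    ∑ i, ∑ t, F.weights 0 (D.W ω) i t ^ 2 * D.condVar P i t ω| ≤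
      τ * frob (F.weights 0 (D.W ω)) ^ 2
  le_condVar : ∀ i t, σ ^ 2 ≤ D.condVar P i t ω

variable {D : FactorPanel Ω N T K} {F : Procedure N T K R c} {P : Measure Ω} {θ : Coef K}
  {ε σ C τ : ℝ} {ω : Ω}

theorem GoodOutcome.frob_pos (h : GoodOutcome D F P θ ε σ C τ ω) :
    0 < frob (F.weights 0 (D.W ω)) :=
  lt_of_le_of_ne (frob_nonneg _) fun h0 =>
    ne_zero_of_isFeasibleWeight h.feasible (frob_eq_zero.1 h0.symm)

theorem GoodOutcome.sq_mul_le (h : GoodOutcome D F P θ ε σ C τ ω) :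
    σ ^ 2 * frob (F.weights 0 (D.W ω)) ^ 2 ≤
      ∑ i, ∑ t, F.weights 0 (D.W ω) i t ^ 2 * D.condVar P i t ω := by
  rw [frob_sq, Finset.mul_sum]
  refine Finset.sum_le_sum fun i _ => ?_
  rw [Finset.mul_sum]
  refine Finset.sum_le_sum fun t _ => ?_
  rw [mul_comm]
  exact mul_le_mul_of_nonneg_left (h.le_condVar i t) (sq_nonneg _)

theorem GoodOutcome.sd_pos (h : GoodOutcome D F P θ ε σ C τ ω) (hσ : 0 < σ) :
    0 < D.sd F P ω := by
  refine Real.sqrt_pos.2 (lt_of_lt_of_le ?_ h.sq_mul_le)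
  have := h.frob_pos
  positivity

theorem GoodOutcome.abs_se_div_sd_sub_one_le (h : GoodOutcome D F P θ ε σ C τ ω) (hσ : 0 < σ)
    (hC : 0 ≤ C) (hc : 0 ≤ c) (hτ : 0 ≤ τ) :
    |F.se (D.Y θ ω, D.W ω) / D.sd F P ω - 1| ≤ τ / σ ^ 2 + √c * (C * maxRoot N T) / σ := by
  have hs2 : D.sd F P ω ^ 2 = ∑ i, ∑ t, F.weights 0 (D.W ω) i t ^ 2 * D.condVar P i t ω :=
    Real.sq_sqrt ((by positivity : 0 ≤ σ ^ 2 * frob (F.weights 0 (D.W ω)) ^ 2).trans h.sq_mul_le)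
  have key := abs_se_div_sub_one_le (A := F.weights 0 (D.W ω)) (U := D.U ω)
    (E := F.UHat (D.Y θ ω, D.W ω) - D.U ω) hc (mul_nonneg hC (maxRoot_nonneg N T)) hσ
    (h.sd_pos hσ) hτ h.feasible.sq_le h.residual (by rw [hs2]; exact h.sq_mul_le)
    (by rw [hs2]; exact h.variance)
  rwa [add_sub_cancel] at key

end Outcome

section Asymptotics

variable {Ω : ℕ → Type*} [∀ n, MeasurableSpace (Ω n)] {K R : ℕ}
  {N T : ℕ → ℕ} {D : ∀ n, FactorPanel (Ω n) (N n) (T n) K}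
  {Pr : ∀ n, Set (ProbabilityMeasure (Ω n))} {Θ : ℕ → Set (Coef K)} {c : ℕ → ℝ}
  {F : ∀ n, Procedure (N n) (T n) K R (c n)} {ε σ M κ : ℝ}

/-- Good outcomes have a uniformly high probability: for every level `δ` there is a constant such
that outcomes fail to be good with probability at most `δ`. -/
def GoodOutcomesLikely (Pr : ∀ n, Set (ProbabilityMeasure (Ω n))) (Θ : ℕ → Set (Coef K))
    (D : ∀ n, FactorPanel (Ω n) (N n) (T n) K) (F : ∀ n, Procedure (N n) (T n) K R (c n))
    (ε σ : ℝ) : Prop :=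
  ∀ δ : ℝ≥0∞, 0 < δ → ∃ C : ℝ, 0 < C ∧ ∀ τ : ℝ, 0 < τ → ∀ᶠ n in atTop,
    ∀ P ∈ Pr n, ∀ θ ∈ Θ n, (P : Measure (Ω n))
      {ω | ¬ GoodOutcome (D n) (F n) (P : Measure (Ω n)) θ ε σ C τ ω} ≤ δ

theorem tendsto_minRoot (hN : Tendsto N atTop atTop) (hT : Tendsto T atTop atTop) :
    Tendsto (fun n => minRoot (N n) (T n)) atTop atTop :=
  tendsto_atTop.2 fun b => by
    filter_upwards [(Real.tendsto_sqrt_atTop.comp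
        (tendsto_natCast_atTop_atTop.comp hN)).eventually_ge_atTop b,
      (Real.tendsto_sqrt_atTop.comp
        (tendsto_natCast_atTop_atTop.comp hT)).eventually_ge_atTop b] with n h1 h2
    exact le_min h1 h2

theorem tendsto_lindeberg_bound (hN : Tendsto N atTop atTop) (hc_pos : ∀ n, 0 < c n)
    (hc : Tendsto (fun n => c n * max (N n : ℝ) (T n)) atTop (𝓝 0)) : Tendsto c atTop (𝓝 0) := by
  refine squeeze_zero' (Eventually.of_forall fun n => (hc_pos n).le) ?_ hc
  filter_upwards [hN.eventually_ge_atTop 1] with n hn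
  refine le_mul_of_one_le_right (hc_pos n).le (le_max_of_le_left ?_)
  exact_mod_cast hn

/-- On good outcomes the standard error is close to the conditional standard deviation. -/
theorem GoodOutcomesLikely.eventually_abs_se_div_sd_sub_one_le
    (h : GoodOutcomesLikely Pr Θ D F ε σ) (hσ : 0 < σ) (hc_pos : ∀ n, 0 < c n)
    (hc : Tendsto (fun n => c n * max (N n : ℝ) (T n)) atTop (𝓝 0)) {δ : ℝ≥0∞} (hδ : 0 < δ)
    {τ : ℝ} (hτ : 0 < τ) :
    ∃ C : ℝ, ∀ᶠ n in atTop, ∀ P ∈ Pr n, ∀ θ ∈ Θ n, (P : Measure (Ω n))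
      {ω | ¬ (GoodOutcome (D n) (F n) (P : Measure (Ω n)) θ ε σ C (τ * σ ^ 2 / 2) ω ∧
        |(F n).se ((D n).Y θ ω, (D n).W ω) / (D n).sd (F n) (P : Measure (Ω n)) ω - 1| ≤ τ)} ≤
          δ := by
  obtain ⟨C, hC, hgood⟩ := h δ hδ
  have hlim : Tendsto (fun n => √(c n) * (C * maxRoot (N n) (T n)) / σ) atTop (𝓝 0) := by
    have h1 := ((Real.continuous_sqrt.tendsto 0).comp hc).const_mul (C / σ)
    rw [Real.sqrt_zero, mul_zero] at h1
    refine h1.congr fun n => ?_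
    rw [Function.comp_apply, ← maxRoot_sq, Real.sqrt_mul (hc_pos n).le,
      Real.sqrt_sq (maxRoot_nonneg _ _)]
    ring
  refine ⟨C, ?_⟩
  filter_upwards [hgood (τ * σ ^ 2 / 2) (by positivity),
    hlim.eventually (gt_mem_nhds (half_pos hτ))] with n hn hlt P hP θ hθ
  refine (measure_mono fun ω hω => ?_).trans (hn P hP θ hθ)
  intro hg
  refine hω ⟨hg, ?_⟩
  refine (hg.abs_se_div_sd_sub_one_le hσ hC.le (hc_pos n).le (by positivity)).trans ?_
  have : τ * σ ^ 2 / 2 / σ ^ 2 = τ / 2 := by field_simp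
  linarith

theorem GoodOutcomesLikely.unifLittleO_se (h : GoodOutcomesLikely Pr Θ D F ε σ) (hσ : 0 < σ)
    (hc_pos : ∀ n, 0 < c n)
    (hc : Tendsto (fun n => c n * max (N n : ℝ) (T n)) atTop (𝓝 0)) :
    UnifLittleO Pr Θ (fun n P θ ω => ‖(F n).se ((D n).Y θ ω, (D n).W ω) /
      (D n).sd (F n) (P : Measure (Ω n)) ω - 1‖ₑ) fun _ => 1 := by
  refine unifLittleO_one_of_forall fun δ hδ τ hτ => ?_
  obtain ⟨C, hC⟩ := h.eventually_abs_se_div_sd_sub_one_le hσ hc_pos hc hδ hτ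
  filter_upwards [hC] with n hn P hP θ hθ
  refine (measure_mono fun ω hω => ?_).trans (hn P hP θ hθ)
  exact fun hg => hω hg.2

theorem GoodOutcomesLikely.unifBigO_betaHat (h : GoodOutcomesLikely Pr Θ D F ε σ)
    (hN : Tendsto N atTop atTop) (hT : Tendsto T atTop atTop) :
    UnifBigO Pr Θ (fun n _ θ ω => ‖(F n).betaHat ((D n).Y θ ω, (D n).W ω) - θ 0‖ₑ)
      fun n => 1 / min (N n : ℝ) (T n) := by
  refine unifBigO_of_forall_exists ?_ fun δ hδ => ?_
  · filter_upwards [hN.eventually_ge_atTop 1, hT.eventually_ge_atTop 1] with n h1 h2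
    have : 0 < (N n : ℝ) := by exact_mod_cast h1
    have : 0 < (T n : ℝ) := by exact_mod_cast h2
    positivity
  · obtain ⟨C, hC, hgood⟩ := h δ hδ
    refine ⟨C, ?_⟩
    filter_upwards [hgood 1 one_pos] with n hn P hP θ hθ
    refine (measure_mono fun ω hω => ?_).trans (hn P hP θ hθ)
    intro hg
    refine hω ?_
    rw [Real.enorm_eq_ofReal_abs, ← minRoot_sq, ← div_eq_mul_one_div]
    exact ENNReal.ofReal_le_ofReal hg.rate

variable [∀ n, StandardBorelSpace (Ω n)]

/-- The deterministic bounds for the procedure hold on every regular draw on which the noise terms are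
of their usual order. -/
theorem goodOutcomesLikely (hN : Tendsto N atTop atTop) (hT : Tendsto T atTop atTop)
    (hc_pos : ∀ n, 0 < c n) (hc : Tendsto c atTop (𝓝 0)) (hε : 0 < ε) (hκ : 0 < κ) (hM : 0 < M)
    (hreg : Likely Pr Θ fun C τ n _ _ ω =>
      RegularDraw R ((D n).W ω) ((D n).Γ ω) ((D n).U ω) (c n) κ C τ)
    (hU : NoisyErrors Pr D σ M) : GoodOutcomesLikely Pr Θ D F ε σ := by
  intro δ hδ
  have hlike := hreg.and ((Likely.forall fun j =>
    likely_abs_ip_weights_le (Θ := Θ) (F := F) hU j).and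
      (likely_abs_sum_sq_weights_sub_le (Θ := Θ) (F := F) hU hM hc))
  obtain ⟨C₀, hC₀⟩ := hlike δ hδ
  obtain ⟨C₁, ν₀, τ₀, hC₁, hτ₀, hproc⟩ :=
    procedure_bounds K R (C := max C₀ 1) (le_max_right _ _) hκ hε
  refine ⟨C₁, hC₁, fun τ hτ => ?_⟩
  have hτ' : 0 < min τ τ₀ := lt_min hτ hτ₀
  filter_upwards [hC₀ (max C₀ 1) (le_max_left _ _) (min τ τ₀) hτ',
    (tendsto_minRoot hN hT).eventually_ge_atTop ν₀] with n hn hν P hP θ hθ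
  refine (measure_mono_ae ?_).trans (hn P hP θ hθ)
  filter_upwards [hU n P hP] with ω hω hbad
  rintro ⟨h1, h2, h3⟩
  obtain ⟨g1, g2, g3, g4⟩ := hproc (F n) θ (hc_pos n) hτ'.le (min_le_right _ _) hν h1 h2
  exact hbad ⟨g1, g2, g3, g4,
    (h3 g1).trans (mul_le_mul_of_nonneg_right (min_le_left _ _) (sq_nonneg _)),
    fun i t => hω.2 (i, t)⟩

/-! ### Asymptotic normality -/

/-- The infeasible self-normalized noise term `⟨A, U⟩ / √(∑_{i,t} A_{it}^2 σ_{it}^2)`. -/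
def FactorPanel.normalizedNoise {Ω : Type*} [MeasurableSpace Ω] {K R N T : ℕ} {c : ℝ}
    (D : FactorPanel Ω N T K) (F : Procedure N T K R c) (P : Measure Ω) (ω : Ω) : ℝ :=
  ip (F.weights 0 (D.W ω)) (D.U ω) / D.sd F P ω

theorem normalizedNoise_eq {Ω : Type*} [MeasurableSpace Ω] {K R N T : ℕ} {c : ℝ}
    (D : FactorPanel Ω N T K) (F : Procedure N T K R c) (P : Measure Ω) (ω : Ω) :
    D.normalizedNoise F P ω = (∑ p, D.weights F 0 ω p * D.errors p ω) /
      √(∑ p, D.weights F 0 ω p ^ 2 * D.variances P ω p) := by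
  simp only [Fintype.sum_prod_type, FactorPanel.normalizedNoise, FactorPanel.sd, ip,
    FactorPanel.weights, FactorPanel.errors, FactorPanel.variances]

theorem measurable_normalizedNoise {Ω : Type*} [MeasurableSpace Ω] {K R N T : ℕ} {c : ℝ}
    (D : FactorPanel Ω N T K) (F : Procedure N T K R c) (P : Measure Ω) :
    Measurable (D.normalizedNoise F P) := by
  have h1 : Measurable (D.weights F 0) := (measurable_weights D F 0).mono D.info_le le_rfl
  have h2 : Measurable (D.variances P) := (measurable_variances D P).mono D.info_le le_rfl
  have h3 := measurable_errors D
  simp only [funext (normalizedNoise_eq D F P)]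
  fun_prop

/-- The noise term, normalized by its conditional standard deviation, is uniformly asymptotically
standard normal. -/
theorem GoodOutcomesLikely.eventually_abs_normalizedNoise_le
    (h : GoodOutcomesLikely Pr Θ D F ε σ) (hσ : 0 < σ) (hM : 0 < M) (hU : NoisyErrors Pr D σ M)
    (hc_pos : ∀ n, 0 < c n) (hc : Tendsto c atTop (𝓝 0)) (x : ℝ) {δ : ℝ} (hδ : 0 < δ) :
    ∀ᶠ n in atTop, ∀ P ∈ Pr n, ∀ θ ∈ Θ n,
      |(P : Measure (Ω n)).real {ω | (D n).normalizedNoise (F n) (P : Measure (Ω n)) ω ≤ x} -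
        cdf (gaussianReal 0 1) x| ≤ δ := by
  have key := eventually_abs_cdf_sub_le (fun n => Pr n ×ˢ Θ n)
    (fun n q => q.1.map (f := (D n).normalizedNoise (F n) (q.1 : Measure (Ω n)))
      (measurable_normalizedNoise (D n) (F n) (q.1 : Measure (Ω n))).aemeasurable) ?_ x hδ
  · filter_upwards [key] with n hn P hP θ hθ
    have := hn (P, θ) ⟨hP, hθ⟩
    rwa [ProbabilityMeasure.toMeasure_map, map_measureReal_apply
      (measurable_normalizedNoise (D n) (F n) (P : Measure (Ω n))) measurableSet_Iic] at this
  intro t δ hδ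
  obtain ⟨k, hk, hkt⟩ : ∃ k : ℝ, 0 < k ∧ 2 * k * t ^ 2 ≤ δ / 3 := by
    refine ⟨δ / (6 * (t ^ 2 + 1)), by positivity, ?_⟩
    rw [show 2 * (δ / (6 * (t ^ 2 + 1))) * t ^ 2 = δ / 3 * (t ^ 2 / (t ^ 2 + 1)) by
      field_simp; ring]
    exact mul_le_of_le_one_right (by positivity)
      ((div_le_one (by positivity)).2 (by linarith))
  have hlim : Tendsto (fun n => (2 / k + 1 / 4) * (t ^ 4 * (c n * M / σ ^ 4))) atTop (𝓝 0) := by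
    have := (((hc.mul_const M).div_const (σ ^ 4)).const_mul (t ^ 4)).const_mul (2 / k + 1 / 4)
    simpa using this
  obtain ⟨C, -, hgood⟩ := h (ENNReal.ofReal (δ / 6)) (by positivity)
  filter_upwards [hgood 1 one_pos, hlim.eventually (gt_mem_nhds (by positivity : 0 < δ / 3))]
    with n hn hlt ⟨P, θ⟩ ⟨hP, hθ⟩
  have h1 := norm_charFun_sub_le_of_ae_isNoise (D n).info_le (measurable_errors (D n))
    ((hU n P hP).mono fun _ hω => hω.1) (measurable_variances (D n) (P : Measure (Ω n)))
    (measurable_weights (D n) (F n) 0) (hc_pos n).le hM.le hσ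
    ((hU n P hP).mono fun _ hω => hω.2) t hk
  simp only [← normalizedNoise_eq] at h1
  refine h1.trans ?_
  have h2 : (P : Measure (Ω n)).real {ω | (∀ p, (D n).weights (F n) 0 ω p ^ 2 ≤
      c n * ∑ p, (D n).weights (F n) 0 ω p ^ 2) ∧ 0 < ∑ p, (D n).weights (F n) 0 ω p ^ 2}ᶜ ≤
      δ / 6 := by
    refine ENNReal.toReal_le_of_le_ofReal (by positivity)
      ((measure_mono fun ω hω => ?_).trans (hn P hP θ hθ))
    intro hg
    refine hω ?_
    simp only [Fintype.sum_prod_type, FactorPanel.weights, Set.mem_ofPred_eq]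
    rw [← frob_sq]
    exact ⟨fun p => hg.feasible.sq_le p.1 p.2, pow_pos hg.frob_pos 2⟩
  linarith

end Asymptotics

section Inference

variable {Ω : ℕ → Type*} [∀ n, MeasurableSpace (Ω n)] [∀ n, StandardBorelSpace (Ω n)] {K R : ℕ}
  {N T : ℕ → ℕ} {D : ∀ n, FactorPanel (Ω n) (N n) (T n) K}
  {Pr : ∀ n, Set (ProbabilityMeasure (Ω n))} {Θ : ℕ → Set (Coef K)} {c : ℕ → ℝ}
  {F : ∀ n, Procedure (N n) (T n) K R (c n)} {ε σ M : ℝ}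

/-- Replacing the conditional standard deviation by the standard error does not affect the limiting
distribution. -/
theorem GoodOutcomesLikely.eventually_abs_ip_div_se_le
    (h : GoodOutcomesLikely Pr Θ D F ε σ) (hσ : 0 < σ) (hM : 0 < M) (hU : NoisyErrors Pr D σ M)
    (hN : Tendsto N atTop atTop) (hc_pos : ∀ n, 0 < c n)
    (hc : Tendsto (fun n => c n * max (N n : ℝ) (T n)) atTop (𝓝 0)) (x : ℝ) {δ : ℝ}
    (hδ : 0 < δ) :
    ∀ᶠ n in atTop, ∀ P ∈ Pr n, ∀ θ ∈ Θ n,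
      |(P : Measure (Ω n)).real {ω | ip ((F n).weights 0 ((D n).W ω)) ((D n).U ω) /
        (F n).se ((D n).Y θ ω, (D n).W ω) ≤ x} - cdf (gaussianReal 0 1) x| ≤ δ := by
  have hc0 := tendsto_lindeberg_bound hN hc_pos hc
  -- the standard error may change the threshold `x` by at most `|x| τ`
  obtain ⟨τ, hτ, hτ1, hτx⟩ : ∃ τ : ℝ, 0 < τ ∧ τ < 1 ∧ ∀ y, |y - x| ≤ |x| * τ →
      |cdf (gaussianReal 0 1) y - cdf (gaussianReal 0 1) x| ≤ δ / 3 := by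
    obtain ⟨r, hr, hrx⟩ := Metric.continuousAt_iff.1
      (continuous_cdf_gaussianReal.continuousAt (x := x)) (δ / 3) (by positivity)
    refine ⟨min (1 / 2) (r / (2 * (|x| + 1))), by positivity,
      (min_le_left _ _).trans_lt (by norm_num), fun y hy => (hrx ?_).le⟩
    rw [Real.dist_eq]
    calc |y - x| ≤ |x| * min (1 / 2) (r / (2 * (|x| + 1))) := hy
      _ ≤ |x| * (r / (2 * (|x| + 1))) := by gcongr; exact min_le_right _ _
      _ = |x| / (|x| + 1) * (r / 2) := by field_simp
      _ ≤ 1 * (r / 2) := by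
        gcongr
        exact (div_le_one (by positivity)).2 (by linarith)
      _ < r := by linarith
  have hx1 := hτx (x + |x| * τ) (by rw [add_sub_cancel_left, abs_mul, abs_abs, abs_of_pos hτ])
  have hx2 := hτx (x - |x| * τ) (by
    rw [sub_sub_cancel_left, abs_neg, abs_mul, abs_abs, abs_of_pos hτ])
  obtain ⟨C, hC⟩ := h.eventually_abs_se_div_sd_sub_one_le hσ hc_pos hc
    (δ := ENNReal.ofReal (δ / 3)) (by positivity) hτ
  filter_upwards [hC,
    h.eventually_abs_normalizedNoise_le hσ hM hU hc_pos hc0 (x + |x| * τ)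
      (δ := δ / 3) (by positivity),
    h.eventually_abs_normalizedNoise_le hσ hM hU hc_pos hc0 (x - |x| * τ)
      (δ := δ / 3) (by positivity)] with n hn hn1 hn2 P hP θ hθ
  have hbad := ENNReal.toReal_le_of_le_ofReal (by positivity) (hn P hP θ hθ)
  have h1 := hn1 P hP θ hθ
  have h2 := hn2 P hP θ hθ
  obtain ⟨B, hB⟩ : ∃ B, B = {ω | ¬ (GoodOutcome (D n) (F n) (P : Measure (Ω n)) θ ε σ C
      (τ * σ ^ 2 / 2) ω ∧ |(F n).se ((D n).Y θ ω, (D n).W ω) /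
        (D n).sd (F n) (P : Measure (Ω n)) ω - 1| ≤ τ)} := ⟨_, rfl⟩
  have key : ∀ ω ∉ B, ∃ ρ : ℝ, |ρ - 1| ≤ τ ∧
      ((ip ((F n).weights 0 ((D n).W ω)) ((D n).U ω) /
        (F n).se ((D n).Y θ ω, (D n).W ω) ≤ x) ↔
        (D n).normalizedNoise (F n) (P : Measure (Ω n)) ω ≤ x * ρ) := by
    intro ω hω
    rw [hB, Set.mem_ofPred_eq, not_not] at hω
    obtain ⟨hg, hρ⟩ := hω
    have hs := hg.sd_pos hσ
    have hρ0 : 0 < (F n).se ((D n).Y θ ω, (D n).W ω) /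
        (D n).sd (F n) (P : Measure (Ω n)) ω := by
      have := (abs_le.1 hρ).1
      linarith
    have hse : 0 < (F n).se ((D n).Y θ ω, (D n).W ω) := by
      rwa [div_pos_iff_of_pos_right hs] at hρ0
    refine ⟨_, hρ, ?_⟩
    rw [FactorPanel.normalizedNoise, div_le_iff₀ hse, div_le_iff₀ hs, mul_assoc,
      div_mul_cancel₀ _ hs.ne']
  have hρx : ∀ ρ : ℝ, |ρ - 1| ≤ τ → |x * ρ - x| ≤ |x| * τ := by
    intro ρ hρ
    rw [show x * ρ - x = x * (ρ - 1) by ring, abs_mul]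
    gcongr
  have hup : (P : Measure (Ω n)).real {ω | ip ((F n).weights 0 ((D n).W ω)) ((D n).U ω) /
        (F n).se ((D n).Y θ ω, (D n).W ω) ≤ x} ≤
      (P : Measure (Ω n)).real {ω | (D n).normalizedNoise (F n) (P : Measure (Ω n)) ω ≤
        x + |x| * τ} + (P : Measure (Ω n)).real B := by
    refine (measureReal_mono (fun ω hω => ?_)).trans (measureReal_union_le _ _)
    by_cases hωB : ω ∈ B
    · exact Or.inr hωB
    · obtain ⟨ρ, hρ, hiff⟩ := key ω hωB
      have := (abs_le.1 (hρx ρ hρ)).2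
      exact Or.inl ((hiff.1 hω).trans (by linarith))
  have hlow : (P : Measure (Ω n)).real {ω | (D n).normalizedNoise (F n) (P : Measure (Ω n)) ω ≤
        x - |x| * τ} ≤
      (P : Measure (Ω n)).real {ω | ip ((F n).weights 0 ((D n).W ω)) ((D n).U ω) /
        (F n).se ((D n).Y θ ω, (D n).W ω) ≤ x} + (P : Measure (Ω n)).real B := by
    refine (measureReal_mono (fun ω hω => ?_)).trans (measureReal_union_le _ _)
    by_cases hωB : ω ∈ B
    · exact Or.inr hωB
    · obtain ⟨ρ, hρ, hiff⟩ := key ω hωB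
      have := (abs_le.1 (hρx ρ hρ)).1
      rw [Set.mem_ofPred_eq] at hω
      exact Or.inl (hiff.2 (by linarith))
  have hbad' : (P : Measure (Ω n)).real B ≤ δ / 3 := by rw [hB]; exact hbad
  rw [abs_le] at h1 h2 hx1 hx2 ⊢
  constructor <;> linarith [h1.1, h1.2, h2.1, h2.2, hx1.1, hx1.2, hx2.1, hx2.2]

/-! ### Coverage of the confidence interval -/

theorem cdf_gaussianReal_neg (x : ℝ) :
    cdf (gaussianReal 0 1) (-x) = 1 - cdf (gaussianReal 0 1) x := by
  have := nullSingletonClass_gaussianReal (μ := 0) one_ne_zero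
  rw [cdf_eq_real, cdf_eq_real, ← probReal_compl_eq_one_sub measurableSet_Iic, Set.compl_Iic]
  have h1 : (gaussianReal 0 1).map (fun y => -y) = gaussianReal 0 1 := by
    rw [gaussianReal_map_neg, neg_zero]
  conv_lhs => rw [← h1]
  rw [map_measureReal_apply measurable_neg measurableSet_Iic]
  have h2 : (fun y : ℝ => -y) ⁻¹' Set.Iic (-x) = Set.Ici x := by
    ext y
    simp
  rw [h2]
  exact (measureReal_congr Ioi_ae_eq_Ici).symm

theorem le_cdf_normalQuantile {p : ℝ} (h0 : 0 < p) (h1 : p < 1) :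
    p ≤ cdf (gaussianReal 0 1) (normalQuantile p) := by
  have hclosed : IsClosed {x : ℝ | p ≤ cdf (gaussianReal 0 1) x} :=
    isClosed_le continuous_const continuous_cdf_gaussianReal
  refine hclosed.csInf_mem ?_ ?_
  · obtain ⟨x, hx⟩ := ((tendsto_cdf_atTop (gaussianReal 0 1)).eventually (lt_mem_nhds h1)).exists
    exact ⟨x, hx.le⟩
  · obtain ⟨x, hx⟩ := ((tendsto_cdf_atBot (gaussianReal 0 1)).eventually (gt_mem_nhds h0)).exists
    refine ⟨x, fun y hy => ?_⟩
    by_contra hlt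
    exact absurd (hy.trans ((cdf (gaussianReal 0 1)).mono (not_le.1 hlt).le)) (not_le.2 hx)

theorem mem_CI_of_abs_le {N T K R : ℕ} {c ε α β n : ℝ} {F : Procedure N T K R c}
    {d : Panel N T × Regressors N T K} (h : |F.betaHat d - β - n| ≤ F.biasBound ε d)
    (hn : |n| ≤ normalQuantile (1 - α / 2) * F.se d) : β ∈ F.CI ε α d := by
  rw [abs_le] at h hn
  constructor <;> linarith [h.1, h.2, hn.1, hn.2]

/-- On good outcomes the confidence interval covers the coefficient whenever the self-normalized
noise term does not exceed the normal quantile in absolute value. -/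
theorem GoodOutcomesLikely.le_liminf_measure_CI (h : GoodOutcomesLikely Pr Θ D F ε σ)
    (hσ : 0 < σ) (hM : 0 < M) (hU : NoisyErrors Pr D σ M) (hN : Tendsto N atTop atTop)
    (hc_pos : ∀ n, 0 < c n)
    (hc : Tendsto (fun n => c n * max (N n : ℝ) (T n)) atTop (𝓝 0)) {α : ℝ} (hα0 : 0 < α)
    (hα1 : α < 1) :
    ENNReal.ofReal (1 - α) ≤ liminf (fun n => ⨅ P ∈ Pr n, ⨅ θ ∈ Θ n, (P : Measure (Ω n))
      {ω | θ 0 ∈ (F n).CI ε α ((D n).Y θ ω, (D n).W ω)}) atTop := by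
  refine le_of_forall_lt fun b hb => ?_
  obtain ⟨b', hbb', hb'⟩ := exists_between hb
  refine hbb'.trans_le (le_liminf_of_le (by isBoundedDefault) ?_)
  have hb'top : b' ≠ ⊤ := hb'.ne_top
  have hb'r : b'.toReal < 1 - α := by
    have := (ENNReal.toReal_lt_toReal hb'top ENNReal.ofReal_ne_top).2 hb'
    rwa [ENNReal.toReal_ofReal (by linarith)] at this
  set z := normalQuantile (1 - α / 2) with hz
  have hz1 : 1 - α / 2 ≤ cdf (gaussianReal 0 1) z :=
    le_cdf_normalQuantile (by linarith) (by linarith)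
  have hz2 := cdf_gaussianReal_neg z
  obtain ⟨δ, hδ⟩ : ∃ δ : ℝ, δ = (1 - α - b'.toReal) / 3 := ⟨_, rfl⟩
  have hδ0 : 0 < δ := by rw [hδ]; linarith
  obtain ⟨C, hC⟩ := h.eventually_abs_se_div_sd_sub_one_le hσ hc_pos hc
    (δ := ENNReal.ofReal δ) (by positivity) (τ := 1 / 2) (by norm_num)
  filter_upwards [hC, h.eventually_abs_ip_div_se_le hσ hM hU hN hc_pos hc z hδ0,
    h.eventually_abs_ip_div_se_le hσ hM hU hN hc_pos hc (-z) hδ0] with n hn hn1 hn2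
  refine le_iInf₂ fun P hP => le_iInf₂ fun θ hθ => ?_
  have hbad := ENNReal.toReal_le_of_le_ofReal hδ0.le (hn P hP θ hθ)
  have h1 := hn1 P hP θ hθ
  have h2 := hn2 P hP θ hθ
  obtain ⟨B, hB⟩ : ∃ B, B = {ω | ¬ (GoodOutcome (D n) (F n) (P : Measure (Ω n)) θ ε σ C
      (1 / 2 * σ ^ 2 / 2) ω ∧ |(F n).se ((D n).Y θ ω, (D n).W ω) /
        (D n).sd (F n) (P : Measure (Ω n)) ω - 1| ≤ 1 / 2)} := ⟨_, rfl⟩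
  have hbad' : (P : Measure (Ω n)).real B ≤ δ := by rw [hB]; exact hbad
  have hcover : (P : Measure (Ω n)).real
      {ω | ip ((F n).weights 0 ((D n).W ω)) ((D n).U ω) /
        (F n).se ((D n).Y θ ω, (D n).W ω) ≤ z} ≤
      (P : Measure (Ω n)).real {ω | θ 0 ∈ (F n).CI ε α ((D n).Y θ ω, (D n).W ω)} +
      (P : Measure (Ω n)).real {ω | ip ((F n).weights 0 ((D n).W ω)) ((D n).U ω) /
        (F n).se ((D n).Y θ ω, (D n).W ω) ≤ -z} + (P : Measure (Ω n)).real B := by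
    refine (measureReal_mono (fun ω hω => ?_)).trans ((measureReal_union_le _ _).trans
      (add_le_add_left (measureReal_union_le _ _) _))
    by_cases hωB : ω ∈ B
    · exact Or.inr hωB
    refine Or.inl ?_
    rw [Set.mem_ofPred_eq] at hω
    rcases le_or_gt (ip ((F n).weights 0 ((D n).W ω)) ((D n).U ω) /
        (F n).se ((D n).Y θ ω, (D n).W ω)) (-z) with hle | hgt
    · exact Or.inr hle
    refine Or.inl ?_
    rw [hB, Set.mem_ofPred_eq, not_not] at hωB
    obtain ⟨hg, hρ⟩ := hωB
    have hs := hg.sd_pos hσ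
    have hse : 0 < (F n).se ((D n).Y θ ω, (D n).W ω) := by
      rw [← div_pos_iff_of_pos_right hs]
      have := (abs_le.1 hρ).1
      linarith
    refine mem_CI_of_abs_le hg.bias ?_
    rw [div_le_iff₀ hse] at hω
    rw [lt_div_iff₀ hse] at hgt
    rw [abs_le, ← hz]
    constructor <;> linarith
  rw [abs_le] at h1 h2
  have hfinal : b'.toReal ≤
      (P : Measure (Ω n)).real {ω | θ 0 ∈ (F n).CI ε α ((D n).Y θ ω, (D n).W ω)} := by
    linarith [h1.1, h2.2]
  exact (ENNReal.toReal_le_toReal hb'top (measure_ne_top _ _)).1 hfinal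

end Inference

end PanelDebias

end

theorem mainTheorem4 {Ω : ℕ → Type*} [∀ n, MeasurableSpace (Ω n)] [∀ n, StandardBorelSpace (Ω n)]
    (K R : ℕ) (N T : ℕ → ℕ) (hN : Tendsto N atTop atTop) (hT : Tendsto T atTop atTop)
    (D : ∀ n, PanelDebias.FactorPanel (Ω n) (N n) (T n) K)
    (Pr : ∀ n, Set (ProbabilityMeasure (Ω n))) (Θ : ℕ → Set (PanelDebias.Coef K))
    (c : ℕ → ℝ) (hc_pos : ∀ n, 0 < c n)
    (hc : Tendsto (fun n => c n * max (N n : ℝ) (T n)) atTop (𝓝 0))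
    (ε : ℝ) (hε : 0 < ε)
    (F : ∀ n, PanelDebias.Procedure (N n) (T n) K R (c n))
    (hrank : PanelDebias.RankBound Pr D R)
    (hNC : PanelDebias.NonCollinear Pr Θ D R)
    (hSN : PanelDebias.SpectralNorms Pr Θ D)
    (hEX : PanelDebias.Exogeneity Pr Θ D)
    (hLSV : PanelDebias.LeadingSingularValues Pr Θ D)
    (hdec : ∀ j, PanelDebias.RegressorDecomposition Pr Θ D c j)
    (hU : PanelDebias.CondIndepErrors Pr D) :
    -- consistency of the standard error
    PanelDebias.UnifLittleO Pr Θ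
      (fun n P θ ω => ‖(F n).se ((D n).Y θ ω, (D n).W ω) /
        Real.sqrt (∑ i, ∑ t, (F n).A ((D n).Y θ ω, (D n).W ω) i t ^ 2 *
          (D n).condVar (P : Measure (Ω n)) i t ω) - 1‖ₑ) (fun _ => 1) ∧
    -- uniform asymptotic normality of the self-normalized noise term
    PanelDebias.UnifStdNormal Pr Θ
      (fun n _ θ ω => PanelDebias.ip ((F n).A ((D n).Y θ ω, (D n).W ω)) ((D n).U ω) /
        (F n).se ((D n).Y θ ω, (D n).W ω)) ∧
    -- rate of convergence
    PanelDebias.UnifBigO Pr Θ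
      (fun n _ θ ω => ‖(F n).betaHat ((D n).Y θ ω, (D n).W ω) - θ 0‖ₑ)
      (fun n => 1 / min (N n : ℝ) (T n)) ∧
    -- uniform asymptotic validity of the bias-aware confidence interval
    ∀ α : ℝ, 0 < α → α < 1 →
      ENNReal.ofReal (1 - α) ≤
        liminf (fun n => ⨅ P ∈ Pr n, ⨅ θ ∈ Θ n,
          (P : Measure (Ω n))
            {ω | θ 0 ∈ (F n).CI ε α ((D n).Y θ ω, (D n).W ω)}) atTop := by
  obtain ⟨κ, hκ, hreg⟩ := PanelDebias.likely_regularDraw hN hT hc_pos hrank hNC hSN hEX hLSV hdec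
  obtain ⟨σ, M, hσ, hM, hnoise⟩ := PanelDebias.exists_noisyErrors hU
  have hc0 := PanelDebias.tendsto_lindeberg_bound hN hc_pos hc
  have hgood : PanelDebias.GoodOutcomesLikely Pr Θ D F ε σ :=
    PanelDebias.goodOutcomesLikely hN hT hc_pos hc0 hε hκ hM hreg hnoise
  exact ⟨hgood.unifLittleO_se hσ hc_pos hc,
    PanelDebias.unifStdNormal_of_eventually fun x _ hδ =>
      hgood.eventually_abs_ip_div_se_le hσ hM hnoise hN hc_pos hc x hδ,
    hgood.unifBigO_betaHat hN hT,
    fun _ hα0 hα1 => hgood.le_liminf_measure_CI hσ hM hnoise hN hc_pos hc hα0 hα1⟩
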